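/- Let $V=\mathbb{C}[x_1,x_2,\dots]$ be the free bosonic vertex algebra: with $\alpha_n=n\,\partial/\partial x_n$ for $n>0$, $\alpha_0=0$, $\alpha_{-n}=x_n\cdot$ for $n>0$, and $\alpha(z)=\sum_{n\in\mathbb{Z}}\alpha_n z^{-n-1}$, the vacuum vector is $1$ and the products $a_{(n)}b$, defined by $Y(a,z)=\sum_{n}a_{(n)}z^{-n-1}$, are given by the linear map $Y$ with $Y(x_{i_1}\cdots x_{i_r},z)={:}\partial^{(i_1-1)}\alpha(z)\cdots\partial^{(i_r-1)}\alpha(z){:}$, where $\partial^{(k)}=\partial_z^k/k!$ and $:\ :$ is the nested normally ordered product. The translation is $Ta=a_{(-2)}1$. A conformal vector is a non-zero $v\in V$ such that, for some $c\in\mathbb{C}$, $v_{(n)}v=0$ for $n\ge 4$, $v_{(3)}v=\frac{c}{2}1$, $v_{(2)}v=0$, $v_{(1)}v=2v$, $v_{(0)}v=Tv$, and such that, writing $L_n=v_{(n+1)}$, the operator $L_0$ is semisimple (diagonalizable) and $L_{-1}=T$. An automorphism of $V$ is a linear automorphism preserving all products $a_{(n)}b$; it is inner if it is of the form $\exp(a_{(m)})$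 for some $m\ge 0$ and $a\in V$ with $a_{(0)}=\cdots=a_{(m-1)}=0$, where the exponential series is required to make sense (for each $b\in V$ the vectors $a_{(m)}^n b$ span a finite-dimensional space, in which the series converges). Let $v$ be a conformal vector of $V$, and let $E,H,F$ be the standard basis of $sl_2(\mathbb{C})$. Then $E\mapsto -L_1$, $H\mapsto -2L_0$, $F\mapsto L_{-1}$ defines an $sl_2(\mathbb{C})$-module structure on $V$. This module is completely reducible if and only if $v$ is the image of $\frac12x_1^2$ under an inner automorphism of $V$. If it is not completely reducible, then the $sl_2(\mathbb{C})$-submodule of $V$ generated by $x_1$ is isomorphic to the dual Verma module $M^*(0)$, i.e. the restricted dual $\bigoplus_\mu (M(0)_\mu)^*$ (over the $H$-weights $\mu$) of the Verma module $M(0)$ of highest weight $0$, with action $(xf)(m)=f(x^{\mathsf T}m)$, where $x\mapsto x^{\mathsf T}$ is matrix transposition. -/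

import Mathlib

/-! # The free bosonic vertex algebra, its conformal vectors and inner automorphisms -/

-- Bracket on associative algebras (matrices, endomorphisms): the commutator.
attribute [local instance 100] LieRing.ofAssociativeRing

noncomputable section

namespace FreeBoson

/-! ## Fields on a vector space

A field `A(z) = ∑ A_(n) z^(-n-1)` on a vector space `M` is a Mathlib `VertexOperator ℂ M`; its
Fourier mode `A_(n)` is `VertexOperator.ncoeff A n`. -/

section Fields

variable {M : Type*} [AddCommGroup M] [Module ℂ M]

/-- The field with given Fourier modes `f n`. -/
def ofModes (f : ℤ → Module.End ℂ M) (hf : ∀ u, ∃ N : ℤ, ∀ n, N ≤ n → f n u = 0) :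
    VertexOperator ℂ M :=
  VertexOperator.of_coeff (fun n => f (-n - 1)) (by
    intro u
    obtain ⟨N, hN⟩ := hf u
    refine ⟨-N, fun n hn => ?_⟩
    by_contra h
    exact hn (hN _ (by omega)))

@[simp]
theorem ncoeff_ofModes (f : ℤ → Module.End ℂ M) (hf) (n : ℤ) :
    VertexOperator.ncoeff (ofModes f hf) n = f n := by
  rw [ofModes, VertexOperator.ncoeff_of_coeff]
  congr 1
  ring

theorem exists_ncoeff_eq_zero (A : VertexOperator ℂ M) (u : M) :
    ∃ N : ℤ, ∀ n, N ≤ n → VertexOperator.ncoeff A n u = 0 := by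
  refine ⟨-HahnSeries.order ((HahnModule.of ℂ).symm (A u)), fun n hn => ?_⟩
  exact VertexOperator.ncoeff_eq_zero_of_lt_order A n u (by omega)

/-- The identity field `I(z) = id`. -/
def idField : VertexOperator ℂ M :=
  ofModes (fun n => if n = -1 then 1 else 0) (fun _ => ⟨0, fun n hn => by
    rw [if_neg (by omega)]; rfl⟩)

/-- The divided derivative `∂^(k) A(z) = (1/k!) ∂^k A(z)`: since
`∂^(k) z^(-m-1) = binom(-m-1, k) z^(-m-1-k)`, its `n`-th mode is `binom(k-n-1, k) A_(n-k)`. -/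
def dividedDeriv (k : ℕ) (A : VertexOperator ℂ M) : VertexOperator ℂ M :=
  ofModes (fun n => ((Ring.choose ((k : ℤ) - n - 1) k : ℤ) : ℂ) •
      VertexOperator.ncoeff A (n - k)) (fun u => by
    obtain ⟨N, hN⟩ := exists_ncoeff_eq_zero A u
    refine ⟨N + k, fun n hn => ?_⟩
    rw [LinearMap.smul_apply, hN _ (by omega), smul_zero])

theorem finite_support_creation (A B : VertexOperator ℂ M) (n : ℤ) (u : M) :
    (Function.support fun i : ℕ => VertexOperator.ncoeff A (-(i : ℤ) - 1)
      (VertexOperator.ncoeff B (n + i) u)).Finite := by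
  obtain ⟨N, hN⟩ := exists_ncoeff_eq_zero B u
  refine (Set.finite_lt_nat (N - n).toNat).subset fun i hi => ?_
  by_contra h
  simp only [Set.mem_ofPred_eq] at h
  exact hi (by simp only [hN (n + i) (by omega), map_zero])

theorem finite_support_annihilation (A B : VertexOperator ℂ M) (n : ℤ) (u : M) :
    (Function.support fun i : ℕ => VertexOperator.ncoeff B (n - 1 - i)
      (VertexOperator.ncoeff A i u)).Finite := by
  obtain ⟨N, hN⟩ := exists_ncoeff_eq_zero A u
  refine (Set.finite_lt_nat N.toNat).subset fun i hi => ?_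
  by_contra h
  simp only [Set.mem_ofPred_eq] at h
  exact hi (by simp only [hN i (by omega), map_zero])

/-- The `n`-th mode of the normally ordered product `:A(z)B(z): = A(z)₋ B(z) + B(z) A(z)₊`, where
`A(z)₋` collects the modes `A_(j)` with `j < 0` and `A(z)₊` those with `j ≥ 0`, namely
`∑_{j<0} A_(j) B_(n-j-1) + ∑_{j≥0} B_(n-j-1) A_(j)` (both sums are finite on each vector). -/
def normalOrderMode (A B : VertexOperator ℂ M) (n : ℤ) : Module.End ℂ M where
  toFun u :=
    (∑ᶠ i : ℕ, VertexOperator.ncoeff A (-(i : ℤ) - 1) (VertexOperator.ncoeff B (n + i) u)) +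
      ∑ᶠ i : ℕ, VertexOperator.ncoeff B (n - 1 - i) (VertexOperator.ncoeff A i u)
  map_add' u w := by
    simp only [map_add]
    rw [finsum_add_distrib (finite_support_creation A B n u) (finite_support_creation A B n w),
      finsum_add_distrib (finite_support_annihilation A B n u)
        (finite_support_annihilation A B n w)]
    abel
  map_smul' c u := by
    simp only [map_smul, RingHom.id_apply, smul_add]
    rw [smul_finsum, smul_finsum]

/-- The normally ordered product `:A(z)B(z):`. -/
def normalOrder (A B : VertexOperator ℂ M) : VertexOperator ℂ M :=
  ofModes (normalOrderMode A B) (fun u => by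
    obtain ⟨N, hN⟩ := exists_ncoeff_eq_zero B u
    obtain ⟨K, hK⟩ := exists_ncoeff_eq_zero A u
    choose P hP using fun i : ℕ => exists_ncoeff_eq_zero B (VertexOperator.ncoeff A i u)
    obtain ⟨Q, hQ⟩ := (((Finset.range K.toNat).image fun i : ℕ => P i + 1 + i)).bddAbove
    refine ⟨max N Q, fun n hn => ?_⟩
    have h1 : ∀ i : ℕ, VertexOperator.ncoeff A (-(i : ℤ) - 1)
        (VertexOperator.ncoeff B (n + i) u) = 0 := fun i => by
      rw [hN _ (by have := le_max_left N Q; omega), map_zero]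
    have h2 : ∀ i : ℕ, VertexOperator.ncoeff B (n - 1 - i)
        (VertexOperator.ncoeff A i u) = 0 := fun i => by
      by_cases hi : i < K.toNat
      · have hm : P i + 1 + (i : ℤ) ≤ Q := hQ (by
          simp only [Finset.coe_image, Finset.coe_range, Set.mem_image, Set.mem_Iio]
          exact ⟨i, hi, rfl⟩)
        exact hP i _ (by have := le_max_right N Q; omega)
      · rw [hK i (by omega), map_zero]
    simp only [normalOrderMode, LinearMap.coe_mk, AddHom.coe_mk, h1, h2, finsum_zero, add_zero])

/-- The nested normally ordered product `:A¹(z) ⋯ Aʳ(z): = :A¹(z) (:A²(z) ⋯ Aʳ(z):):`; the empty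
product is the identity field. -/
def nestedNormalOrder : List (VertexOperator ℂ M) → VertexOperator ℂ M
  | [] => idField
  | A :: l => normalOrder A (nestedNormalOrder l)

end Fields

/-! ## The free bosonic vertex algebra -/

/-- The underlying space `ℂ[x₁, x₂, …]` of the vacuum (charge `0`) Fock representation. The variable
`x_{k+1}` is `MvPolynomial.X k`, for `k : ℕ`. -/
abbrev Fock : Type := MvPolynomial ℕ ℂ

/-- The Heisenberg operators: `α_n = n ∂/∂x_n` for `n > 0`, `α_0 = 0`, and `α_n` is multiplication
by `x_{-n}` for `n < 0`. -/
def alpha : ℤ → Module.End ℂ Fock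
  | Int.ofNat 0 => 0
  | Int.ofNat (k + 1) => ((k : ℂ) + 1) • (MvPolynomial.pderiv k).toLinearMap
  | Int.negSucc k => LinearMap.mulLeft ℂ (MvPolynomial.X k)

theorem exists_alpha_eq_zero (u : Fock) : ∃ N : ℤ, ∀ n, N ≤ n → alpha n u = 0 := by
  obtain ⟨K, hK⟩ := u.vars.bddAbove
  refine ⟨K + 2, fun n hn => ?_⟩
  obtain ⟨k, rfl⟩ : ∃ k : ℕ, n = Int.ofNat (k + 1) := ⟨(n - 1).toNat, by
    simp only [Int.ofNat_eq_natCast]; omega⟩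
  have hk : k ∉ u.vars := fun h => by
    have := hK h
    simp only [Int.ofNat_eq_natCast] at hn
    omega
  change ((k : ℂ) + 1) • MvPolynomial.pderiv k u = 0
  rw [MvPolynomial.pderiv_eq_zero_of_notMem_vars hk, smul_zero]

/-- The Heisenberg field `α(z) = ∑ α_n z^(-n-1)`. -/
def alphaField : VertexOperator ℂ Fock := ofModes alpha exists_alpha_eq_zero

/-- The state–field correspondence of the free bosonic vertex algebra, the linear map with
`Y(x_{k₁+1} ⋯ x_{kᵣ+1}, z) = :∂^(k₁)α(z) ⋯ ∂^(kᵣ)α(z):`. (The result does not depend on the order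
of the factors; they are listed with `k₁ ≤ ⋯ ≤ kᵣ`.) -/
def Y : Fock →ₗ[ℂ] VertexOperator ℂ Fock :=
  (MvPolynomial.basisMonomials ℕ ℂ).constr ℂ fun s =>
    nestedNormalOrder ((s.toMultiset.sort (· ≤ ·)).map fun k => dividedDeriv k alphaField)

/-- The operator `a_(n)`; thus `mode a n b` is the `n`-th product `a_(n) b`. -/
def mode (a : Fock) (n : ℤ) : Module.End ℂ Fock := VertexOperator.ncoeff (Y a) n

/-- The translation `T a = a_(-2) 1`; the vacuum vector is `1`. -/
def translation (a : Fock) : Fock := mode a (-2) 1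

/-! ## Conformal vectors -/

/-- Virasoro vectors of central charge `c`. -/
structure IsVirasoroVector (c : ℂ) (v : Fock) : Prop where
  ne_zero : v ≠ 0
  mode_ge_four : ∀ n : ℤ, 4 ≤ n → mode v n v = 0
  mode_three : mode v 3 v = (c / 2) • (1 : Fock)
  mode_two : mode v 2 v = 0
  mode_one : mode v 1 v = (2 : ℂ) • v
  mode_zero : mode v 0 v = translation v

/-- The operators `L_n = v_(n+1)`. -/
def virasoroOp (v : Fock) (n : ℤ) : Module.End ℂ Fock := mode v (n + 1)

/-- A conformal vector: a Virasoro vector such that `L_0` is semisimple (the space is the direct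
sum of the eigenspaces of `L_0`) and `L_{-1} = T`. -/
structure IsConformalVector (v : Fock) : Prop where
  virasoro : ∃ c : ℂ, IsVirasoroVector c v
  semisimple : ⨆ Δ : ℂ, Module.End.eigenspace (virasoroOp v 0) Δ = ⊤
  translation_eq : ∀ a, virasoroOp v (-1) a = translation a

/-! ## Inner automorphisms -/

/-- Automorphisms of the vertex algebra: linear automorphisms preserving all products. -/
def IsAutomorphism (σ : Fock ≃ₗ[ℂ] Fock) : Prop :=
  ∀ (a : Fock) (n : ℤ) (b : Fock), σ (mode a n b) = mode (σ a) n (σ b)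

/-- `exp D = ∑ Dⁿ / n!` makes sense and is equal to `σ`: for each `b` the vectors `Dⁿ b` lie in a
finite-dimensional subspace, and there `∑ Dⁿ b / n!` converges to `σ b` (convergence being tested
by linear functionals). -/
def IsExp (D : Module.End ℂ Fock) (σ : Fock ≃ₗ[ℂ] Fock) : Prop :=
  ∀ b : Fock,
    (∃ W : Submodule ℂ Fock, FiniteDimensional ℂ W ∧ ∀ n : ℕ, (D ^ n) b ∈ W) ∧
    ∀ f : Module.Dual ℂ Fock,
      HasSum (fun n : ℕ => f (((n.factorial : ℂ)⁻¹) • (D ^ n) b)) (f (σ b))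

/-- Inner automorphisms: automorphisms `exp(a_(m))` with `m ≥ 0` and
`a_(0) = a_(1) = ⋯ = a_(m-1) = 0`. -/
def IsInnerAutomorphism (σ : Fock ≃ₗ[ℂ] Fock) : Prop :=
  IsAutomorphism σ ∧
    ∃ (m : ℕ) (a : Fock), (∀ i : ℕ, i < m → mode a i = 0) ∧ IsExp (mode a m) σ

/-! ## Representations of `sl₂` -/

/-- The Lie algebra `sl₂(ℂ)`. -/
abbrev sl2 := LieAlgebra.SpecialLinear.sl (Fin 2) ℂ

theorem mem_sl2 {A : Matrix (Fin 2) (Fin 2) ℂ} (h : A.trace = 0) :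
    A ∈ LieAlgebra.SpecialLinear.sl (Fin 2) ℂ :=
  (LinearMap.mem_ker).2 h

/-- The standard basis element `E`. -/
def sl2E : sl2 := ⟨!![0, 1; 0, 0], mem_sl2 (by simp [Matrix.trace_fin_two])⟩

/-- The standard basis element `H`. -/
def sl2H : sl2 := ⟨!![1, 0; 0, -1], mem_sl2 (by simp [Matrix.trace_fin_two])⟩

/-- The standard basis element `F`. -/
def sl2F : sl2 := ⟨!![0, 0; 1, 0], mem_sl2 (by simp [Matrix.trace_fin_two])⟩

section Representations

variable {M : Type*} [AddCommGroup M] [Module ℂ M]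

/-- The `sl₂`-module given by a representation `ρ` on `M`: the space `M` with `x • m = ρ x m`. -/
def RepModule (_ρ : sl2 →ₗ⁅ℂ⁆ Module.End ℂ M) : Type _ := M

variable (ρ : sl2 →ₗ⁅ℂ⁆ Module.End ℂ M)

instance : AddCommGroup (RepModule ρ) := inferInstanceAs (AddCommGroup M)

instance : Module ℂ (RepModule ρ) := inferInstanceAs (Module ℂ M)

instance : LieRingModule sl2 (RepModule ρ) := LieRingModule.compLieHom M ρ

instance : LieModule ℂ sl2 (RepModule ρ) := LieModule.compLieHom M ρ

/-- The identification of `M` with the module `RepModule ρ`. -/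
def RepModule.of : M ≃ₗ[ℂ] RepModule ρ := LinearEquiv.refl ℂ M

theorem RepModule.lie_of (x : sl2) (m : M) :
    ⁅x, RepModule.of ρ m⁆ = RepModule.of ρ (ρ x m) := rfl

/-- Complete reducibility: every submodule has a complementary submodule. -/
def IsCompletelyReducible : Prop := ComplementedLattice (LieSubmodule ℂ sl2 (RepModule ρ))

end Representations

/-! ## Dual Verma modules -/

/-- The left ideal of `U(sl₂)` generated by `E` and `H - l`. -/
def vermaIdeal (l : ℂ) : Submodule (UniversalEnvelopingAlgebra ℂ sl2)
    (UniversalEnvelopingAlgebra ℂ sl2) :=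
  Submodule.span _ {UniversalEnvelopingAlgebra.ι ℂ sl2E,
    UniversalEnvelopingAlgebra.ι ℂ sl2H - algebraMap ℂ _ l}

/-- The Verma module `M(l) = U(sl₂) / (U(sl₂) E + U(sl₂) (H - l))` of highest weight `l`. -/
abbrev Verma (l : ℂ) : Type := UniversalEnvelopingAlgebra ℂ sl2 ⧸ vermaIdeal l

/-- The action of `sl₂` on the Verma module. -/
def vermaRep (l : ℂ) : sl2 →ₗ⁅ℂ⁆ Module.End ℂ (Verma l) :=
  (Algebra.lsmul ℂ ℂ (Verma l)).toLieHom.comp (UniversalEnvelopingAlgebra.ι ℂ)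

/-- The transposition anti-involution of `sl₂`; it exchanges `E` and `F` and fixes `H`. -/
def sl2Transpose : sl2 →ₗ[ℂ] sl2 where
  toFun x := ⟨(x : Matrix (Fin 2) (Fin 2) ℂ).transpose, mem_sl2 (by
    rw [Matrix.trace_transpose]; exact (LinearMap.mem_ker).1 x.2)⟩
  map_add' _ _ := Subtype.ext (Matrix.transpose_add _ _)
  map_smul' _ _ := Subtype.ext (Matrix.transpose_smul _ _)

theorem sl2Transpose_lie (x y : sl2) :
    sl2Transpose ⁅x, y⁆ = ⁅sl2Transpose y, sl2Transpose x⁆ := by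
  apply Subtype.ext
  change (⁅(x : Matrix (Fin 2) (Fin 2) ℂ), (y : Matrix (Fin 2) (Fin 2) ℂ)⁆).transpose = _
  rw [LieSubalgebra.coe_bracket, Ring.lie_def, Ring.lie_def, Matrix.transpose_sub,
    Matrix.transpose_mul, Matrix.transpose_mul]
  rfl

section Dual

variable {M : Type*} [AddCommGroup M] [Module ℂ M] (ρ : sl2 →ₗ⁅ℂ⁆ Module.End ℂ M)

/-- The action of `sl₂` on the full dual space twisted by transposition: `(x f)(m) = f(xᵀ m)`. -/
def fullDualRep : sl2 →ₗ⁅ℂ⁆ Module.End ℂ (Module.Dual ℂ M) where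
  toFun x := (ρ (sl2Transpose x)).dualMap
  map_add' x y := by ext f m; simp
  map_smul' c x := by ext f m; simp
  map_lie' {x y} := by
    ext f m
    simp [sl2Transpose_lie, LieHom.map_lie, Ring.lie_def]

/-- The restricted dual `⨁_μ (M_μ)^*` of a weight module: the sum of the `H`-weight spaces of the
full dual. (A functional has weight `μ` if and only if it satisfies `f(H m) = μ f(m)`, that is,
if it vanishes on the weight spaces of `M` of weight other than `μ`.) -/
def restrictedDual : Submodule ℂ (Module.Dual ℂ M) :=
  ⨆ μ : ℂ, Module.End.eigenspace (fullDualRep ρ sl2H) μ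

theorem sl2_eq (x : sl2) : x = (x.1 0 1) • sl2E + (x.1 0 0) • sl2H + (x.1 1 0) • sl2F := by
  have ht : x.1 0 0 + x.1 1 1 = 0 := by
    have := (LinearMap.mem_ker).1 x.2
    simpa [Matrix.trace_fin_two] using this
  apply Subtype.ext
  ext i j
  fin_cases i <;> fin_cases j <;> simp [sl2E, sl2H, sl2F]
  linear_combination ht

theorem lie_H_E : ⁅sl2H, sl2E⁆ = (2 : ℂ) • sl2E := by
  apply Subtype.ext
  ext i j
  fin_cases i <;> fin_cases j <;>
    simp [sl2E, sl2H, Ring.lie_def]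
  norm_num

theorem lie_H_F : ⁅sl2H, sl2F⁆ = (-2 : ℂ) • sl2F := by
  apply Subtype.ext
  ext i j
  fin_cases i <;> fin_cases j <;>
    simp [sl2F, sl2H, Ring.lie_def]
  norm_num

theorem weight_shift {N : Type*} [AddCommGroup N] [Module ℂ N] (τ : sl2 →ₗ⁅ℂ⁆ Module.End ℂ N)
    {x : sl2} {c : ℂ} (hx : ⁅sl2H, x⁆ = c • x) {f : N}
    (hf : f ∈ ⨆ μ : ℂ, Module.End.eigenspace (τ sl2H) μ) :
    τ x f ∈ ⨆ μ : ℂ, Module.End.eigenspace (τ sl2H) μ := by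
  have key : (⨆ μ : ℂ, Module.End.eigenspace (τ sl2H) μ) ≤
      (⨆ μ : ℂ, Module.End.eigenspace (τ sl2H) μ).comap (τ x) := by
    refine iSup_le fun μ g hg => ?_
    refine Submodule.mem_iSup_of_mem (μ + c) ?_
    rw [Module.End.mem_eigenspace_iff] at hg ⊢
    have h : τ ⁅sl2H, x⁆ g = c • τ x g := by rw [hx]; simp
    rw [LieHom.map_lie, Ring.lie_def, LinearMap.sub_apply, Module.End.mul_apply,
      Module.End.mul_apply, hg, map_smul] at h
    rw [add_smul, ← h]
    abel
  exact key hf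

theorem restrictedDual_stable (x : sl2) (f : Module.Dual ℂ M) (hf : f ∈ restrictedDual ρ) :
    fullDualRep ρ x f ∈ restrictedDual ρ := by
  rw [sl2_eq x]
  simp only [map_add, map_smul, LinearMap.add_apply, LinearMap.smul_apply]
  refine add_mem (add_mem ?_ ?_) ?_ <;> refine Submodule.smul_mem _ _ ?_
  · exact weight_shift _ lie_H_E hf
  · exact weight_shift _ (c := 0) (by simp) hf
  · exact weight_shift _ lie_H_F hf

/-- The dual (contragredient) representation on the restricted dual. -/
def dualRep : sl2 →ₗ⁅ℂ⁆ Module.End ℂ (restrictedDual ρ) where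
  toFun x := (fullDualRep ρ x).restrict (restrictedDual_stable ρ x)
  map_add' x y := by ext f m; simp
  map_smul' c x := by ext f m; simp
  map_lie' {x y} := by
    apply LinearMap.ext
    intro f
    apply Subtype.ext
    simp [LieHom.map_lie, Ring.lie_def]

end Dual

/-- The dual Verma module `M*(l)` of highest weight `l`. -/
abbrev DualVerma (l : ℂ) : Type := RepModule (dualRep (vermaRep l))

end FreeBoson

end

noncomputable section

namespace FreeBoson

open MvPolynomial Filter

/-! ## Structure of the state–field correspondence -/

/-! Throughout, `X k` stands for $x_{k+1}$. The heart of the proof is a classification: every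
conformal vector is $\exp(t\alpha_1)(\frac12x_1^2+l\,x_2)$ for some $t,l$
(`exists_shift_stdVec_eq`). Everything else is a computation with three derivations of the
polynomial ring: $L_{-1}=T$, the degree operator $L_0$, and $L_1$, which sends $x_1$ to $-2l$.

Identities between modes rest on one principle (`end_ext`): an operator is determined by its value
on $1$ and its commutators with the multiplications by the variables. Borcherds' commutator formula
(`X_mul_mode`) expresses the commutator of $x_{k+1}$ with $w_{(n)}$ through modes of the partial
derivatives $\partial_jw$, so statements about all states follow by induction on derivatives.

Classification. Put $w=v-\frac12x_1^2$. Since $v$ and $\frac12x_1^2$ both have zeroth mode $T$,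
$w_{(0)}=0$, so $w_{(1)}$ is a derivation of the vertex algebra and is determined by $u=w_{(1)}x_1$.
Now filter by conformal weight plus polynomial degree. To leading order $L_0=\deg+w_{(1)}$ is the
derivation commuting with $T$ that sends $x_1$ to the top component $f$ of $u$. If $u$ had weight
above that of $x_1$, the iterates of this derivation on $x_1$ would be nonzero of unbounded weight,
although $x_1$ is a finite sum of $L_0$-eigenvectors (`mem_filt_two_of_locally_finite`). Hence $u$
is affine in $x_1$; its linear coefficient vanishes because $w_{(0)}=0$, so $u=t$ and
$L_0=\deg+t\,\partial/\partial x_1$. This is the conjugate of $\deg$ by the shift $x_1\mapsto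
x_1+t$. Undoing the shift gives a vector of degree 2, namely $a x_1^2+l x_2$, and $a=\frac12$
because its zeroth mode is $T$.

The $sl_2$-module. Automorphisms transport the representation, so only $\frac12x_1^2+l x_2$ matters.
For $l\ne0$ the trivial submodule $\mathbb{C}1$ has no complement, because $L_1$ sends $x_1$ to a
nonzero constant. For $l=0$ the operator $L_1$ never reaches the vacuum component, every homogeneous
vector is a sum of descendants of primary vectors, and each primary vector generates a simple
module. For $l\ne0$, $x_1$ plus any constant generates the span of $1,x_1,x_2,\dots$. Pairing $p$
with $F^nm_0$ to get the constant term of $(-L_1)^np$ is diagonal and nondegenerate on this basis,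
which identifies the span with $M^*(0)$. -/

theorem ncoeff_normalOrder (A B : VertexOperator ℂ Fock) (n : ℤ) :
    VertexOperator.ncoeff (normalOrder A B) n = normalOrderMode A B n :=
  ncoeff_ofModes _ _ _

theorem finsum_eventually_eq_sum_range {M : Type*} [AddCommMonoid M] {f : ℕ → M}
    (hf : (Function.support f).Finite) :
    ∀ᶠ N in atTop, ∑ᶠ i, f i = ∑ i ∈ Finset.range N, f i := by
  obtain ⟨K, hK⟩ := hf.bddAbove
  filter_upwards [eventually_gt_atTop K] with N hN
  refine finsum_eq_sum_of_support_subset _ fun i hi => ?_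
  have := hK hi
  simp only [Finset.coe_range, Set.mem_Iio]
  omega

/-- Replacing both sums by truncations at any large `N` allows several normally ordered products to
be compared at one common `N`. -/
theorem normalOrder_apply_eventually (A B : VertexOperator ℂ Fock) (n : ℤ) (u : Fock) :
    ∀ᶠ N in atTop, VertexOperator.ncoeff (normalOrder A B) n u =
      (∑ i ∈ Finset.range N, VertexOperator.ncoeff A (-(i : ℤ) - 1)
        (VertexOperator.ncoeff B (n + i) u)) +
      ∑ i ∈ Finset.range N, VertexOperator.ncoeff B (n - 1 - i) (VertexOperator.ncoeff A i u) := by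
  filter_upwards [finsum_eventually_eq_sum_range (finite_support_creation A B n u),
    finsum_eventually_eq_sum_range (finite_support_annihilation A B n u)] with N h1 h2
  rw [ncoeff_normalOrder, normalOrderMode, LinearMap.coe_mk, AddHom.coe_mk, h1, h2]

theorem Y_one : Y 1 = idField := by
  have h : (1 : Fock) = basisMonomials ℕ ℂ 0 := by simp
  rw [h, Y, Module.Basis.constr_basis]
  simp [nestedNormalOrder]

/-- `Y` is defined by sorted lists of factors, so only a smallest variable can be peeled off as the
outermost field. This is why the inductions on monomials below carry the condition on the support.
-/
theorem Y_X_mul_monomial (k : ℕ) (s : ℕ →₀ ℕ) (hs : ∀ i ∈ s.support, k ≤ i) :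
    Y (X k * monomial s 1) = normalOrder (dividedDeriv k alphaField) (Y (monomial s 1)) := by
  have h : (X k * monomial s 1 : Fock) = basisMonomials ℕ ℂ (Finsupp.single k 1 + s) := by
    rw [coe_basisMonomials, X, monomial_mul, one_mul]
  have h' : (monomial s 1 : Fock) = basisMonomials ℕ ℂ s := by simp
  rw [h, h', Y, Module.Basis.constr_basis, Module.Basis.constr_basis, Finsupp.toMultiset_add,
    Finsupp.toMultiset_single, one_smul, Multiset.singleton_add, Multiset.sort_cons]
  · rfl
  · intro b hb
    exact hs b (by simpa using hb)

theorem mode_one (n : ℤ) : mode 1 n = if n = -1 then 1 else 0 := by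
  rw [mode, Y_one, idField, ncoeff_ofModes]

theorem mode_smul (c : ℂ) (a : Fock) (n : ℤ) : mode (c • a) n = c • mode a n := by
  simp [mode]

theorem mode_add (a b : Fock) (n : ℤ) : mode (a + b) n = mode a n + mode b n := by
  simp [mode]

theorem mode_sub (a b : Fock) (n : ℤ) : mode (a - b) n = mode a n - mode b n := by
  simp [mode]

theorem mode_zero (n : ℤ) : mode 0 n = 0 := by
  simp [mode]

theorem mode_sum {ι : Type*} (s : Finset ι) (f : ι → Fock) (n : ℤ) :
    mode (∑ i ∈ s, f i) n = ∑ i ∈ s, mode (f i) n := by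
  simp [mode]

/-- The field `∂^(k)α` of the state `X k`. -/
def alphaDeriv (k : ℕ) (n : ℤ) : Module.End ℂ Fock :=
  ((Ring.choose ((k : ℤ) - n - 1) k : ℤ) : ℂ) • alpha (n - k)

theorem ncoeff_dividedDeriv_alpha (k : ℕ) (n : ℤ) :
    VertexOperator.ncoeff (dividedDeriv k alphaField) n = alphaDeriv k n := by
  rw [dividedDeriv, ncoeff_ofModes, alphaField, ncoeff_ofModes, alphaDeriv]

theorem alpha_natCast_succ (k : ℕ) (p : Fock) :
    alpha ((k : ℤ) + 1) p = ((k : ℂ) + 1) • pderiv k p := rfl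

theorem alpha_zero : alpha 0 = 0 := rfl

theorem alpha_neg (k : ℕ) (p : Fock) : alpha (-(k : ℤ) - 1) p = X k * p := by
  have : (-(k : ℤ) - 1) = Int.negSucc k := by omega
  rw [this]; rfl

theorem alphaDeriv_neg (k i : ℕ) (p : Fock) :
    alphaDeriv k (-(i : ℤ) - 1) p = ((k + i).choose k : ℂ) • (X (k + i) * p) := by
  have h1 : (k : ℤ) - (-(i : ℤ) - 1) - 1 = ((k + i : ℕ) : ℤ) := by push_cast; ring
  have h2 : -(i : ℤ) - 1 - k = -((k + i : ℕ) : ℤ) - 1 := by push_cast; ring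
  rw [alphaDeriv, h1, h2, Ring.choose_natCast, LinearMap.smul_apply, alpha_neg]
  simp

theorem alphaDeriv_of_lt (k i : ℕ) (h : i < k) : alphaDeriv k i = 0 := by
  have h1 : (k : ℤ) - i - 1 = ((k - i - 1 : ℕ) : ℤ) := by omega
  rw [alphaDeriv, h1, Ring.choose_natCast, Nat.choose_eq_zero_of_lt (by omega)]
  simp

theorem alphaDeriv_self (k : ℕ) : alphaDeriv k k = 0 := by
  rw [alphaDeriv, sub_self, alpha_zero, smul_zero]

theorem alphaDeriv_pos (k i : ℕ) (p : Fock) :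
    alphaDeriv k (k + i + 1 : ℕ) p =
      (((i : ℂ) + 1) * (Ring.choose (-(i : ℤ) - 2) k : ℤ)) • pderiv i p := by
  have h1 : (k : ℤ) - ((k + i + 1 : ℕ) : ℤ) - 1 = -(i : ℤ) - 2 := by push_cast; ring
  have h2 : ((k + i + 1 : ℕ) : ℤ) - k = (i : ℤ) + 1 := by push_cast; ring
  rw [alphaDeriv, h1, h2, LinearMap.smul_apply, alpha_natCast_succ, smul_smul, mul_comm]

theorem alphaDeriv_natCast_one (k i : ℕ) : alphaDeriv k i 1 = 0 := by
  rcases lt_trichotomy i k with h | rfl | h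
  · rw [alphaDeriv_of_lt _ _ h]; rfl
  · rw [alphaDeriv_self]; rfl
  · obtain ⟨j, rfl⟩ := Nat.exists_eq_add_of_lt h
    rw [alphaDeriv_pos]; simp

/-- The coefficients of the commutator of `X k` with a field. -/
def commCoeff (k j : ℕ) : ℂ := -((k : ℂ) + 1) * (Ring.choose (-(k : ℤ) - 2) j : ℤ)

theorem alphaDeriv_comm (k l i : ℕ) (p : Fock) :
    X l * alphaDeriv k i p - alphaDeriv k i (X l * p) =
      if i = k + l + 1 then commCoeff l k • p else 0 := by
  rcases lt_trichotomy i k with h | rfl | h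
  · rw [alphaDeriv_of_lt _ _ h, if_neg (by omega)]; simp
  · rw [alphaDeriv_self, if_neg (by omega)]; simp
  · obtain ⟨j, rfl⟩ := Nat.exists_eq_add_of_lt h
    rw [alphaDeriv_pos, alphaDeriv_pos, Derivation.leibniz, pderiv_X]
    by_cases hj : j = l
    · subst hj
      simp only [if_true, Pi.single_eq_same, commCoeff, smul_eq_mul, mul_one, smul_add,
        mul_smul_comm]
      rw [sub_add_cancel_left, ← neg_smul]
      congr 1
      ring
    · rw [if_neg (by omega), Pi.single_eq_of_ne (by omega)]
      simp

/-- Builds a monomial one variable at a time, each new variable being at most those already present,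
to match `Y_X_mul_monomial`. -/
theorem sorted_induction {P : (ℕ →₀ ℕ) → Prop} (h0 : P 0)
    (h : ∀ k s, (∀ i ∈ s.support, k ≤ i) → P s → P (Finsupp.single k 1 + s)) : ∀ s, P s := by
  intro s
  induction s using Finsupp.induction_on_min with
  | zero => exact h0
  | single_add a b f ha hb hf =>
    clear hb
    induction b with
    | zero => simpa using hf
    | succ b ih =>
      rw [add_comm b 1, Finsupp.single_add, add_assoc]
      refine h _ _ (fun i hi => ?_) ih
      rcases Finset.mem_union.1 (Finsupp.support_add hi) with hi | hi
      · rw [Finset.mem_singleton.1 (Finsupp.support_single_subset hi)]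
      · exact (ha i hi).le

theorem mode_X_mul_pderiv_monomial (k j : ℕ) (s : ℕ →₀ ℕ) (hs : ∀ i ∈ s.support, k ≤ i) (n : ℤ)
    (p : Fock) :
    ∀ᶠ N in atTop, mode (X k * pderiv j (monomial s 1)) n p =
      (∑ i ∈ Finset.range N, alphaDeriv k (-(i : ℤ) - 1)
        (mode (pderiv j (monomial s 1)) (n + i) p)) +
      ∑ i ∈ Finset.range N, mode (pderiv j (monomial s 1)) (n - 1 - i) (alphaDeriv k i p) := by
  have h1 : pderiv j (monomial s (1 : ℂ)) = (s j : ℂ) • monomial (s - Finsupp.single j 1) 1 := by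
    rw [pderiv_monomial, smul_monomial, one_mul, smul_eq_mul, mul_one]
  have h2 : ∀ i ∈ (s - Finsupp.single j 1).support, k ≤ i := fun i hi =>
    hs i (by simp only [Finsupp.mem_support_iff, Finsupp.tsub_apply] at hi ⊢; omega)
  have h3 := normalOrder_apply_eventually (dividedDeriv k alphaField)
    (Y (monomial (s - Finsupp.single j 1) 1)) n p
  filter_upwards [h3] with N h
  simp only [ncoeff_dividedDeriv_alpha] at h
  rw [h1, mul_smul_comm, mode_smul, LinearMap.smul_apply, mode, Y_X_mul_monomial k _ h2, h]
  simp only [mode_smul, LinearMap.smul_apply, map_smul, smul_add, Finset.smul_sum]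
  rfl

theorem mode_X_mul_monomial (k : ℕ) (s : ℕ →₀ ℕ) (hs : ∀ i ∈ s.support, k ≤ i) (n : ℤ)
    (p : Fock) :
    ∀ᶠ N in atTop, mode (X k * monomial s 1) n p =
      (∑ i ∈ Finset.range N, alphaDeriv k (-(i : ℤ) - 1) (mode (monomial s 1) (n + i) p)) +
      ∑ i ∈ Finset.range N, mode (monomial s 1) (n - 1 - i) (alphaDeriv k i p) := by
  have h3 := normalOrder_apply_eventually (dividedDeriv k alphaField) (Y (monomial s 1)) n p
  filter_upwards [h3] with N h
  simp only [ncoeff_dividedDeriv_alpha] at h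
  rw [mode, Y_X_mul_monomial k _ hs, h]
  rfl

/-- Borcherds' formula $[\alpha_{-k-1},w_{(n)}]=\sum_i\binom{-k-1}{i}(\alpha_iw)_{(n-k-1-i)}$: the
term $i=0$ vanishes, and with $i=j+1$ one has $\alpha_{j+1}=(j+1)\partial_j$ and
$(j+1)\binom{-k-1}{j+1}=-(k+1)\binom{-k-2}{j}$, which is `commCoeff k j`. The proof is Wick's
theorem in inductive form: commuting $x_{k+1}$ past the outermost field produces one contraction. -/
theorem X_mul_mode_monomial (k J : ℕ) (s : ℕ →₀ ℕ) (hJ : ∀ i ∈ s.support, i < J) :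
    ∀ (n : ℤ) (p : Fock),
    X k * mode (monomial s 1) n p - mode (monomial s 1) n (X k * p) =
      ∑ j ∈ Finset.range J, commCoeff k j • mode (pderiv j (monomial s 1)) (n - k - j - 2) p := by
  revert hJ
  induction s using sorted_induction with
  | h0 =>
    intro _ n p
    have h : (monomial 0 1 : Fock) = 1 := rfl
    simp only [h, mode_one]
    rw [Finset.sum_eq_zero]
    · split_ifs <;> simp
    · intro j _
      simp [mode_zero]
  | h k₀ s hs ih =>
    intro hJ n p
    have hsub : s.support ⊆ (Finsupp.single k₀ 1 + s).support := by
      intro i hi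
      simp only [Finsupp.mem_support_iff, Finsupp.add_apply] at hi ⊢
      omega
    have hk₀ : k₀ < J := hJ k₀ (by simp)
    specialize ih fun i hi => hJ i (hsub hi)
    have hmon : (monomial (Finsupp.single k₀ 1 + s) 1 : Fock) = X k₀ * monomial s 1 := by
      rw [X, monomial_mul, one_mul]
    rw [hmon]
    -- One truncation serves all the normally ordered products; it exceeds `k₀ + k + 1`, the only
    -- index at which the outermost field contracts with `X k`.
    have hall : ∀ᶠ N in atTop, ∀ j ∈ Finset.range J, _ := (Filter.eventually_all_finset _).2
      fun j _ => mode_X_mul_pderiv_monomial k₀ j s hs (n - k - j - 2) p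
    obtain ⟨N, h1, h2, h3, hN⟩ := ((mode_X_mul_monomial k₀ s hs n p).and
      ((mode_X_mul_monomial k₀ s hs n (X k * p)).and (hall.and
        (eventually_gt_atTop (k₀ + k + 1))))).exists
    rw [h1, h2]
    -- By the Leibniz rule, differentiating the new factor contributes only at `j = k₀`; this is the
    -- term that the contraction must match.
    have hR : ∑ j ∈ Finset.range J,
        commCoeff k j • mode (pderiv j (X k₀ * monomial s 1)) (n - k - j - 2) p =
        commCoeff k k₀ • mode (monomial s 1) (n - k - k₀ - 2) p +
        ∑ j ∈ Finset.range J,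
          commCoeff k j • mode (X k₀ * pderiv j (monomial s 1)) (n - k - j - 2) p := by
      rw [← Finset.sum_erase_add _ _ (Finset.mem_range.2 hk₀),
        ← Finset.sum_erase_add (f := fun j => commCoeff k j •
          mode (X k₀ * pderiv j (monomial s 1)) (n - k - j - 2) p) _ (Finset.mem_range.2 hk₀)]
      have : ∀ j ∈ (Finset.range J).erase k₀,
          commCoeff k j • mode (pderiv j (X k₀ * monomial s 1)) (n - k - j - 2) p =
          commCoeff k j • mode (X k₀ * pderiv j (monomial s 1)) (n - k - j - 2) p := by
        intro j hj
        rw [Derivation.leibniz, pderiv_X, Pi.single_eq_of_ne (Finset.ne_of_mem_erase hj).symm]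
        simp
      rw [Finset.sum_congr rfl this, Derivation.leibniz, pderiv_X, Pi.single_eq_same]
      simp only [smul_eq_mul, mul_one, mode_add, LinearMap.add_apply, smul_add]
      abel
    rw [hR, Finset.sum_congr (s₁ := Finset.range J) rfl
      fun j hj => congrArg (commCoeff k j • ·) (h3 j hj)]
    simp only [smul_add, Finset.sum_add_distrib, Finset.smul_sum, mul_add, Finset.mul_sum]
    rw [Finset.sum_comm (s := Finset.range J), Finset.sum_comm (s := Finset.range J)]
    have e1 : ∀ i ∈ Finset.range N,
        X k * alphaDeriv k₀ (-(i : ℤ) - 1) (mode (monomial s 1) (n + i) p) =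
        alphaDeriv k₀ (-(i : ℤ) - 1) (mode (monomial s 1) (n + i) (X k * p)) +
        ∑ j ∈ Finset.range J, commCoeff k j • alphaDeriv k₀ (-(i : ℤ) - 1)
          (mode (pderiv j (monomial s 1)) (n - k - j - 2 + i) p) := by
      intro i _
      have := congrArg (alphaDeriv k₀ (-(i : ℤ) - 1)) (ih (n + i) p)
      rw [map_sub, sub_eq_iff_eq_add, map_sum, add_comm (Finset.sum _ _)] at this
      convert this using 1
      · simp only [alphaDeriv_neg, mul_smul_comm, mul_left_comm]
      · congr 1
        refine Finset.sum_congr rfl fun j _ => ?_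
        rw [map_smul]
        congr 4
        ring
    have e2 : ∀ i ∈ Finset.range N,
        X k * mode (monomial s 1) (n - 1 - i) (alphaDeriv k₀ i p) =
        mode (monomial s 1) (n - 1 - i) (alphaDeriv k₀ i (X k * p)) +
        (if i = k₀ + k + 1 then commCoeff k k₀ • mode (monomial s 1) (n - 1 - i) p else 0) +
        ∑ j ∈ Finset.range J, commCoeff k j •
          (mode (pderiv j (monomial s 1)) (n - k - j - 2 - 1 - i) (alphaDeriv k₀ i p)) := by
      intro i _
      have h := ih (n - 1 - i) (alphaDeriv k₀ i p)
      have h' := congrArg (mode (monomial s 1) (n - 1 - i)) (alphaDeriv_comm k₀ k i p)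
      rw [sub_eq_iff_eq_add] at h
      rw [map_sub, sub_eq_iff_eq_add, apply_ite (mode (monomial s 1) (n - 1 - i)), map_smul,
        map_zero] at h'
      rw [h, h']
      have : ∀ j : ℕ, n - 1 - i - k - j - 2 = n - k - j - 2 - 1 - i := fun j => by ring
      simp only [this]
      abel
    rw [Finset.sum_congr rfl e1, Finset.sum_congr rfl e2]
    simp only [Finset.sum_add_distrib, Finset.sum_ite_eq', Finset.mem_range, hN, if_true]
    have : n - 1 - ((k₀ + k + 1 : ℕ) : ℤ) = n - k - k₀ - 2 := by push_cast; ring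
    rw [this]
    abel

theorem pderiv_sum_range_congr {M : Type*} [AddCommMonoid M] {w : Fock} {J J' : ℕ} (h : J ≤ J')
    (hJ : ∀ j, J ≤ j → pderiv j w = 0) (f : ℕ → Fock → M) (hf : ∀ j, f j 0 = 0) :
    ∑ j ∈ Finset.range J, f j (pderiv j w) = ∑ j ∈ Finset.range J', f j (pderiv j w) := by
  refine Finset.sum_subset (Finset.range_mono h) fun j _ hj => ?_
  rw [hJ j (by simpa using hj), hf]

theorem exists_pderiv_eq_zero (w : Fock) : ∃ J, ∀ j, J ≤ j → pderiv j w = 0 := by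
  obtain ⟨K, hK⟩ := w.vars.bddAbove
  refine ⟨K + 1, fun j hj => pderiv_eq_zero_of_notMem_vars fun h => ?_⟩
  have := hK h
  omega

/-- The commutator of a creation operator with the modes of a state. -/
theorem X_mul_mode (k : ℕ) {J : ℕ} {w : Fock} (hJ : ∀ j, J ≤ j → pderiv j w = 0) (n : ℤ)
    (p : Fock) :
    X k * mode w n p - mode w n (X k * p) =
      ∑ j ∈ Finset.range J, commCoeff k j • mode (pderiv j w) (n - k - j - 2) p := by
  obtain ⟨K, hK⟩ := w.vars.bddAbove
  rw [pderiv_sum_range_congr (le_max_left J (K + 1)) hJ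
    (fun j q => commCoeff k j • mode q (n - k - j - 2) p) (by simp [mode_zero])]
  have hmon : ∀ s ∈ w.support, ∀ i ∈ s.support, i < max J (K + 1) := fun s hs i hi => by
    have : i ≤ K := hK ((mem_vars_iff_mem_support _).2 ⟨s, hs, hi⟩)
    omega
  have key : ∀ q : Fock, q.support ⊆ w.support → X k * mode q n p - mode q n (X k * p) =
      ∑ j ∈ Finset.range (max J (K + 1)), commCoeff k j •
        mode (pderiv j q) (n - k - j - 2) p := by
    intro q hq
    have hq' : q = ∑ s ∈ q.support, coeff s q • monomial s 1 := by
      conv_lhs => rw [q.as_sum]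
      simp [smul_monomial]
    rw [hq']
    simp only [mode_sum, LinearMap.sum_apply, Finset.mul_sum, map_sum, mode_smul,
      LinearMap.smul_apply, Derivation.map_smul, Finset.smul_sum, mul_smul_comm]
    rw [← Finset.sum_sub_distrib, Finset.sum_comm]
    refine Finset.sum_congr rfl fun s hs => ?_
    rw [← smul_sub, X_mul_mode_monomial k _ s (hmon s (hq hs)), Finset.smul_sum]
    exact Finset.sum_congr rfl fun j _ => smul_comm _ _ _
  exact key w subset_rfl

/-! ## Translation, vacuum, and uniqueness -/

theorem add_single_mem_support_of_mem_support_pderiv {k : ℕ} {p : Fock} {s : ℕ →₀ ℕ}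
    (h : s ∈ (pderiv k p).support) : s + Finsupp.single k 1 ∈ p.support := by
  have hp : pderiv k p = ∑ t ∈ p.support, pderiv k (monomial t (coeff t p)) := by
    conv_lhs => rw [p.as_sum, map_sum]
  rw [hp] at h
  obtain ⟨t, ht, hs⟩ := Finset.mem_biUnion.1 (support_sum h)
  rw [pderiv_monomial] at hs
  have hs' := Finset.mem_singleton.1 (support_monomial_subset hs)
  have htk : t k ≠ 0 := by
    intro h0
    simp [h0] at hs
  have : s + Finsupp.single k 1 = t := by
    rw [hs']
    ext i
    by_cases hi : i = k
    · subst hi; simp; omega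
    · simp [Finsupp.single_eq_of_ne hi]
  rwa [this]

/-- Partial derivatives lower the total degree. The principle fits `X_mul_mode`, whose right side
involves a state only through its partial derivatives. -/
theorem pderiv_induction {P : Fock → Prop} (h0 : P 0)
    (h : ∀ p, (∀ k, P (pderiv k p)) → P p) (p : Fock) : P p := by
  have key : ∀ n (p : Fock), (∀ s ∈ p.support, s.degree < n) → P p := by
    intro n
    induction n with
    | zero =>
      intro p hp
      have : p = 0 := by
        rw [← support_eq_empty, Finset.eq_empty_iff_forall_notMem]
        exact fun s hs => absurd (hp s hs) (by simp)
      rwa [this]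
    | succ n ih =>
      intro p hp
      refine h p fun k => ih _ fun s hs => ?_
      have := hp _ (add_single_mem_support_of_mem_support_pderiv hs)
      rw [map_add, Finsupp.degree_single] at this
      omega
  refine key (p.support.sup Finsupp.degree + 1) p fun s hs => ?_
  exact Nat.lt_succ_of_le (Finset.le_sup (f := Finsupp.degree) hs)

/-- The translation operator as a derivation of the polynomial algebra. -/
def transDer : Derivation ℂ Fock Fock := mkDerivation ℂ fun k => ((k : ℂ) + 1) • X (k + 1)

@[simp]
theorem transDer_X (k : ℕ) : transDer (X k) = ((k : ℂ) + 1) • X (k + 1) := mkDerivation_X _ _ _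

/-- The divided powers `T^n / n!` of the translation operator. -/
def transPow (n : ℕ) : Module.End ℂ Fock :=
  ((n.factorial : ℂ)⁻¹) • (transDer : Module.End ℂ Fock) ^ n

@[simp]
theorem transPow_zero (p : Fock) : transPow 0 p = p := by simp [transPow]

theorem succ_smul_transPow_succ (n : ℕ) (p : Fock) :
    ((n : ℂ) + 1) • transPow (n + 1) p = transDer (transPow n p) := by
  rw [transPow, transPow, LinearMap.smul_apply, LinearMap.smul_apply, smul_smul,
    Nat.factorial_succ, Derivation.map_smul, pow_succ']
  have : ((n : ℂ) + 1) ≠ 0 := by exact_mod_cast n.succ_ne_zero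
  have h : ((n : ℂ) + 1) * (((n + 1) * n.factorial : ℕ) : ℂ)⁻¹ = (n.factorial : ℂ)⁻¹ := by
    push_cast
    field_simp
  rw [h]
  rfl

theorem transPow_succ (n : ℕ) (p : Fock) :
    transPow (n + 1) p = ((n : ℂ) + 1)⁻¹ • transDer (transPow n p) := by
  have : ((n : ℂ) + 1) ≠ 0 := by exact_mod_cast n.succ_ne_zero
  rw [← succ_smul_transPow_succ, inv_smul_smul₀ this]

theorem transPow_one (p : Fock) : transPow 1 p = transDer p := by
  simp [transPow]

theorem transPow_trans (n : ℕ) (p : Fock) : transPow n (transDer p) = transDer (transPow n p) := by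
  induction n with
  | zero => simp
  | succ n ih => rw [transPow_succ, transPow_succ, ih, Derivation.map_smul]

theorem transPow_mul (n : ℕ) (p q : Fock) :
    transPow n (p * q) = ∑ ij ∈ Finset.HasAntidiagonal.antidiagonal n,
      transPow ij.1 p * transPow ij.2 q := by
  induction n with
  | zero => simp
  | succ n ih =>
    have hn : ((n : ℂ) + 1) ≠ 0 := by exact_mod_cast n.succ_ne_zero
    refine smul_right_injective Fock hn ?_
    simp only
    rw [succ_smul_transPow_succ, ih, map_sum]
    have h1 : ∀ ij ∈ Finset.HasAntidiagonal.antidiagonal (n + 1),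
        ((n : ℂ) + 1) • (transPow ij.1 p * transPow ij.2 q) =
        (ij.1 : ℂ) • (transPow ij.1 p * transPow ij.2 q) +
        (ij.2 : ℂ) • (transPow ij.1 p * transPow ij.2 q) := by
      intro ij hij
      rw [← add_smul]
      congr 1
      have := Finset.HasAntidiagonal.mem_antidiagonal.1 hij
      exact_mod_cast this.symm
    rw [Finset.smul_sum, Finset.sum_congr rfl h1, Finset.sum_add_distrib,
      Finset.Nat.sum_antidiagonal_succ, Finset.Nat.sum_antidiagonal_succ']
    simp only [Nat.cast_zero, zero_smul, zero_add, Nat.cast_add, Nat.cast_one]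
    rw [← Finset.sum_add_distrib]
    refine Finset.sum_congr rfl fun ij _ => ?_
    rw [Derivation.leibniz, ← succ_smul_transPow_succ, ← succ_smul_transPow_succ, smul_eq_mul,
      smul_eq_mul, mul_smul_comm, mul_smul_comm, add_comm, mul_comm (transPow ij.2 q)]

theorem transPow_X (n k : ℕ) : transPow n (X k) = ((k + n).choose k : ℂ) • X (k + n) := by
  induction n with
  | zero => simp
  | succ n ih =>
    have hn : ((n : ℂ) + 1) ≠ 0 := by exact_mod_cast n.succ_ne_zero
    rw [transPow_succ, ih, Derivation.map_smul, transDer_X, smul_smul, smul_smul, ← add_assoc]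
    congr 1
    have h : ((k + n + 1).choose k : ℂ) * ((n : ℂ) + 1) = ((k + n).choose k : ℂ) * (k + n + 1) := by
      have := Nat.add_one_mul_choose_eq (k + n) n
      rw [Nat.choose_symm_of_eq_add (show k + n = n + k by ring),
        Nat.choose_symm_of_eq_add (show k + n + 1 = (n + 1) + k by ring)] at this
      have h2 : (((k + n + 1) * (k + n).choose k : ℕ) : ℂ) =
        ((k + n + 1).choose k * (n + 1) : ℕ) := by rw [this]
      push_cast at h2
      rw [← h2]
      ring
    push_cast
    field_simp
    rw [mul_comm ((n : ℂ) + 1), h]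

/-- Annihilation property of the vacuum and the creation property of states. -/
theorem mode_apply_one_monomial (s : ℕ →₀ ℕ) : ∀ m : ℕ, mode (monomial s 1) m 1 = 0 ∧
    mode (monomial s 1) (-(m : ℤ) - 1) 1 = transPow m (monomial s 1) := by
  induction s using sorted_induction with
  | h0 =>
    intro m
    have h : (monomial 0 1 : Fock) = 1 := rfl
    simp only [h, mode_one]
    refine ⟨by rw [if_neg (by omega)]; rfl, ?_⟩
    cases m with
    | zero => simp
    | succ m =>
      rw [if_neg (by push_cast; omega), transPow_succ, ← transPow_trans]
      simp
  | h k s hs ih =>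
    intro m
    have hmon : (monomial (Finsupp.single k 1 + s) 1 : Fock) = X k * monomial s 1 := by
      rw [X, monomial_mul, one_mul]
    rw [hmon]
    constructor
    · obtain ⟨N, hN⟩ := (mode_X_mul_monomial k s hs m 1).exists
      rw [hN, Finset.sum_eq_zero, Finset.sum_eq_zero, add_zero]
      · intro i _
        rw [alphaDeriv_natCast_one, map_zero]
      · intro i _
        have := (ih (m + i)).1
        push_cast at this
        rw [this, map_zero]
    · obtain ⟨N, hN, hm⟩ := ((mode_X_mul_monomial k s hs (-(m : ℤ) - 1) 1).and
        (eventually_ge_atTop (m + 1))).exists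
      rw [hN, Finset.sum_eq_zero (s := Finset.range N) (f := fun i : ℕ =>
        mode (monomial s 1) _ (alphaDeriv k i 1)), add_zero, transPow_mul,
        Finset.Nat.sum_antidiagonal_eq_sum_range_succ
          (fun i j => transPow i (X k) * transPow j (monomial s 1))]
      · symm
        -- The terms with `i > m` apply a nonnegative mode to the vacuum and vanish; the others form
        -- the Leibniz expansion of the divided power of `T`.
        refine Finset.sum_subset_zero_on_sdiff (Finset.range_mono hm) ?_ ?_
        · intro i hi
          simp only [Finset.mem_sdiff, Finset.mem_range, not_lt] at hi
          have := (ih (i - (m + 1))).1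
          rw [show -(m : ℤ) - 1 + i = ((i - (m + 1) : ℕ) : ℤ) by omega, this, map_zero]
        · intro i hi
          have hi' : i ≤ m := by simpa [Nat.lt_succ_iff] using hi
          have := (ih (m - i)).2
          rw [show -(m : ℤ) - 1 + i = -((m - i : ℕ) : ℤ) - 1 by omega, this, alphaDeriv_neg,
            transPow_X, smul_mul_assoc]
      · intro i _
        rw [alphaDeriv_natCast_one, map_zero]

theorem eq_sum_smul_monomial (q : Fock) : q = ∑ s ∈ q.support, coeff s q • monomial s 1 := by
  conv_lhs => rw [q.as_sum]
  simp [smul_monomial]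

theorem mode_natCast_one (w : Fock) (m : ℕ) : mode w m 1 = 0 := by
  rw [eq_sum_smul_monomial w]
  simp [mode_sum, mode_smul, LinearMap.sum_apply, mode_apply_one_monomial]

theorem mode_neg_one (w : Fock) (m : ℕ) : mode w (-(m : ℤ) - 1) 1 = transPow m w := by
  rw [eq_sum_smul_monomial w]
  simp [mode_sum, mode_smul, LinearMap.sum_apply, mode_apply_one_monomial]

theorem translation_eq_trans (a : Fock) : translation a = transDer a := by
  rw [translation, ← transPow_one, ← mode_neg_one]
  rfl

/-- The vacuum is cyclic for the creation operators. -/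
theorem end_ext {A B : Module.End ℂ Fock} (h1 : A 1 = B 1)
    (h : ∀ k p, X k * A p - A (X k * p) = X k * B p - B (X k * p)) : A = B := by
  ext1 s
  apply LinearMap.ext_ring
  change A (monomial s 1) = B (monomial s 1)
  induction s using sorted_induction with
  | h0 => exact h1
  | h k s _ ih =>
    have hmon : (monomial (Finsupp.single k 1 + s) 1 : Fock) = X k * monomial s 1 := by
      rw [X, monomial_mul, one_mul]
    have := h k (monomial s 1)
    rw [ih] at this
    rw [hmon]
    exact sub_right_injective this

/-! ### Modes of the generators and of the vectors $\frac12x_1^2+l\,x_2$. -/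

theorem X_mul_derivation (D : Derivation ℂ Fock Fock) (k : ℕ) (p : Fock) :
    X k * D p - D (X k * p) = -(D (X k) * p) := by
  rw [Derivation.leibniz, smul_eq_mul, smul_eq_mul]
  ring

theorem pderiv_X_eq (j k : ℕ) : pderiv j (X k : Fock) = if j = k then 1 else 0 := by
  rw [pderiv_X]
  by_cases h : j = k
  · subst h; simp
  · rw [if_neg h, Pi.single_eq_of_ne (Ne.symm h)]

theorem commCoeff_zero (k : ℕ) : commCoeff k 0 = -((k : ℂ) + 1) := by
  simp [commCoeff]

theorem X_mul_mode_X (l k : ℕ) (n : ℤ) (p : Fock) :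
    X l * mode (X k) n p - mode (X k) n (X l * p) =
      if n = k + l + 1 then commCoeff l k • p else 0 := by
  rw [X_mul_mode l (J := k + 1) (fun j hj => by rw [pderiv_X_eq, if_neg (by omega)]),
    Finset.sum_eq_single k]
  · rw [pderiv_X_eq, if_pos rfl, mode_one]
    by_cases h : n = k + l + 1
    · rw [if_pos h, if_pos (by omega)]; rfl
    · rw [if_neg h, if_neg (by omega)]; simp
  · intro j _ hj
    rw [pderiv_X_eq, if_neg hj, mode_zero]; simp
  · simp

/-- The field of the state `X k` is `∂^(k) α`. -/
theorem mode_X (k : ℕ) (n : ℤ) : mode (X k) n = alphaDeriv k n := by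
  obtain ⟨m, rfl | rfl⟩ : ∃ m : ℕ, n = m ∨ n = -(m : ℤ) - 1 := by
    rcases le_or_gt 0 n with h | h
    · exact ⟨n.toNat, Or.inl (by omega)⟩
    · exact ⟨(-n - 1).toNat, Or.inr (by omega)⟩
  · refine end_ext (by rw [mode_natCast_one, alphaDeriv_natCast_one]) fun l p => ?_
    rw [X_mul_mode_X, alphaDeriv_comm]
    exact if_congr (by norm_cast) rfl rfl
  · refine end_ext ?_ fun l p => ?_
    · rw [mode_neg_one, alphaDeriv_neg, transPow_X, mul_one]
    · rw [X_mul_mode_X, if_neg (by omega), alphaDeriv_neg, alphaDeriv_neg, mul_smul_comm,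
        mul_left_comm, sub_self]

theorem mode_X_zero (n : ℤ) : mode (X 0) n = alpha n := by
  rw [mode_X, alphaDeriv]
  simp

theorem mode_X_one (n : ℤ) : mode (X 1) n = (-n : ℂ) • alpha (n - 1) := by
  rw [mode_X, alphaDeriv]
  simp

/-- The degree operator `L_0` of the standard conformal vector. -/
def degDer : Derivation ℂ Fock Fock := mkDerivation ℂ fun k => ((k : ℂ) + 1) • X k

@[simp]
theorem degDer_X (k : ℕ) : degDer (X k) = ((k : ℂ) + 1) • X k := mkDerivation_X _ _ _

/-- The operator `L_1` of the conformal vector `½ x₁² + l x₂`. -/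
def lowDer (l : ℂ) : Derivation ℂ Fock Fock := mkDerivation ℂ fun k =>
  match k with
  | 0 => C (-2 * l)
  | k + 1 => ((k : ℂ) + 2) • X k

@[simp]
theorem lowDer_X_zero (l : ℂ) : lowDer l (X 0) = C (-2 * l) := mkDerivation_X _ _ _

@[simp]
theorem lowDer_X_succ (l : ℂ) (k : ℕ) : lowDer l (X (k + 1)) = ((k : ℂ) + 2) • X k :=
  mkDerivation_X _ _ _

/-- The only nonzero partial derivative is $x_1$, so the commutator is a single oscillator. For
modes 0, 1 and 2 this oscillator is a creation operator or zero, which is how the three modes are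
recognised as derivations. -/
theorem X_mul_mode_X_zero_sq (l : ℕ) (n : ℤ) (p : Fock) :
    X l * mode ((1 / 2 : ℂ) • X 0 ^ 2) n p - mode ((1 / 2 : ℂ) • X 0 ^ 2) n (X l * p) =
      -((l : ℂ) + 1) • alpha (n - l - 2) p := by
  have hd : ∀ j, pderiv j ((1 / 2 : ℂ) • X 0 ^ 2 : Fock) = if j = 0 then X 0 else 0 := by
    intro j
    rw [Derivation.map_smul, Derivation.leibniz_pow, pderiv_X_eq]
    split_ifs
    · rw [pow_one, smul_eq_mul, mul_one, ← Nat.cast_smul_eq_nsmul ℂ, smul_smul]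
      norm_num
    · simp
  rw [X_mul_mode l (J := 1) (fun j hj => by rw [hd, if_neg (by omega)]), Finset.sum_range_one, hd,
    if_pos rfl, mode_X_zero, commCoeff_zero]
  simp

theorem mode_X_zero_sq_zero : mode ((1 / 2 : ℂ) • X 0 ^ 2) 0 = transDer := by
  refine end_ext ?_ fun k p => ?_
  · have := mode_natCast_one ((1 / 2 : ℂ) • X 0 ^ 2) 0
    simpa using this
  · rw [X_mul_mode_X_zero_sq, Derivation.coeFn_coe, X_mul_derivation, transDer_X,
      show (0 : ℤ) - k - 2 = -((k + 1 : ℕ) : ℤ) - 1 by push_cast; ring, alpha_neg, neg_smul,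
      smul_mul_assoc]

theorem mode_X_zero_sq_one : mode ((1 / 2 : ℂ) • X 0 ^ 2) 1 = degDer := by
  refine end_ext ?_ fun k p => ?_
  · have := mode_natCast_one ((1 / 2 : ℂ) • X 0 ^ 2) 1
    simpa using this
  · rw [X_mul_mode_X_zero_sq, Derivation.coeFn_coe, X_mul_derivation, degDer_X,
      show (1 : ℤ) - k - 2 = -(k : ℤ) - 1 by ring, alpha_neg, neg_smul, smul_mul_assoc]

theorem mode_X_zero_sq_two : mode ((1 / 2 : ℂ) • X 0 ^ 2) 2 = lowDer 0 := by
  refine end_ext ?_ fun k p => ?_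
  · have := mode_natCast_one ((1 / 2 : ℂ) • X 0 ^ 2) 2
    simpa using this
  · rw [X_mul_mode_X_zero_sq, Derivation.coeFn_coe, X_mul_derivation]
    cases k with
    | zero => simp [alpha_zero]
    | succ k =>
      rw [lowDer_X_succ, show (2 : ℤ) - (k + 1 : ℕ) - 2 = -(k : ℤ) - 1 by push_cast; ring,
        alpha_neg, neg_smul, smul_mul_assoc]
      push_cast
      rw [add_assoc, one_add_one_eq_two]

/-- The vectors `½ x₁² + l x₂`. -/
def stdVec (l : ℂ) : Fock := (1 / 2 : ℂ) • X 0 ^ 2 + l • X 1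

theorem mode_stdVec_zero (l : ℂ) : mode (stdVec l) 0 = transDer := by
  rw [stdVec, mode_add, mode_smul l, mode_X_zero_sq_zero, mode_X_one]
  simp

theorem mode_stdVec_one (l : ℂ) : mode (stdVec l) 1 = degDer := by
  rw [stdVec, mode_add, mode_smul l, mode_X_zero_sq_one, mode_X_one]
  simp [alpha_zero]

theorem mode_stdVec_two (l : ℂ) : mode (stdVec l) 2 = lowDer l := by
  have h : lowDer l = lowDer 0 + (-2 * l) • pderiv 0 := by
    refine derivation_ext fun k => ?_
    cases k with
    | zero => simp [C_eq_smul_one]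
    | succ k => simp
  rw [stdVec, mode_add, mode_smul l, mode_X_zero_sq_two, mode_X_one, h]
  ext1 s
  apply LinearMap.ext_ring
  have h2 : ∀ p, alpha (2 - 1) p = pderiv 0 p := fun p => by
    have := alpha_natCast_succ 0 p
    simpa using this
  simp only [LinearMap.comp_apply, LinearMap.add_apply, LinearMap.smul_apply, h2,
    Derivation.coeFn_coe, Derivation.add_apply, Derivation.smul_apply, smul_smul]
  congr 2
  push_cast
  ring

/-- Both sides come from comparing derivations on the generators. At `j = 0` the truncated index `j
- 1` is harmless because its coefficient is zero. -/
theorem pderiv_trans (j : ℕ) (p : Fock) :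
    pderiv j (transDer p) = transDer (pderiv j p) + (j : ℂ) • pderiv (j - 1) p := by
  have h : ⁅(pderiv j : Derivation ℂ Fock Fock), transDer⁆ =
      (j : ℂ) • (pderiv (j - 1) : Derivation ℂ Fock Fock) := by
    refine derivation_ext fun k => ?_
    rw [Derivation.commutator_apply, transDer_X, Derivation.map_smul, pderiv_X_eq, pderiv_X_eq,
      Derivation.smul_apply, pderiv_X_eq]
    have h0 : ∀ P : Prop, ∀ _ : Decidable P, transDer (if P then 1 else 0) = 0 := by
      intro P _
      split_ifs <;> simp
    rw [h0, sub_zero]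
    cases j with
    | zero => simp
    | succ j =>
      by_cases hj : j = k
      · subst hj; simp
      · simp [hj]
  have := congrArg (fun D : Derivation ℂ Fock Fock => D p) h
  simp only [Derivation.commutator_apply, Derivation.smul_apply] at this
  rw [← this]
  abel

theorem ring_choose_succ_eq_mul (r : ℤ) (j : ℕ) :
    Ring.choose r (j + 1) * ((j : ℤ) + 1) = (r - j) * Ring.choose r j := by
  have h1 := Ring.choose_smul_choose r (n := j + 1) (k := j) (by omega)
  rw [Nat.choose_succ_self_right, nsmul_eq_mul, show j + 1 - j = 1 by omega,
    Ring.choose_one_right] at h1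
  push_cast at h1
  rw [mul_comm, h1]
  ring

theorem commCoeff_succ (k j : ℕ) :
    commCoeff k (j + 1) * ((j : ℂ) + 1) = commCoeff k j * (-(k : ℂ) - 2 - j) := by
  have h : ((Ring.choose (-(k : ℤ) - 2) (j + 1) : ℤ) : ℂ) * ((j : ℂ) + 1) =
      (-(k : ℂ) - 2 - j) * (Ring.choose (-(k : ℤ) - 2) j : ℤ) := by
    exact_mod_cast congrArg (Int.cast : ℤ → ℂ) (ring_choose_succ_eq_mul (-(k : ℤ) - 2) j)
  rw [commCoeff, commCoeff, mul_assoc, h]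
  ring

/-- `Y(Ta, z) = ∂Y(a, z)`. -/
theorem mode_trans (b : Fock) : ∀ n : ℤ, mode (transDer b) n = (-n : ℂ) • mode b (n - 1) := by
  induction b using pderiv_induction with
  | h0 => intro n; simp [mode_zero]
  | h b ih =>
    intro n
    refine end_ext ?_ fun k p => ?_
    · obtain ⟨m, rfl | rfl⟩ : ∃ m : ℕ, n = m ∨ n = -(m : ℤ) - 1 := by
        rcases le_or_gt 0 n with h | h
        · exact ⟨n.toNat, Or.inl (by omega)⟩
        · exact ⟨(-n - 1).toNat, Or.inr (by omega)⟩
      · rw [mode_natCast_one]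
        cases m with
        | zero => simp
        | succ m =>
          have := mode_natCast_one b m
          simp [this]
      · rw [mode_neg_one, LinearMap.smul_apply,
          show -(m : ℤ) - 1 - 1 = -((m + 1 : ℕ) : ℤ) - 1 by push_cast; ring, mode_neg_one,
          transPow_trans, ← succ_smul_transPow_succ]
        congr 1
        push_cast
        ring
    · obtain ⟨J, hJ⟩ := exists_pderiv_eq_zero b
      have hJ1 : ∀ j, J + 1 ≤ j → pderiv j (transDer b) = 0 := fun j hj => by
        rw [pderiv_trans, hJ j (by omega), hJ (j - 1) (by omega)]
        simp
      rw [X_mul_mode k hJ1, LinearMap.smul_apply, LinearMap.smul_apply, mul_smul_comm, ← smul_sub,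
        X_mul_mode k hJ]
      -- Commuting `pderiv j` past the translation gives two sums; once the second is shifted by
      -- one, their coefficients combine by `commCoeff_succ`.
      have h1 : ∀ j ∈ Finset.range (J + 1),
          commCoeff k j • mode (pderiv j (transDer b)) (n - k - j - 2) p =
          (commCoeff k j * -(n - k - j - 2)) • mode (pderiv j b) (n - k - j - 3) p +
          (commCoeff k j * j) • mode (pderiv (j - 1) b) (n - k - j - 2) p := by
        intro j _
        rw [pderiv_trans, mode_add, LinearMap.add_apply, ih j, mode_smul, LinearMap.smul_apply,
          LinearMap.smul_apply, smul_add, smul_smul, smul_smul]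
        congr 3
        · push_cast; ring
        · congr 1; ring
      rw [Finset.sum_congr rfl h1, Finset.sum_add_distrib,
        Finset.sum_range_succ, Finset.sum_range_succ' (n := J), hJ J le_rfl, mode_zero,
        Finset.smul_sum]
      simp only [LinearMap.zero_apply, smul_zero, add_zero, Nat.cast_zero, mul_zero, zero_smul]
      rw [← Finset.sum_add_distrib]
      refine Finset.sum_congr rfl fun j _ => ?_
      rw [Nat.add_sub_cancel, show n - k - ((j + 1 : ℕ) : ℤ) - 2 = n - k - j - 3 by push_cast; ring,
        show n - 1 - k - j - 2 = n - k - j - 3 by ring, ← add_smul, smul_smul, Nat.cast_add,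
        Nat.cast_one, commCoeff_succ]
      congr 1
      ring

/-! ## The inner automorphisms `x₁ ↦ x₁ + t` -/

def shiftHom (t : ℂ) : Fock →ₐ[ℂ] Fock := aeval fun k => X k + C (if k = 0 then t else 0)

@[simp]
theorem shiftHom_X (t : ℂ) (k : ℕ) :
    shiftHom t (X k) = X k + C (if k = 0 then t else 0) := aeval_X _ _

theorem shiftHom_comp (s t : ℂ) (h : s + t = 0) :
    (shiftHom s).comp (shiftHom t) = AlgHom.id ℂ Fock := by
  refine algHom_ext fun k => ?_
  rw [AlgHom.comp_apply, shiftHom_X, map_add, shiftHom_X, AlgHom.id_apply, ← algebraMap_eq,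
    AlgHom.commutes, add_assoc, ← map_add]
  split_ifs <;> simp [h]

/-- The automorphism `exp(t α₁)`. -/
def shift (t : ℂ) : Fock ≃ₐ[ℂ] Fock :=
  AlgEquiv.ofAlgHom (shiftHom t) (shiftHom (-t)) (shiftHom_comp _ _ (by simp))
    (shiftHom_comp _ _ (by simp))

@[simp]
theorem shift_X (t : ℂ) (k : ℕ) :
    shift t (X k) = X k + C (if k = 0 then t else 0) := shiftHom_X t k

@[simp]
theorem shift_C (t c : ℂ) : shift t (C c) = C c := AlgEquiv.commutes (shift t) c

theorem derivation_comp_shift (t : ℂ) (D D' : Derivation ℂ Fock Fock)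
    (h : ∀ k, D (shift t (X k)) = shift t (D' (X k))) (p : Fock) :
    D (shift t p) = shift t (D' p) := by
  induction p using MvPolynomial.induction_on with
  | C a => rw [shift_C, derivation_C, derivation_C, map_zero]
  | add p q hp hq => rw [map_add, map_add, map_add, map_add, hp, hq]
  | mul_X p k ih =>
    rw [map_mul, Derivation.leibniz, Derivation.leibniz, ih, h, smul_eq_mul, smul_eq_mul,
      smul_eq_mul, smul_eq_mul, map_add, map_mul, map_mul]

theorem pderiv_shift (t : ℂ) (j : ℕ) (p : Fock) :
    pderiv j (shift t p) = shift t (pderiv j p) := by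
  refine derivation_comp_shift t _ _ (fun k => ?_) p
  rw [shift_X, map_add, pderiv_C, add_zero, pderiv_X_eq]
  split_ifs <;> simp

theorem transDer_shift (t : ℂ) (p : Fock) : transDer (shift t p) = shift t (transDer p) := by
  refine derivation_comp_shift t _ _ (fun k => ?_) p
  rw [shift_X, map_add, derivation_C, add_zero, transDer_X, map_smul, shift_X,
    if_neg k.succ_ne_zero, map_zero, add_zero]

/-- The shift conjugates the degree operator into itself plus $t\,\partial_0$. In the classification
this is the perturbation of $L_0$ that survives, so the shift removes it. -/
theorem degDer_shift (t : ℂ) (p : Fock) :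
    degDer (shift t p) + t • pderiv 0 (shift t p) = shift t (degDer p) := by
  refine derivation_comp_shift t (degDer + t • pderiv 0) degDer (fun k => ?_) p
  rw [shift_X, map_add, derivation_C, add_zero, Derivation.add_apply, degDer_X, map_smul, shift_X,
    Derivation.smul_apply, pderiv_X_eq]
  cases k with
  | zero => simp [smul_eq_C_mul]
  | succ k => simp

theorem transPow_shift (t : ℂ) (n : ℕ) (p : Fock) :
    transPow n (shift t p) = shift t (transPow n p) := by
  induction n with
  | zero => simp
  | succ n ih => rw [transPow_succ, transPow_succ, ih, transDer_shift, map_smul]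

/-- The shift commutes with $T$ and with all $\partial_j$, and it changes each variable by a
constant, which drops out of commutators. Hence the conjugated modes have the same vacuum values and
commutators as the original ones, and `end_ext` applies. -/
theorem shift_mode (t : ℂ) (a : Fock) : ∀ (n : ℤ) (b : Fock),
    shift t (mode a n b) = mode (shift t a) n (shift t b) := by
  have key : ∀ n : ℤ, ((shift t).symm.toLinearMap ∘ₗ mode (shift t a) n ∘ₗ
      (shift t).toLinearMap : Module.End ℂ Fock) = mode a n := by
    induction a using pderiv_induction with
    | h0 => intro n; simp [mode_zero]
    | h a ih =>
      intro n
      refine end_ext ?_ fun k p => ?_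
      · simp only [LinearMap.comp_apply, AlgEquiv.toLinearMap_apply, map_one]
        obtain ⟨m, rfl | rfl⟩ : ∃ m : ℕ, n = m ∨ n = -(m : ℤ) - 1 := by
          rcases le_or_gt 0 n with h | h
          · exact ⟨n.toNat, Or.inl (by omega)⟩
          · exact ⟨(-n - 1).toNat, Or.inr (by omega)⟩
        · rw [mode_natCast_one, mode_natCast_one, map_zero]
        · rw [mode_neg_one, mode_neg_one, transPow_shift, AlgEquiv.symm_apply_apply]
      · obtain ⟨J, hJ⟩ := exists_pderiv_eq_zero a
        have hJ' : ∀ j, J ≤ j → pderiv j (shift t a) = 0 := fun j hj => by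
          rw [pderiv_shift, hJ j hj, map_zero]
        have h1 := X_mul_mode k hJ n p
        have h2 := X_mul_mode k hJ' n (shift t p)
        rw [h1]
        apply (shift t).injective
        simp only [LinearMap.comp_apply, AlgEquiv.toLinearMap_apply, map_sub, map_mul,
          AlgEquiv.apply_symm_apply, map_sum, map_smul]
        rw [shift_X, add_mul, add_mul, map_add, ← smul_eq_C_mul, ← smul_eq_C_mul, map_smul,
          add_sub_add_right_eq_sub, h2]
        refine Finset.sum_congr rfl fun j _ => ?_
        rw [pderiv_shift, ← ih j]
        simp
  intro n b
  rw [← key n]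
  simp

theorem iterate_derivation_mul_X (D : Derivation ℂ Fock Fock) (k : ℕ) (c : ℂ)
    (h : D (X k) = C c) (p : Fock) (n : ℕ) :
    ((D : Module.End ℂ Fock) ^ n) (p * X k) =
      ((D : Module.End ℂ Fock) ^ n) p * X k +
        ((n : ℂ) * c) • ((D : Module.End ℂ Fock) ^ (n - 1)) p := by
  induction n with
  | zero => simp
  | succ n ih =>
    rw [pow_succ', Module.End.mul_apply, ih, map_add, map_smul, Module.End.mul_apply,
      Derivation.coeFn_coe, Derivation.leibniz, h, smul_eq_mul, smul_eq_mul, Nat.add_sub_cancel]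
    have h2 : ((n : ℂ) * c) • D (((D : Module.End ℂ Fock) ^ (n - 1)) p) =
        ((n : ℂ) * c) • ((D : Module.End ℂ Fock) ^ n) p := by
      cases n with
      | zero => simp
      | succ n => rw [pow_succ', Module.End.mul_apply, Derivation.coeFn_coe, Nat.add_sub_cancel]
    rw [h2, mul_comm _ (C c), ← smul_eq_C_mul, Nat.cast_add, Nat.cast_one, add_mul, add_smul,
      one_mul, mul_comm (X k)]
    abel

/-- Taylor's formula in $x_1$. Nilpotency and the value of the sum are proved together, because
multiplying by a variable needs both. -/
theorem exp_pderiv_zero (t : ℂ) (p : Fock) : ∃ K : ℕ, ∀ N, K ≤ N →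
    (((t • pderiv 0 : Derivation ℂ Fock Fock) : Module.End ℂ Fock) ^ N) p = 0 ∧
    ∑ n ∈ Finset.range N, ((n.factorial : ℂ)⁻¹) •
      (((t • pderiv 0 : Derivation ℂ Fock Fock) : Module.End ℂ Fock) ^ n) p = shift t p := by
  set D : Derivation ℂ Fock Fock := t • pderiv 0 with hD
  induction p using MvPolynomial.induction_on with
  | C a =>
    have h : ∀ n, ((D : Module.End ℂ Fock) ^ (n + 1)) (C a) = 0 := fun n => by
      rw [pow_succ, Module.End.mul_apply, Derivation.coeFn_coe, derivation_C, map_zero]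
    refine ⟨1, fun N hN => ?_⟩
    obtain ⟨M, rfl⟩ := Nat.exists_eq_add_of_le' hN
    refine ⟨h M, ?_⟩
    rw [Finset.sum_range_succ', Finset.sum_eq_zero fun n _ => by rw [h, smul_zero]]
    simp
  | add p q hp hq =>
    obtain ⟨K, hK⟩ := hp
    obtain ⟨K', hK'⟩ := hq
    refine ⟨max K K', fun N hN => ?_⟩
    obtain ⟨h1, h2⟩ := hK N (le_trans (le_max_left _ _) hN)
    obtain ⟨h3, h4⟩ := hK' N (le_trans (le_max_right _ _) hN)
    simp only [map_add, h1, h3, add_zero, smul_add, Finset.sum_add_distrib, h2, h4, true_and]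
  | mul_X p k ih =>
    obtain ⟨K, hK⟩ := ih
    have hc : D (X k) = C (if k = 0 then t else 0) := by
      rw [hD, Derivation.smul_apply, pderiv_X_eq]
      by_cases h : k = 0
      · simp [h, smul_eq_C_mul]
      · simp [h, Ne.symm h]
    refine ⟨K + 1, fun N hN => ?_⟩
    obtain ⟨M, rfl⟩ : ∃ M, N = M + 1 := ⟨N - 1, by omega⟩
    obtain ⟨h1, h2⟩ := hK (M + 1) (by omega)
    obtain ⟨h3, h4⟩ := hK M (by omega)
    simp only [iterate_derivation_mul_X D k _ hc, h1, Nat.add_sub_cancel, h3, zero_mul, smul_zero,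
      add_zero, true_and, smul_add, Finset.sum_add_distrib]
    -- The extra term of the Leibniz rule lowers the power of `D` by one, so it resums to a constant
    -- times the series for `p` truncated one step earlier.
    have e : ∀ n ∈ Finset.range M, (((n + 1).factorial : ℂ)⁻¹) •
        (((n + 1 : ℕ) : ℂ) * (if k = 0 then t else 0)) •
          ((D : Module.End ℂ Fock) ^ (n + 1 - 1)) p =
        C (if k = 0 then t else 0) * ((n.factorial : ℂ)⁻¹ • ((D : Module.End ℂ Fock) ^ n) p) := by
      intro n _
      have : ((n : ℂ) + 1) ≠ 0 := by exact_mod_cast n.succ_ne_zero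
      have h5 : (n.factorial : ℂ) ≠ 0 := by exact_mod_cast n.factorial_ne_zero
      rw [← smul_eq_C_mul, smul_smul, smul_smul, Nat.add_sub_cancel, Nat.factorial_succ]
      congr 1
      push_cast
      field_simp
    rw [Finset.sum_range_succ' (n := M) (f := fun n => ((n.factorial : ℂ)⁻¹) • ((n : ℂ) * _) • _),
      Finset.sum_congr rfl e, ← Finset.mul_sum, h4, Nat.cast_zero, zero_mul, zero_smul, smul_zero,
      add_zero, map_mul, shift_X, mul_add, ← h2, Finset.sum_mul, h2, mul_comm (C _)]
    simp only [smul_mul_assoc]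

theorem mode_smul_X_zero_one (t : ℂ) :
    mode (t • X 0) 1 = ((t • pderiv 0 : Derivation ℂ Fock Fock) : Module.End ℂ Fock) := by
  rw [mode_smul, mode_X_zero]
  ext1 s
  apply LinearMap.ext_ring
  have := alpha_natCast_succ 0 (monomial s 1)
  simp only [Nat.cast_zero, zero_add, one_smul] at this
  exact congrArg (t • ·) this

/-- Here $m=1$ and $a=t\,x_1$; the condition $a_{(0)}=0$ holds because $\alpha_0=0$. -/
theorem isInnerAutomorphism_shift (t : ℂ) : IsInnerAutomorphism (shift t).toLinearEquiv := by
  refine ⟨fun a n b => shift_mode t a n b, 1, t • X 0, fun i hi => ?_, fun b => ?_⟩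
  · obtain rfl : i = 0 := by omega
    rw [mode_smul, mode_X_zero, Nat.cast_zero, alpha_zero, smul_zero]
  · obtain ⟨K, hK⟩ := exp_pderiv_zero t b
    rw [Nat.cast_one, mode_smul_X_zero_one]
    constructor
    · refine ⟨Submodule.span ℂ ((fun n => (((t • pderiv 0 : Derivation ℂ Fock Fock) :
        Module.End ℂ Fock) ^ n) b) '' (Finset.range K : Set ℕ)),
        FiniteDimensional.span_of_finite ℂ ((Finset.finite_toSet _).image _), fun n => ?_⟩
      by_cases hn : n < K
      · exact Submodule.subset_span ⟨n, by simpa using hn, rfl⟩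
      · rw [(hK n (by omega)).1]
        exact zero_mem _
    · intro f
      have h := hasSum_sum_of_ne_finset_zero (L := SummationFilter.unconditional ℕ)
        (f := fun n : ℕ => f (((n.factorial : ℂ)⁻¹) •
        (((t • pderiv 0 : Derivation ℂ Fock Fock) : Module.End ℂ Fock) ^ n) b))
        (s := Finset.range K) (fun n hn => by
          rw [(hK n (by simpa using hn)).1, smul_zero, map_zero])
      rwa [← map_sum, (hK K le_rfl).2] at h

/-! ## A filtration of the Fock space -/

/-- The weight of a monomial for which `X k` has weight `k + 2`. -/
abbrev wt : (ℕ →₀ ℕ) →+ ℕ := Finsupp.weight fun k : ℕ => k + 2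

theorem wt_single_add (k : ℕ) (s : ℕ →₀ ℕ) : wt (Finsupp.single k 1 + s) = k + 2 + wt s := by
  rw [map_add, Finsupp.weight_single, one_smul]

/-- The span of the monomials of weight at most `e`. -/
def filt (e : ℤ) : Submodule ℂ Fock where
  carrier := {p | ∀ s, coeff s p ≠ 0 → (wt s : ℤ) ≤ e}
  add_mem' {p q} hp hq s hs := by
    by_contra h
    have h1 : coeff s p = 0 := by_contra fun h' => h (hp s h')
    have h2 : coeff s q = 0 := by_contra fun h' => h (hq s h')
    simp [h1, h2] at hs
  zero_mem' s hs := by simp at hs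
  smul_mem' c p hp s hs := hp s fun h => by simp [h] at hs

theorem filt_mono {e e' : ℤ} (h : e ≤ e') : filt e ≤ filt e' := fun _ hp s hs => (hp s hs).trans h

theorem monomial_mem_filt {e : ℤ} {s : ℕ →₀ ℕ} (h : (wt s : ℤ) ≤ e) (c : ℂ) :
    monomial s c ∈ filt e := by
  classical
  intro t ht
  rw [coeff_monomial] at ht
  by_cases hst : s = t
  · rwa [← hst]
  · simp [hst] at ht

theorem map_mem_filt (f : Module.End ℂ Fock) {e e' : ℤ}
    (h : ∀ s : ℕ →₀ ℕ, (wt s : ℤ) ≤ e → f (monomial s 1) ∈ filt e') {p : Fock} (hp : p ∈ filt e) :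
    f p ∈ filt e' := by
  rw [eq_sum_smul_monomial p, map_sum]
  refine Submodule.sum_mem _ fun s hs => ?_
  rw [map_smul]
  exact Submodule.smul_mem _ _ (h s (hp s (mem_support_iff.1 hs)))

theorem mul_mem_filt {a b : ℤ} {p q : Fock} (hp : p ∈ filt a) (hq : q ∈ filt b) :
    p * q ∈ filt (a + b) := by
  refine map_mem_filt (LinearMap.mulLeft ℂ p) (fun t ht => ?_) hq
  rw [LinearMap.mulLeft_apply, mul_comm]
  refine map_mem_filt (LinearMap.mulLeft ℂ (monomial t 1)) (fun s hs => ?_) hp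
  rw [LinearMap.mulLeft_apply, monomial_mul]
  refine monomial_mem_filt ?_ _
  rw [map_add]
  push_cast
  omega

theorem X_mem_filt (k : ℕ) : (X k : Fock) ∈ filt (k + 2) := by
  refine monomial_mem_filt ?_ _
  rw [Finsupp.weight_single, one_smul]
  push_cast
  rfl

theorem exists_mem_filt (p : Fock) : ∃ e : ℕ, p ∈ filt e := by
  refine ⟨p.support.sup wt, fun s hs => ?_⟩
  exact_mod_cast Finset.le_sup (f := wt) (mem_support_iff.2 hs)

theorem pderiv_mem_filt (k : ℕ) {e : ℤ} {p : Fock} (hp : p ∈ filt e) :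
    pderiv k p ∈ filt (e - (k + 2)) := by
  intro s hs
  have h := hp _ (mem_support_iff.1
    (add_single_mem_support_of_mem_support_pderiv (mem_support_iff.2 hs)))
  rw [add_comm, wt_single_add] at h
  push_cast at h
  omega

theorem X_mul_monomial (k : ℕ) (s : ℕ →₀ ℕ) :
    (monomial (Finsupp.single k 1 + s) 1 : Fock) = X k * monomial s 1 := by
  rw [X, monomial_mul, one_mul]

theorem derivation_mem_filt (D : Derivation ℂ Fock Fock) {r : ℤ}
    (hD : ∀ k : ℕ, D (X k) ∈ filt (k + 2 + r)) {e : ℤ} {p : Fock} (hp : p ∈ filt e) :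
    D p ∈ filt (e + r) := by
  refine map_mem_filt (D : Module.End ℂ Fock) (fun s hs => ?_) hp
  refine filt_mono (add_le_add_left hs r) ?_
  clear hs
  induction s using sorted_induction with
  | h0 =>
    have h : (monomial 0 1 : Fock) = 1 := rfl
    rw [h, Derivation.coeFn_coe, Derivation.map_one_eq_zero]
    exact zero_mem _
  | h k s _ ih =>
    rw [X_mul_monomial, Derivation.coeFn_coe, Derivation.leibniz, wt_single_add, smul_eq_mul,
      smul_eq_mul]
    refine add_mem ?_ ?_
    · refine filt_mono ?_ (mul_mem_filt (X_mem_filt k) ih)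
      push_cast
      omega
    · refine filt_mono ?_ (mul_mem_filt (monomial_mem_filt le_rfl 1) (hD k))
      push_cast
      omega

theorem derivation_isWeightedHomogeneous (D : Derivation ℂ Fock Fock) {r : ℕ}
    (hD : ∀ k : ℕ, IsWeightedHomogeneous (fun k : ℕ => k + 2) (D (X k)) (k + 2 + r)) {e : ℕ}
    {p : Fock} (hp : IsWeightedHomogeneous (fun k : ℕ => k + 2) p e) :
    IsWeightedHomogeneous (fun k : ℕ => k + 2) (D p) (e + r) := by
  rw [eq_sum_smul_monomial p, map_sum]
  refine IsWeightedHomogeneous.sum _ _ _ fun s hs => ?_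
  rw [Derivation.map_smul, smul_eq_C_mul]
  refine IsWeightedHomogeneous.C_mul ?_ _
  rw [← hp (mem_support_iff.1 hs)]
  clear hs
  induction s using sorted_induction with
  | h0 =>
    have h : (monomial 0 1 : Fock) = 1 := rfl
    rw [h, Derivation.map_one_eq_zero]
    exact isWeightedHomogeneous_zero _ _ _
  | h k s _ ih =>
    rw [X_mul_monomial, Derivation.leibniz, wt_single_add, smul_eq_mul, smul_eq_mul]
    refine IsWeightedHomogeneous.add ?_ ?_
    · have := (isWeightedHomogeneous_X ℂ (fun k : ℕ => k + 2) k).mul ih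
      rwa [← add_assoc] at this
    · have := (isWeightedHomogeneous_monomial (fun k : ℕ => k + 2) s (1 : ℂ) rfl).mul (hD k)
      rwa [← add_assoc, add_comm (Finsupp.weight _ s)] at this

theorem transDer_mem_filt {e : ℤ} {p : Fock} (hp : p ∈ filt e) : transDer p ∈ filt (e + 1) := by
  refine derivation_mem_filt _ (fun k => ?_) hp
  rw [transDer_X]
  refine Submodule.smul_mem _ _ (filt_mono ?_ (X_mem_filt (k + 1)))
  push_cast
  omega

theorem transPow_mem_filt (n : ℕ) {e : ℤ} {p : Fock} (hp : p ∈ filt e) :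
    transPow n p ∈ filt (e + n) := by
  induction n with
  | zero => simpa using hp
  | succ n ih =>
    rw [transPow_succ]
    refine Submodule.smul_mem _ _ ?_
    have := transDer_mem_filt ih
    rwa [add_assoc] at this

theorem transPow_isWeightedHomogeneous (n : ℕ) {e : ℕ} {p : Fock}
    (hp : IsWeightedHomogeneous (fun k : ℕ => k + 2) p e) :
    IsWeightedHomogeneous (fun k : ℕ => k + 2) (transPow n p) (e + n) := by
  induction n with
  | zero => simpa using hp
  | succ n ih =>
    rw [transPow_succ, smul_eq_C_mul]
    refine IsWeightedHomogeneous.C_mul ?_ _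
    refine derivation_isWeightedHomogeneous transDer (r := 1) (fun k => ?_) ih
    rw [transDer_X, smul_eq_C_mul]
    refine IsWeightedHomogeneous.C_mul ?_ _
    have := isWeightedHomogeneous_X ℂ (fun k : ℕ => k + 2) (k + 1)
    rwa [show k + 1 + 2 = k + 2 + 1 by ring] at this

/-- The leading part of `u_(n)`: multiplication by a divided derivative of `u`. -/
def leadCoeff (n : ℤ) (u : Fock) : Fock := if n < 0 then transPow (-n - 1).toNat u else 0

theorem leadCoeff_mem_filt (n : ℤ) {e : ℤ} {u : Fock} (hu : u ∈ filt e) :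
    leadCoeff n u ∈ filt (e - n - 1) := by
  rw [leadCoeff]
  split_ifs with h
  · refine filt_mono ?_ (transPow_mem_filt _ hu)
    omega
  · exact zero_mem _

/-- The weight is conformal weight plus polynomial degree. The modes respect conformal weight, and
each contraction removes two variables, so every contraction term lies strictly below the
uncontracted product, which is multiplication by a divided derivative of `u`. Conformal weight alone
would not separate them. -/
theorem mode_monomial_sub_mem_filt (t : ℕ →₀ ℕ) : ∀ (n e : ℤ) (u : Fock), u ∈ filt e →
    mode u n (monomial t 1) - leadCoeff n u * monomial t 1 ∈ filt (e + wt t - n - 2) := by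
  induction t using sorted_induction with
  | h0 =>
    intro n e u _
    have h : (monomial 0 1 : Fock) = 1 := rfl
    rw [h, mul_one, leadCoeff]
    split_ifs with hn
    · rw [← mode_neg_one, show -((-n - 1).toNat : ℤ) - 1 = n by omega, sub_self]
      exact zero_mem _
    · have := mode_natCast_one u n.toNat
      rw [show ((n.toNat : ℕ) : ℤ) = n by omega] at this
      rw [this, sub_zero]
      exact zero_mem _
  | h k t _ ih =>
    intro n e u hu
    obtain ⟨J, hJ⟩ := exists_pderiv_eq_zero u
    have hb : ∀ (n e : ℤ) (u : Fock), u ∈ filt e →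
        mode u n (monomial t 1) ∈ filt (e + wt t - n - 1) := by
      intro n e u hu
      rw [← sub_add_cancel (mode u n (monomial t 1)) (leadCoeff n u * monomial t 1)]
      refine add_mem (filt_mono (by omega) (ih n e u hu)) (filt_mono ?_
        (mul_mem_filt (leadCoeff_mem_filt n hu) (monomial_mem_filt le_rfl 1)))
      omega
    have h := X_mul_mode k hJ n (monomial t 1)
    have h' : mode u n (X k * monomial t 1) - leadCoeff n u * (X k * monomial t 1) =
        X k * (mode u n (monomial t 1) - leadCoeff n u * monomial t 1) -
        ∑ j ∈ Finset.range J, commCoeff k j • mode (pderiv j u) (n - k - j - 2) (monomial t 1) := by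
      rw [← h]
      ring
    rw [X_mul_monomial, h', wt_single_add]
    refine sub_mem (filt_mono ?_ (mul_mem_filt (X_mem_filt k) (ih n e u hu)))
      (Submodule.sum_mem _ fun j _ => Submodule.smul_mem _ _ (filt_mono ?_
        (hb _ _ _ (pderiv_mem_filt j hu))))
    · push_cast
      omega
    · push_cast
      omega

/-! ## Evolutionary derivations -/

/-- The derivation commuting with translations that maps `X 0` to `f`. -/
def evolDer (f : Fock) : Derivation ℂ Fock Fock := mkDerivation ℂ fun k => transPow k f

@[simp]
theorem evolDer_X (f : Fock) (k : ℕ) : evolDer f (X k) = transPow k f := mkDerivation_X _ _ _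

theorem derivation_sum_apply {ι : Type*} (s : Finset ι) (D : ι → Derivation ℂ Fock Fock)
    (p : Fock) : (∑ i ∈ s, D i) p = ∑ i ∈ s, D i p := by
  have := map_sum (Derivation.coeFnAddMonoidHom (R := ℂ) (A := Fock) (M := Fock)) D s
  exact (congrFun this p).trans (Finset.sum_apply _ _ _)

theorem derivation_eq_sum (D : Derivation ℂ Fock Fock) {J : ℕ} {g : Fock}
    (hJ : ∀ j, J ≤ j → pderiv j g = 0) :
    D g = ∑ k ∈ Finset.range J, pderiv k g * D (X k) := by
  obtain ⟨K, hK⟩ := g.vars.bddAbove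
  rw [pderiv_sum_range_congr (le_max_left J (K + 1)) hJ (fun k q => q * D (X k)) (by simp)]
  set N := max J (K + 1) with hN
  have hg : g ∈ supported ℂ (Set.Iio N) := by
    rw [mem_supported]
    intro i hi
    have := hK hi
    simp only [Set.mem_Iio]
    omega
  have h := derivation_eqOn_supported (D₁ := D)
    (D₂ := ∑ k ∈ Finset.range N, D (X k) • (pderiv k : Derivation ℂ Fock Fock))
    (s := Set.Iio N) (fun i hi => ?_) hg
  · rw [h]
    simp [derivation_sum_apply, mul_comm]
  · simp only [Function.comp_apply, derivation_sum_apply, Derivation.smul_apply,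
      pderiv_X_eq, smul_eq_mul, mul_ite, mul_one, mul_zero, Finset.sum_ite_eq', Finset.mem_range]
    rw [if_pos (Set.mem_Iio.1 hi)]

/-- Each translation raises the differential order by one and, by `pderiv_trans`, keeps the top
coefficient up to a nonzero factor. -/
theorem pderiv_transPow {f : Fock} {m : ℕ} (hm : ∀ j, m < j → pderiv j f = 0) (k : ℕ) :
    (∀ j, m + k < j → pderiv j (transPow k f) = 0) ∧
    ∃ c : ℂ, c ≠ 0 ∧ pderiv (m + k) (transPow k f) = c • pderiv m f := by
  induction k with
  | zero => exact ⟨by simpa using hm, 1, one_ne_zero, by simp⟩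
  | succ k ih =>
    obtain ⟨h0, c, hc, h1⟩ := ih
    have hk : ((k : ℂ) + 1)⁻¹ ≠ 0 := inv_ne_zero (by exact_mod_cast k.succ_ne_zero)
    have hmk : ((m : ℂ) + (k + 1)) ≠ 0 := by exact_mod_cast (m + k).succ_ne_zero
    refine ⟨fun j hj => ?_, ((k : ℂ) + 1)⁻¹ * ((m + (k + 1)) * c),
      mul_ne_zero hk (mul_ne_zero hmk hc), ?_⟩
    · rw [transPow_succ, Derivation.map_smul, pderiv_trans, h0 j (by omega),
        h0 (j - 1) (by omega)]
      simp
    · rw [transPow_succ, Derivation.map_smul, pderiv_trans, h0 _ (by omega),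
        show m + (k + 1) - 1 = m + k by omega, h1, map_zero, zero_add, smul_smul, smul_smul]
      congr 1
      push_cast
      ring

/-- By the chain rule, an application of the derivation to `g` of order `K` gives order `K + m`,
with top coefficient a nonzero multiple of `pderiv K g * pderiv m f`. As `m ≠ 0`, no second
derivative of `g` interferes; the product is nonzero because the ring is a domain. -/
theorem evolDer_pow_ne_zero_of_order {f : Fock} {m : ℕ} (hm0 : m ≠ 0) (hf : pderiv m f ≠ 0)
    (hm : ∀ j, m < j → pderiv j f = 0) (n : ℕ) :
    ∃ K, pderiv K (((evolDer f : Module.End ℂ Fock) ^ n) (X 0)) ≠ 0 ∧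
      ∀ j, K < j → pderiv j (((evolDer f : Module.End ℂ Fock) ^ n) (X 0)) = 0 := by
  induction n with
  | zero =>
    refine ⟨0, by simp, fun j hj => ?_⟩
    rw [pow_zero, Module.End.one_apply, pderiv_X_eq, if_neg (by omega)]
  | succ n ih =>
    obtain ⟨K, hK, hK'⟩ := ih
    rw [pow_succ', Module.End.mul_apply, Derivation.coeFn_coe]
    set g := ((evolDer f : Module.End ℂ Fock) ^ n) (X 0)
    have hg := derivation_eq_sum (evolDer f) (J := K + 1) (g := g) fun j hj => hK' j (by omega)
    have hcomm : ∀ i j, pderiv i (pderiv j g) = pderiv j (pderiv i g) := fun i j => by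
      have h : ⁅(pderiv i : Derivation ℂ Fock Fock), (pderiv j : Derivation ℂ Fock Fock)⁆ = 0 := by
        refine derivation_ext fun l => ?_
        rw [Derivation.commutator_apply, pderiv_X_eq, pderiv_X_eq]
        split_ifs <;> simp
      have h' := congrArg (fun D : Derivation ℂ Fock Fock => D g) h
      simp only [Derivation.commutator_apply, Derivation.zero_apply] at h'
      exact sub_eq_zero.1 h'
    have hd : ∀ j, K < j → pderiv j (evolDer f g) =
        ∑ k ∈ Finset.range (K + 1), pderiv k g * pderiv j (transPow k f) := by
      intro j hj
      rw [hg, map_sum]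
      refine Finset.sum_congr rfl fun k _ => ?_
      rw [Derivation.leibniz, evolDer_X, hcomm, hK' j hj, map_zero, smul_zero, add_zero,
        smul_eq_mul]
    refine ⟨K + m, ?_, fun j hj => ?_⟩
    · obtain ⟨c, hc, h⟩ := (pderiv_transPow hm K).2
      rw [hd _ (by omega), Finset.sum_range_succ, Finset.sum_eq_zero, zero_add, add_comm K m, h]
      · exact mul_ne_zero hK (smul_ne_zero hc hf)
      · intro k hk
        rw [(pderiv_transPow hm k).1 _ (by have := Finset.mem_range.1 hk; omega), mul_zero]
    · rw [hd _ (by omega)]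
      refine Finset.sum_eq_zero fun k hk => ?_
      rw [(pderiv_transPow hm k).1 _ (by have := Finset.mem_range.1 hk; omega), mul_zero]

theorem evolDer_pow_X_zero_pow {c : ℂ} (hc : c ≠ 0) {q : ℕ} (n : ℕ) :
    ∃ (a : ℂ) (N : ℕ), a ≠ 0 ∧
      ((evolDer (c • X 0 ^ (q + 1)) : Module.End ℂ Fock) ^ n) (X 0) = a • X 0 ^ (N + 1) := by
  induction n with
  | zero => exact ⟨1, 0, one_ne_zero, by simp⟩
  | succ n ih =>
    obtain ⟨a, N, ha, h⟩ := ih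
    refine ⟨a * ((N + 1 : ℕ) * c), N + q,
      mul_ne_zero ha (mul_ne_zero (Nat.cast_ne_zero.2 (by omega)) hc), ?_⟩
    rw [pow_succ', Module.End.mul_apply, h, map_smul, Derivation.coeFn_coe, Derivation.leibniz_pow,
      evolDer_X, transPow_zero, Nat.add_sub_cancel, ← Nat.cast_smul_eq_nsmul ℂ, mul_smul, mul_smul]
    congr 2
    rw [smul_eq_mul, mul_smul_comm, ← pow_add, add_assoc]

/-- Either `f` involves some variable other than $x_1$, and the differential orders grow, or
homogeneity forces `f` to be a multiple of a power of $x_1$, and the iterates are explicit powers.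
-/
theorem evolDer_pow_ne_zero {f : Fock} {s : ℕ} (hs : 2 < s) (hf0 : f ≠ 0)
    (hf : IsWeightedHomogeneous (fun k : ℕ => k + 2) f s) (n : ℕ) :
    ((evolDer f : Module.End ℂ Fock) ^ n) (X 0) ≠ 0 := by
  obtain ⟨J, hJ⟩ := exists_pderiv_eq_zero f
  by_cases h : ∃ m, m ≠ 0 ∧ pderiv m f ≠ 0
  · classical
    have hP : ∃ m, (m ≠ 0 ∧ pderiv m f ≠ 0) ∧ ∀ j, m < j → pderiv j f = 0 := by
      obtain ⟨m, hm⟩ := h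
      have hmJ : m ≤ J := by
        by_contra hc
        exact hm.2 (hJ m (by omega))
      refine ⟨Nat.findGreatest (fun m => m ≠ 0 ∧ pderiv m f ≠ 0) J,
        Nat.findGreatest_spec (P := fun m => m ≠ 0 ∧ pderiv m f ≠ 0) hmJ hm, fun j hj => ?_⟩
      by_cases hjJ : j ≤ J
      · have := Nat.findGreatest_is_greatest hj hjJ
        simp only [not_and, not_not] at this
        exact this (by omega)
      · exact hJ j (by omega)
    obtain ⟨m, ⟨hm0, hm1⟩, hm2⟩ := hP
    obtain ⟨K, hK, _⟩ := evolDer_pow_ne_zero_of_order hm0 hm1 hm2 n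
    intro h0
    rw [h0, map_zero] at hK
    exact hK rfl
  · push Not at h
    have hsupp : ∀ t, coeff t f ≠ 0 → t = Finsupp.single 0 (t 0) := by
      intro t ht
      ext i
      by_cases hi : i = 0
      · subst hi; simp
      · rw [Finsupp.single_eq_of_ne hi]
        by_contra hti
        have hD := congrArg (coeff (t - Finsupp.single i 1)) (h i hi)
        have hle : Finsupp.single i 1 ≤ t := by
          rw [Finsupp.single_le_iff]; omega
        rw [coeff_zero, coeff_pderiv, tsub_add_cancel_of_le hle] at hD
        simp only [mul_eq_zero, ht, false_or] at hD
        exact Nat.cast_add_one_ne_zero _ hD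
    obtain ⟨t, ht⟩ := ne_zero_iff.1 hf0
    have hwt : ∀ t, coeff t f ≠ 0 → t 0 * 2 = s := by
      intro t ht
      have := hf ht
      rw [hsupp t ht, Finsupp.weight_single] at this
      simpa using this
    have hft : f = coeff t f • X 0 ^ (t 0 - 1 + 1) := by
      have h1 := hwt t ht
      rw [show t 0 - 1 + 1 = t 0 by omega, X_pow_eq_monomial, smul_monomial, smul_eq_mul, mul_one,
        ← hsupp t ht]
      refine eq_monomial_of_support_subset_singleton fun t' ht' => ?_
      rw [hsupp t ht, hsupp t' (mem_support_iff.1 ht')]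
      have := hwt t' (mem_support_iff.1 ht')
      congr 1
      omega
    obtain ⟨a, N, ha, h⟩ := evolDer_pow_X_zero_pow ht (q := t 0 - 1) n
    rw [← hft] at h
    rw [h]
    exact smul_ne_zero ha (pow_ne_zero _ (X_ne_zero 0))

/-- A locally finite operator of the form `L_0 = degDer + w_(1)` has bounded `w_(1) x₁`. -/
theorem mem_filt_two_of_locally_finite {L : Module.End ℂ Fock} {u : Fock} (h1 : L 1 = 0)
    (hL : ∀ (k : ℕ) (p : Fock),
      L (X k * p) = ((k : ℂ) + 1) • (X k * p) + X k * L p + mode u (-(k : ℤ) - 1) p)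
    (hfin : ∃ e : ℤ, ∀ n : ℕ, (L ^ n) (X 0) ∈ filt e) : u ∈ filt 2 := by
  by_contra hu
  have hu0 : u ≠ 0 := fun h => hu (by rw [h]; exact zero_mem _)
  -- The variable `X 0` has weight 2. If the top weight `s` of `u` exceeds 2, the derivation with
  -- characteristic `f`, the top component of `u`, raises weights by `s - 2 > 0`.
  set s := weightedTotalDegree (fun k : ℕ => k + 2) u with hs
  have hus : u ∈ filt s := fun t ht => by
    exact_mod_cast le_weightedTotalDegree _ (mem_support_iff.2 ht)
  have hs2 : 2 < s := by
    by_contra h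
    exact hu (filt_mono (by omega) hus)
  set f := weightedHomogeneousComponent (fun k : ℕ => k + 2) s u with hf
  have hfh : IsWeightedHomogeneous (fun k : ℕ => k + 2) f s :=
    weightedHomogeneousComponent_isWeightedHomogeneous _ _
  have hf0 : f ≠ 0 := by
    obtain ⟨t, ht, hts⟩ : ∃ t ∈ u.support, wt t = s := by
      obtain ⟨t, ht, h⟩ := Finset.exists_mem_eq_sup u.support
        (support_nonempty.2 hu0) wt
      exact ⟨t, ht, h.symm⟩
    intro h
    have := congrArg (coeff t) h
    rw [hf, coeff_weightedHomogeneousComponent, if_pos hts, coeff_zero] at this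
    exact mem_support_iff.1 ht this
  have huf : u - f ∈ filt (s - 1) := by
    intro t ht
    rw [coeff_sub, hf, coeff_weightedHomogeneousComponent] at ht
    split_ifs at ht with h
    · simp at ht
    · rw [sub_zero] at ht
      have := hus t ht
      have h' : wt t ≠ s := h
      omega
  have hfs : f ∈ filt s := fun t ht => by
    exact_mod_cast (hfh ht).le
  -- `L` agrees with `evolDer f` to leading order. Three errors have relative weight at most `s -
  -- 3`: the degree operator (here `s ≥ 3` is used), the contractions, and the lower part `u - f`.
  have key : ∀ t : ℕ →₀ ℕ, L (monomial t 1) - evolDer f (monomial t 1) ∈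
      filt (wt t + (s - 3)) := by
    intro t
    induction t using sorted_induction with
    | h0 =>
      have h : (monomial 0 1 : Fock) = 1 := rfl
      rw [h, h1, Derivation.map_one_eq_zero, sub_zero]
      exact zero_mem _
    | h k t _ ih =>
      rw [X_mul_monomial, hL, Derivation.leibniz, evolDer_X, wt_single_add]
      have e : ((k : ℂ) + 1) • (X k * monomial t 1 : Fock) + X k * L (monomial t 1) +
          mode u (-(k : ℤ) - 1) (monomial t 1) -
          ((X k : Fock) • evolDer f (monomial t 1) + (monomial t 1 : Fock) • transPow k f) =
          ((k : ℂ) + 1) • (X k * monomial t 1 : Fock) +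
          X k * (L (monomial t 1) - evolDer f (monomial t 1)) +
          (mode u (-(k : ℤ) - 1) (monomial t 1) - transPow k u * monomial t 1) +
          transPow k (u - f) * monomial t 1 := by
        rw [map_sub, smul_eq_mul, smul_eq_mul]
        ring
      rw [e]
      have hlc : leadCoeff (-(k : ℤ) - 1) u = transPow k u := by
        rw [leadCoeff, if_pos (by omega)]
        congr 2
        omega
      refine add_mem (add_mem (add_mem (Submodule.smul_mem _ _ (filt_mono ?_
        (mul_mem_filt (X_mem_filt k) (monomial_mem_filt le_rfl 1)))) (filt_mono ?_
        (mul_mem_filt (X_mem_filt k) ih))) (filt_mono ?_ (hlc ▸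
          mode_monomial_sub_mem_filt t (-(k : ℤ) - 1) s u hus))) (filt_mono ?_
          (mul_mem_filt (transPow_mem_filt k huf) (monomial_mem_filt le_rfl 1))) <;>
      · push_cast
        omega
  have key2 : ∀ (e : ℤ) (p : Fock), p ∈ filt e → L p - evolDer f p ∈ filt (e + (s - 3)) := by
    intro e p hp
    refine map_mem_filt (L - (evolDer f : Module.End ℂ Fock)) (fun t ht => ?_) hp
    exact filt_mono (by omega) (key t)
  have hev : ∀ (e : ℤ) (p : Fock), p ∈ filt e → evolDer f p ∈ filt (e + (s - 2)) := by
    intro e p hp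
    refine derivation_mem_filt _ (fun k => ?_) hp
    rw [evolDer_X]
    exact filt_mono (by omega) (transPow_mem_filt k hfs)
  have hevh : ∀ n : ℕ, IsWeightedHomogeneous (fun k : ℕ => k + 2)
      (((evolDer f : Module.End ℂ Fock) ^ n) (X 0)) (2 + n * (s - 2)) := by
    intro n
    induction n with
    | zero => simpa using isWeightedHomogeneous_X ℂ (fun k : ℕ => k + 2) 0
    | succ n ih =>
      have := derivation_isWeightedHomogeneous (evolDer f) (r := s - 2) (fun k => ?_) ih
      · rw [pow_succ', Module.End.mul_apply, Derivation.coeFn_coe]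
        convert this using 1
        ring
      · rw [evolDer_X]
        convert transPow_isWeightedHomogeneous k hfh using 1
        omega
  have hcast : ∀ n : ℕ, ((2 + n * (s - 2) : ℕ) : ℤ) = 2 + n * ((s : ℤ) - 2) := fun n => by
    push_cast [Nat.cast_sub hs2.le]
    ring
  have hevf : ∀ n : ℕ, ((evolDer f : Module.End ℂ Fock) ^ n) (X 0) ∈
      filt (2 + n * ((s : ℤ) - 2)) := fun n t ht => by
    rw [← hcast]
    exact_mod_cast (hevh n ht).le
  have hpow : ∀ n : ℕ, (L ^ n) (X 0) - ((evolDer f : Module.End ℂ Fock) ^ n) (X 0) ∈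
      filt (2 + n * ((s : ℤ) - 2) - 1) := by
    intro n
    induction n with
    | zero => rw [pow_zero, pow_zero, sub_self]; exact zero_mem _
    | succ n ih =>
      rw [pow_succ', pow_succ', Module.End.mul_apply, Module.End.mul_apply, Derivation.coeFn_coe]
      set a := (L ^ n) (X 0)
      set b := ((evolDer f : Module.End ℂ Fock) ^ n) (X 0)
      have e : L a - evolDer f b = (L (a - b) - evolDer f (a - b)) + evolDer f (a - b) +
          (L b - evolDer f b) := by
        rw [map_sub, map_sub]
        abel
      rw [e]
      refine add_mem (add_mem (filt_mono ?_ (key2 _ _ ih)) (filt_mono ?_ (hev _ _ ih)))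
        (filt_mono ?_ (key2 _ _ (hevf n))) <;>
      · push_cast
        nlinarith
  obtain ⟨e, he⟩ := hfin
  -- Each iteration gains at least one unit of weight, so `e.toNat` iterations suffice to leave
  -- `filt e`.
  have hn : e ≤ 2 + (e.toNat : ℤ) * ((s : ℤ) - 2) - 1 := by
    have h3 : (1 : ℤ) ≤ (s : ℤ) - 2 := by omega
    have h4 : (0 : ℤ) ≤ e.toNat := by positivity
    have h5 : e ≤ (e.toNat : ℤ) := Int.self_le_toNat e
    nlinarith
  have hmem := sub_mem (filt_mono hn (he e.toNat)) (hpow e.toNat)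
  rw [sub_sub_cancel] at hmem
  obtain ⟨t, ht⟩ := ne_zero_iff.1 (evolDer_pow_ne_zero hs2 hf0 hfh e.toNat)
  have h6 := hmem t ht
  have h7 : wt t = _ := hevh e.toNat ht
  rw [h7, hcast] at h6
  omega

/-! ## Classification of the conformal vectors -/

theorem ring_choose_succ (r : ℤ) (j : ℕ) :
    Ring.choose r (j + 1) * ((j : ℤ) + 1) = r * Ring.choose (r - 1) j := by
  have h1 := Ring.choose_smul_choose r (n := j + 1) (k := 1) (by omega)
  rw [Nat.choose_one_right, nsmul_eq_mul, Ring.choose_one_right, Nat.add_sub_cancel] at h1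
  push_cast at h1
  rw [← h1]
  ring

theorem mode_transPow (j : ℕ) (b : Fock) : ∀ n : ℤ, mode (transPow j b) n =
    ((-1) ^ j * (Ring.choose n j : ℤ) : ℂ) • mode b (n - j) := by
  induction j with
  | zero => intro n; simp
  | succ j ih =>
    intro n
    have hj : ((j : ℂ) + 1) ≠ 0 := by exact_mod_cast j.succ_ne_zero
    have h : ((Ring.choose n (j + 1) : ℤ) : ℂ) * ((j : ℂ) + 1) =
        (n : ℂ) * (Ring.choose (n - 1) j : ℤ) := by
      exact_mod_cast congrArg (Int.cast : ℤ → ℂ) (ring_choose_succ n j)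
    rw [transPow_succ, mode_smul, mode_trans, ih, smul_smul, smul_smul,
      show n - 1 - (j : ℤ) = n - ((j + 1 : ℕ) : ℤ) by push_cast; ring]
    congr 1
    rw [mul_assoc, inv_mul_eq_iff_eq_mul₀ hj, pow_succ]
    linear_combination (-1) ^ j * h

theorem commCoeff_eq (k j : ℕ) :
    commCoeff k j = -(((j : ℂ) + 1) + k) * (Ring.choose (-(k : ℤ) - 1) j : ℤ) := by
  have h : ((k : ℤ) + 1) * Ring.choose (-(k : ℤ) - 2) j =
      (((j : ℤ) + 1) + k) * Ring.choose (-(k : ℤ) - 1) j := by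
    have h1 := ring_choose_succ (-(k : ℤ) - 1) j
    rw [ring_choose_succ_eq_mul, show -(k : ℤ) - 1 - 1 = -k - 2 by ring] at h1
    linear_combination h1
  have h' : ((k : ℂ) + 1) * (Ring.choose (-(k : ℤ) - 2) j : ℤ) =
      (((j : ℂ) + 1) + k) * (Ring.choose (-(k : ℤ) - 1) j : ℤ) := by
    exact_mod_cast congrArg (Int.cast : ℤ → ℂ) h
  rw [commCoeff]
  linear_combination -h'

/-- Since $w_{(1)}1=0$, the vector $w_{(1)}x_1$ is minus the commutator of $x_1$ with $w_{(1)}$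
applied to the vacuum. -/
theorem mode_one_X_zero {w : Fock} {J : ℕ} (hJ : ∀ j, J ≤ j → pderiv j w = 0) :
    mode w 1 (X 0) = ∑ j ∈ Finset.range J, ((-1) ^ j * ((j : ℂ) + 1)) •
      transPow j (pderiv j w) := by
  have h := X_mul_mode 0 hJ 1 1
  have h0 := mode_natCast_one w 1
  rw [Nat.cast_one] at h0
  rw [h0, mul_zero, zero_sub, mul_one, neg_eq_iff_eq_neg, ← Finset.sum_neg_distrib] at h
  rw [h]
  refine Finset.sum_congr rfl fun j _ => ?_
  rw [show (1 : ℤ) - (0 : ℕ) - j - 2 = -(j : ℤ) - 1 by push_cast; ring, mode_neg_one, commCoeff_eq,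
    ← neg_smul]
  congr 1
  have := Ring.choose_neg (1 : ℤ) j
  simp only [Nat.cast_zero, neg_zero, zero_sub, add_zero]
  rw [this]
  rw [add_sub_cancel_left, Ring.choose_natCast, Nat.choose_self]
  simp [Units.smul_def]
  ring

/-- If `w_(0) = 0` then `w_(1)` is a derivation of the vertex algebra. -/
theorem mode_one_X_mul {w : Fock} (hw : mode w 0 = 0) (k : ℕ) (p : Fock) :
    mode w 1 (X k * p) = X k * mode w 1 p + mode (mode w 1 (X 0)) (-(k : ℤ) - 1) p := by
  obtain ⟨J, hJ⟩ := exists_pderiv_eq_zero w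
  -- For positive `k` this is the commutator of the preceding variable with $w_{(0)}=0$. In
  -- `commCoeff_eq` the factor $(j+1)+k$ splits: the part `k` gives this vanishing sum and the part
  -- `j + 1` gives the mode of $w_{(1)}x_1$.
  have hzero : ∑ j ∈ Finset.range J, ((k : ℂ) * (Ring.choose (-(k : ℤ) - 1) j : ℤ)) •
      mode (pderiv j w) (-(k : ℤ) - j - 1) p = 0 := by
    cases k with
    | zero => simp
    | succ k =>
      have h := X_mul_mode k hJ 0 p
      rw [hw, LinearMap.zero_apply, LinearMap.zero_apply, mul_zero, sub_zero] at h
      rw [← neg_eq_zero, ← Finset.sum_neg_distrib, h]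
      refine Finset.sum_congr rfl fun j _ => ?_
      rw [show -((k + 1 : ℕ) : ℤ) - j - 1 = 0 - k - j - 2 by push_cast; ring, ← neg_smul, commCoeff]
      congr 1
      push_cast
      rw [show -((k : ℤ) + 1) - 1 = -k - 2 by ring]
      ring
  have h := X_mul_mode k hJ 1 p
  rw [sub_eq_iff_eq_add, ← sub_eq_iff_eq_add'] at h
  rw [← h, sub_eq_add_neg, add_right_inj, neg_eq_iff_add_eq_zero, mode_one_X_zero hJ, mode_sum,
    LinearMap.sum_apply, ← Finset.sum_add_distrib, ← neg_eq_zero, ← Finset.sum_neg_distrib, ← hzero]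
  refine Finset.sum_congr rfl fun j _ => ?_
  have hsq : ((-1 : ℂ) ^ j) * (-1) ^ j = 1 := by rw [← mul_pow]; simp
  rw [mode_smul, mode_transPow, smul_smul, LinearMap.smul_apply, commCoeff_eq,
    show (1 : ℤ) - k - j - 2 = -k - j - 1 by ring, show -(k : ℤ) - 1 - j = -k - j - 1 by ring,
    ← add_smul, ← neg_smul]
  congr 1
  linear_combination -((j : ℂ) + 1) * (Ring.choose (-(k : ℤ) - 1) j : ℤ) * hsq

theorem constantCoeff_transDer (p : Fock) : constantCoeff (transDer p) = 0 := by
  induction p using MvPolynomial.induction_on with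
  | C a => simp
  | add p q hp hq => rw [map_add, map_add, hp, hq, add_zero]
  | mul_X p k ih =>
    rw [Derivation.leibniz, transDer_X, map_add, smul_eq_mul, smul_eq_mul, map_mul, map_mul, ih]
    simp [smul_eq_C_mul]

/-- The $x_1$-coefficient of $w_{(1)}x_1$ equals that of $\partial_0w$, since proper translates have
no $x_1$ term. Up to sign it is also the $x_2$-coefficient of the commutator of $x_1$ with $w_{(0)}$
at the vacuum, where only the single translate $T\partial_0w$ contributes; that commutator is zero.
-/
theorem constantCoeff_pderiv_zero_mode_one {w : Fock} (hw : mode w 0 = 0) :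
    constantCoeff (pderiv 0 (mode w 1 (X 0))) = 0 := by
  obtain ⟨J, hJ⟩ := exists_pderiv_eq_zero w
  have h0 : ∀ g, constantCoeff (pderiv 0 (transDer g)) = 0 := fun g => by
    rw [pderiv_trans]
    simp [constantCoeff_transDer]
  have h1 : ∀ g, constantCoeff (pderiv 1 (transDer g)) = constantCoeff (pderiv 0 g) := fun g => by
    rw [pderiv_trans]
    simp [constantCoeff_transDer]
  have hJ1 : ∀ j, J + 1 ≤ j → pderiv j w = 0 := fun j hj => hJ j (by omega)
  have hz := X_mul_mode 0 hJ1 0 1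
  rw [hw, LinearMap.zero_apply, LinearMap.zero_apply, mul_zero, sub_zero] at hz
  have hz' := congrArg (fun g => constantCoeff (pderiv 1 g)) hz
  simp only [map_zero, map_sum] at hz'
  rw [Finset.sum_range_succ', Finset.sum_eq_zero, zero_add] at hz'
  · rw [mode_one_X_zero hJ1, map_sum, map_sum, Finset.sum_range_succ', Finset.sum_eq_zero, zero_add]
    · have := mode_neg_one (pderiv 0 w) 1
      rw [show (0 : ℤ) - (0 : ℕ) - (0 : ℕ) - 2 = -((1 : ℕ) : ℤ) - 1 by norm_num, this,
        transPow_one, Derivation.map_smul, constantCoeff_smul, h1, commCoeff_zero] at hz'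
      simpa using hz'.symm
    · intro j _
      rw [Derivation.map_smul, constantCoeff_smul, transPow_succ, Derivation.map_smul,
        constantCoeff_smul, h0, smul_zero, smul_zero]
  · intro j _
    rw [show (0 : ℤ) - (0 : ℕ) - (j + 1 : ℕ) - 2 = -((j + 2 : ℕ) : ℤ) - 1 by push_cast; ring,
      mode_neg_one, transPow_succ, transPow_succ]
    simp only [Derivation.map_smul, constantCoeff_smul, h1, h0, smul_zero]

theorem eq_of_mem_filt_two {u : Fock} (hu : u ∈ filt 2) :
    u = coeff (Finsupp.single 0 1) u • X 0 + C (constantCoeff u) := by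
  classical
  ext s
  rw [coeff_add, coeff_smul, coeff_C, coeff_X, constantCoeff_eq]
  by_cases h0 : s = 0
  · subst h0
    simp
  · by_cases h1 : s = Finsupp.single 0 1
    · subst h1
      rw [if_pos rfl, if_neg (Ne.symm h0), smul_eq_mul, mul_one, add_zero]
    · rw [if_neg (Ne.symm h1), if_neg (Ne.symm h0), smul_zero, add_zero]
      by_contra h
      have hs := hu s h
      obtain ⟨k, hk⟩ := Finsupp.ne_iff.1 h0
      have hle : Finsupp.single k 1 ≤ s := by
        rw [Finsupp.single_le_iff]
        simp at hk
        omega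
      obtain ⟨s', rfl⟩ := exists_add_of_le hle
      rw [wt_single_add] at hs
      have hk0 : k = 0 := by omega
      subst hk0
      refine h1 ?_
      have : s' = 0 := by
        by_contra hs'
        obtain ⟨i, hi⟩ := Finsupp.ne_iff.1 hs'
        have hle : Finsupp.single i 1 ≤ s' := by
          rw [Finsupp.single_le_iff]
          simp at hi
          omega
        obtain ⟨s'', rfl⟩ := exists_add_of_le hle
        rw [wt_single_add] at hs
        omega
      rw [this, add_zero]

/-- The weight of a monomial for which `X k` has weight `k + 1`. -/
abbrev confWt : (ℕ →₀ ℕ) →+ ℕ := Finsupp.weight fun k : ℕ => k + 1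

theorem confWt_single_add (k : ℕ) (s : ℕ →₀ ℕ) :
    confWt (Finsupp.single k 1 + s) = k + 1 + confWt s := by
  rw [map_add, Finsupp.weight_single, one_smul]

theorem degDer_monomial (s : ℕ →₀ ℕ) :
    degDer (monomial s 1) = (confWt s : ℂ) • monomial s 1 := by
  induction s using sorted_induction with
  | h0 =>
    have h : (monomial 0 1 : Fock) = 1 := rfl
    rw [h, Derivation.map_one_eq_zero]
    simp
  | h k s _ ih =>
    rw [X_mul_monomial, Derivation.leibniz, ih, degDer_X, confWt_single_add, smul_eq_mul,
      smul_eq_mul, mul_smul_comm, mul_smul_comm, mul_comm (monomial s 1), ← add_smul]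
    congr 1
    push_cast
    ring

theorem coeff_degDer (p : Fock) (s : ℕ →₀ ℕ) :
    coeff s (degDer p) = confWt s * coeff s p := by
  classical
  conv_lhs => rw [eq_sum_smul_monomial p]
  conv_rhs => rw [eq_sum_smul_monomial p]
  simp only [map_sum, Derivation.map_smul, degDer_monomial, coeff_sum, coeff_smul, coeff_monomial,
    Finset.mul_sum]
  refine Finset.sum_congr rfl fun t _ => ?_
  by_cases h : t = s
  · subst h; simp [mul_comm]
  · simp [h]

theorem exists_eq_single_add {s : ℕ →₀ ℕ} (hs : s ≠ 0) :
    ∃ k s', s = Finsupp.single k 1 + s' := by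
  obtain ⟨k, hk⟩ := Finsupp.ne_iff.1 hs
  have hle : Finsupp.single k 1 ≤ s := by
    rw [Finsupp.single_le_iff]
    simp at hk
    omega
  obtain ⟨s', h⟩ := exists_add_of_le hle
  exact ⟨k, s', h⟩

theorem eq_of_degDer_eq_two_smul {p : Fock} (hp : degDer p = (2 : ℂ) • p) :
    ∃ a l : ℂ, p = a • X 0 ^ 2 + l • X 1 := by
  classical
  refine ⟨coeff (Finsupp.single 0 2) p, coeff (Finsupp.single 1 1) p, ?_⟩
  ext s
  rw [coeff_add, coeff_smul, coeff_smul, coeff_X, coeff_X_pow]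
  have hs := congrArg (coeff s) hp
  rw [coeff_degDer, coeff_smul, smul_eq_mul] at hs
  by_cases h0 : Finsupp.single 0 2 = s
  · subst h0
    have : (Finsupp.single 1 1 : ℕ →₀ ℕ) ≠ Finsupp.single 0 2 := by
      intro h
      simpa using DFunLike.congr_fun h 1
    simp [this]
  · by_cases h1 : Finsupp.single 1 1 = s
    · subst h1
      simp [h0]
    · rw [if_neg h0, if_neg h1, smul_zero, smul_zero, add_zero]
      by_contra h
      have hw : confWt s = 2 := by exact_mod_cast mul_right_cancel₀ h hs
      have hs0 : s ≠ 0 := by rintro rfl; simp at hw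
      obtain ⟨k, s', rfl⟩ := exists_eq_single_add hs0
      rw [confWt_single_add] at hw
      by_cases hs' : s' = 0
      · subst hs'
        rw [map_zero] at hw
        obtain rfl : k = 1 := by omega
        exact h1 (by simp)
      · obtain ⟨k', s'', rfl⟩ := exists_eq_single_add hs'
        rw [confWt_single_add] at hw
        obtain rfl : k = 0 := by omega
        obtain rfl : k' = 0 := by omega
        have hs'' : s'' = 0 := by
          by_contra hs''
          obtain ⟨k'', s''', rfl⟩ := exists_eq_single_add hs''
          rw [confWt_single_add] at hw
          omega
        subst hs''
        exact h0 (by rw [add_zero, ← Finsupp.single_add])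

/-- Every conformal vector is `exp(t α₁)(½ x₁² + l x₂)` for some `t` and `l`. -/
theorem exists_shift_stdVec_eq {v : Fock} (hv : IsConformalVector v) :
    ∃ t l : ℂ, shift t (stdVec l) = v := by
  have hv0 : mode v 0 = transDer := by
    apply LinearMap.ext
    intro a
    have := hv.translation_eq a
    rw [translation_eq_trans] at this
    exact this
  set w := v - (1 / 2 : ℂ) • X 0 ^ 2 with hw
  have hw0 : mode w 0 = 0 := by
    rw [hw, mode_sub, hv0, mode_X_zero_sq_zero, sub_self]
  have hv1 : mode v 1 = (degDer : Module.End ℂ Fock) + mode w 1 := by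
    rw [hw, mode_sub, mode_X_zero_sq_one, add_sub_cancel]
  set u := mode w 1 (X 0) with hu
  have hw1 : mode w 1 1 = 0 := by
    have := mode_natCast_one w 1
    rwa [Nat.cast_one] at this
  -- By semisimplicity `X 0` is a finite sum of eigenvectors of $L_0$, so its orbit stays in one
  -- step of the filtration.
  have hfin : ∃ e : ℤ, ∀ n : ℕ, (mode v 1 ^ n) (X 0) ∈ filt e := by
    have hX : (X 0 : Fock) ∈ ⨆ Δ : ℂ, Module.End.eigenspace (virasoroOp v 0) Δ := by
      rw [hv.semisimple]
      trivial
    refine Submodule.iSup_induction (fun Δ : ℂ => Module.End.eigenspace (virasoroOp v 0) Δ)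
      (motive := fun x => ∃ e : ℤ, ∀ n : ℕ, (mode v 1 ^ n) x ∈ filt e) hX ?_ ?_ ?_
    · intro Δ x hx
      obtain ⟨e, he⟩ := exists_mem_filt x
      have hx' : mode v 1 x = Δ • x := Module.End.mem_eigenspace_iff.1 hx
      refine ⟨e, fun n => ?_⟩
      induction n with
      | zero => simpa using he
      | succ n ih =>
        rw [pow_succ, Module.End.mul_apply, hx', map_smul]
        exact Submodule.smul_mem _ _ ih
    · exact ⟨0, fun n => by rw [map_zero]; exact zero_mem _⟩
    · rintro x y ⟨e, he⟩ ⟨e', he'⟩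
      refine ⟨max e e', fun n => ?_⟩
      rw [map_add]
      exact add_mem (filt_mono (le_max_left _ _) (he n)) (filt_mono (le_max_right _ _) (he' n))
  have hu2 : u ∈ filt 2 := by
    refine mem_filt_two_of_locally_finite (L := mode v 1) ?_ (fun k p => ?_) hfin
    · rw [hv1, LinearMap.add_apply, hw1, Derivation.coeFn_coe, Derivation.map_one_eq_zero, add_zero]
    · rw [hv1, LinearMap.add_apply, LinearMap.add_apply, Derivation.coeFn_coe, Derivation.leibniz,
        mode_one_X_mul hw0, degDer_X, smul_eq_mul, smul_eq_mul, mul_add, mul_smul_comm, mul_comm p]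
      abel
  have hu3 := eq_of_mem_filt_two hu2
  set t := constantCoeff u
  have hc : coeff (Finsupp.single 0 1) u = 0 := by
    have h := constantCoeff_pderiv_zero_mode_one hw0
    rw [← hu, hu3] at h
    simpa using h
  rw [hc, zero_smul, zero_add] at hu3
  have hw1' : mode w 1 = ((t • pderiv 0 : Derivation ℂ Fock Fock) : Module.End ℂ Fock) := by
    refine end_ext ?_ fun k p => ?_
    · rw [hw1, Derivation.coeFn_coe, Derivation.map_one_eq_zero]
    · rw [mode_one_X_mul hw0, ← hu, hu3, Derivation.coeFn_coe, X_mul_derivation,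
        Derivation.smul_apply, pderiv_X_eq, C_eq_smul_one, mode_smul, mode_one,
        LinearMap.smul_apply]
      cases k with
      | zero => simp
      | succ k => rw [if_neg (by push_cast; omega), if_neg (by omega)]; simp
  -- The equation $L_0v=2v$ with $L_0=\deg+t\,\partial_0$, transported back by the shift.
  have hN : degDer ((shift t).symm v) = (2 : ℂ) • (shift t).symm v := by
    obtain ⟨c, hvir⟩ := hv.virasoro
    have h := hvir.mode_one
    rw [hv1, hw1'] at h
    apply (shift t).injective
    rw [← degDer_shift, AlgEquiv.apply_symm_apply, map_smul, AlgEquiv.apply_symm_apply]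
    exact h
  obtain ⟨a, l, hp⟩ := eq_of_degDer_eq_two_smul hN
  refine ⟨t, l, ?_⟩
  -- The zeroth mode of $a x_1^2+l x_2$ is $2aT$, and it must be $T$; the coefficient of $x_2$ in
  -- the image of $x_1$ gives $2a=1$.
  have ha : a = 1 / 2 := by
    have h := shift_mode t ((shift t).symm v) 0 (X 0)
    rw [AlgEquiv.apply_symm_apply, hv0, Derivation.coeFn_coe, transDer_shift] at h
    have h' := (shift t).injective h
    rw [hp, mode_add, show a • (X 0 ^ 2 : Fock) = (2 * a) • ((1 / 2 : ℂ) • X 0 ^ 2) by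
      rw [smul_smul]; congr 1; ring, mode_smul, mode_X_zero_sq_zero, mode_smul l, mode_X_one] at h'
    have h'' := congrArg (coeff (Finsupp.single 1 1)) h'
    simp at h''
    linear_combination (1 / 2 : ℂ) * h''
  rw [stdVec, ← ha, ← hp, AlgEquiv.apply_symm_apply]

/-! ## Representations of `sl₂` given by a triple of operators -/

section Sl2

variable {M M' : Type*} [AddCommGroup M] [Module ℂ M] [AddCommGroup M'] [Module ℂ M']

theorem lie_E_F : ⁅sl2E, sl2F⁆ = sl2H := by
  apply Subtype.ext
  ext i j
  fin_cases i <;> fin_cases j <;> simp [sl2E, sl2F, sl2H, Ring.lie_def]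

/-- The representation of `sl₂` given by operators satisfying the defining relations. -/
def repOfTriple (e h f : Module.End ℂ M) (hef : e * f - f * e = h)
    (hhe : h * e - e * h = (2 : ℂ) • e) (hhf : h * f - f * h = (-2 : ℂ) • f) :
    sl2 →ₗ⁅ℂ⁆ Module.End ℂ M where
  toFun x := (x.1 0 1) • e + (x.1 0 0) • h + (x.1 1 0) • f
  map_add' x y := by
    change (x.1 0 1 + y.1 0 1) • e + (x.1 0 0 + y.1 0 0) • h + (x.1 1 0 + y.1 1 0) • f = _
    module
  map_smul' c x := by
    change (c * x.1 0 1) • e + (c * x.1 0 0) • h + (c * x.1 1 0) • f = _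
    rw [RingHom.id_apply]
    module
  map_lie' {x y} := by
    have tr : ∀ x : sl2, x.1 1 1 = -x.1 0 0 := fun x => by
      have ht : x.1 0 0 + x.1 1 1 = 0 := by
        have := (LinearMap.mem_ker).1 x.2
        simpa [Matrix.trace_fin_two] using this
      linear_combination ht
    have hb : ∀ i j, (⁅x, y⁆ : sl2).1 i j = x.1 i 0 * y.1 0 j + x.1 i 1 * y.1 1 j -
        (y.1 i 0 * x.1 0 j + y.1 i 1 * x.1 1 j) := fun i j => by
      rw [LieSubalgebra.coe_bracket, Ring.lie_def]
      simp [Matrix.sub_apply, Matrix.mul_apply, Fin.sum_univ_two]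
    simp only [hb, tr, Ring.lie_def, add_mul, mul_add, smul_mul_assoc, mul_smul_comm]
    linear_combination (norm := module) (y.1 0 1 * x.1 1 0 - x.1 0 1 * y.1 1 0) • hef +
      (y.1 0 0 * x.1 0 1 - x.1 0 0 * y.1 0 1) • hhe +
      (y.1 0 0 * x.1 1 0 - x.1 0 0 * y.1 1 0) • hhf

theorem repOfTriple_E (e h f : Module.End ℂ M) (hef) (hhe) (hhf) :
    repOfTriple e h f hef hhe hhf sl2E = e := by
  change (sl2E.1 0 1) • e + (sl2E.1 0 0) • h + (sl2E.1 1 0) • f = _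
  simp [sl2E]

theorem repOfTriple_H (e h f : Module.End ℂ M) (hef) (hhe) (hhf) :
    repOfTriple e h f hef hhe hhf sl2H = h := by
  change (sl2H.1 0 1) • e + (sl2H.1 0 0) • h + (sl2H.1 1 0) • f = _
  simp [sl2H]

theorem repOfTriple_F (e h f : Module.End ℂ M) (hef) (hhe) (hhf) :
    repOfTriple e h f hef hhe hhf sl2F = f := by
  change (sl2F.1 0 1) • e + (sl2F.1 0 0) • h + (sl2F.1 1 0) • f = _
  simp [sl2F]

theorem rep_apply_eq (ρ : sl2 →ₗ⁅ℂ⁆ Module.End ℂ M) (x : sl2) (m : M) :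
    ρ x m = (x.1 0 1) • ρ sl2E m + (x.1 0 0) • ρ sl2H m + (x.1 1 0) • ρ sl2F m := by
  conv_lhs => rw [sl2_eq x]
  simp

/-- A subspace stable under `E`, `H`, `F`, as a submodule. -/
def lieSubmoduleOf (ρ : sl2 →ₗ⁅ℂ⁆ Module.End ℂ M) (W : Submodule ℂ M)
    (hE : ∀ m ∈ W, ρ sl2E m ∈ W) (hH : ∀ m ∈ W, ρ sl2H m ∈ W) (hF : ∀ m ∈ W, ρ sl2F m ∈ W) :
    LieSubmodule ℂ sl2 (RepModule ρ) where
  toSubmodule := W.map (RepModule.of ρ : M →ₗ[ℂ] RepModule ρ)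
  lie_mem := by
    rintro x _ ⟨m, hm, rfl⟩
    refine ⟨ρ x m, ?_, rfl⟩
    rw [rep_apply_eq]
    exact add_mem (add_mem (W.smul_mem _ (hE m hm)) (W.smul_mem _ (hH m hm)))
      (W.smul_mem _ (hF m hm))

theorem mem_lieSubmoduleOf (ρ : sl2 →ₗ⁅ℂ⁆ Module.End ℂ M) (W : Submodule ℂ M) (hE) (hH) (hF)
    (m : M) : RepModule.of ρ m ∈ lieSubmoduleOf ρ W hE hH hF ↔ m ∈ W := by
  constructor
  · rintro ⟨m', hm', h⟩
    exact (RepModule.of ρ).injective h ▸ hm'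
  · exact fun h => ⟨m, h, rfl⟩

theorem LieSubmodule_rep_mem {ρ : sl2 →ₗ⁅ℂ⁆ Module.End ℂ M}
    (K : LieSubmodule ℂ sl2 (RepModule ρ)) (x : sl2) {m : M} (hm : RepModule.of ρ m ∈ K) :
    RepModule.of ρ (ρ x m) ∈ K := K.lie_mem hm

/-- Isomorphic representations give isomorphic modules. -/
def repEquiv (ρ : sl2 →ₗ⁅ℂ⁆ Module.End ℂ M) (ρ' : sl2 →ₗ⁅ℂ⁆ Module.End ℂ M') (σ : M ≃ₗ[ℂ] M')
    (hE : ∀ m, σ (ρ sl2E m) = ρ' sl2E (σ m)) (hH : ∀ m, σ (ρ sl2H m) = ρ' sl2H (σ m))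
    (hF : ∀ m, σ (ρ sl2F m) = ρ' sl2F (σ m)) : RepModule ρ ≃ₗ⁅ℂ, sl2⁆ RepModule ρ' :=
  { (RepModule.of ρ).symm.trans (σ.trans (RepModule.of ρ')) with
    map_lie' := by
      intro x m
      obtain ⟨m, rfl⟩ := (RepModule.of ρ).surjective m
      change RepModule.of ρ' (σ (ρ x m)) = RepModule.of ρ' (ρ' x (σ m))
      congr 1
      rw [rep_apply_eq ρ, rep_apply_eq ρ', map_add, map_add, map_smul, map_smul, map_smul, hE, hH,
        hF] }

theorem isCompletelyReducible_iff_of_equiv {ρ : sl2 →ₗ⁅ℂ⁆ Module.End ℂ M}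
    {ρ' : sl2 →ₗ⁅ℂ⁆ Module.End ℂ M'} (e : RepModule ρ ≃ₗ⁅ℂ, sl2⁆ RepModule ρ') :
    IsCompletelyReducible ρ ↔ IsCompletelyReducible ρ' :=
  ⟨fun h => @OrderIso.complementedLattice _ _ _ _ _ _ h (LieSubmodule.orderIsoMapComap e),
    fun h => @OrderIso.complementedLattice _ _ _ _ _ _ h (LieSubmodule.orderIsoMapComap e).symm⟩

end Sl2

/-! ## The representations on the Fock space -/

theorem lowDer_lie_transDer (l : ℂ) : ⁅lowDer l, transDer⁆ = (2 : ℂ) • degDer := by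
  refine derivation_ext fun k => ?_
  rw [Derivation.commutator_apply, transDer_X, Derivation.map_smul, lowDer_X_succ,
    Derivation.smul_apply, degDer_X]
  cases k with
  | zero => simp
  | succ k =>
    rw [lowDer_X_succ, Derivation.map_smul, transDer_X]
    push_cast
    module

theorem degDer_lie_lowDer (l : ℂ) : ⁅degDer, lowDer l⁆ = -lowDer l := by
  refine derivation_ext fun k => ?_
  rw [Derivation.commutator_apply, degDer_X, Derivation.map_smul, Derivation.neg_apply]
  cases k with
  | zero => simp
  | succ k =>
    rw [lowDer_X_succ, Derivation.map_smul, degDer_X]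
    push_cast
    module

theorem degDer_lie_transDer : ⁅degDer, transDer⁆ = transDer := by
  refine derivation_ext fun k => ?_
  rw [Derivation.commutator_apply, degDer_X, Derivation.map_smul, transDer_X, Derivation.map_smul,
    degDer_X]
  push_cast
  module

theorem lowDer_transDer (l : ℂ) (p : Fock) :
    lowDer l (transDer p) = transDer (lowDer l p) + (2 : ℂ) • degDer p := by
  have := congrArg (fun D : Derivation ℂ Fock Fock => D p) (lowDer_lie_transDer l)
  simp only [Derivation.commutator_apply, Derivation.smul_apply] at this
  rw [← this]
  abel

theorem degDer_lowDer (l : ℂ) (p : Fock) :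
    degDer (lowDer l p) = lowDer l (degDer p) - lowDer l p := by
  have := congrArg (fun D : Derivation ℂ Fock Fock => D p) (degDer_lie_lowDer l)
  simp only [Derivation.commutator_apply, Derivation.neg_apply] at this
  rw [sub_eq_add_neg, ← this]
  abel

theorem degDer_transDer (p : Fock) : degDer (transDer p) = transDer (degDer p) + transDer p := by
  have := congrArg (fun D : Derivation ℂ Fock Fock => D p) degDer_lie_transDer
  rw [Derivation.commutator_apply, sub_eq_iff_eq_add'] at this
  exact this

/-- The representation `E ↦ -L_1`, `H ↦ -2 L_0`, `F ↦ L_{-1}` for `½ x₁² + l x₂`. -/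
def stdRep (l : ℂ) : sl2 →ₗ⁅ℂ⁆ Module.End ℂ Fock :=
  repOfTriple (-(lowDer l : Module.End ℂ Fock)) ((-2 : ℂ) • (degDer : Module.End ℂ Fock)) transDer
    (by
      refine LinearMap.ext fun p => ?_
      simp only [LinearMap.sub_apply, Module.End.mul_apply, LinearMap.neg_apply,
        LinearMap.smul_apply, Derivation.coeFn_coe, lowDer_transDer, map_neg]
      module)
    (by
      refine LinearMap.ext fun p => ?_
      simp only [LinearMap.sub_apply, Module.End.mul_apply, LinearMap.neg_apply,
        LinearMap.smul_apply, Derivation.coeFn_coe, degDer_lowDer, map_neg, Derivation.map_smul]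
      module)
    (by
      refine LinearMap.ext fun p => ?_
      simp only [LinearMap.sub_apply, Module.End.mul_apply,
        LinearMap.smul_apply, Derivation.coeFn_coe, degDer_transDer, Derivation.map_smul]
      module)

theorem stdRep_E (l : ℂ) (p : Fock) : stdRep l sl2E p = -lowDer l p := by
  rw [stdRep, repOfTriple_E]; rfl

theorem stdRep_H (l : ℂ) (p : Fock) : stdRep l sl2H p = (-2 : ℂ) • degDer p := by
  rw [stdRep, repOfTriple_H]; rfl

theorem stdRep_F (l : ℂ) (p : Fock) : stdRep l sl2F p = transDer p := by
  rw [stdRep, repOfTriple_F]; rfl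

/-- A complement of $\mathbb{C}1$ would contain $x_1-c$ for some constant $c$, hence its image $2l$
under $E=-L_1$, hence $1$. -/
theorem not_isCompletelyReducible_stdRep {l : ℂ} (hl : l ≠ 0) :
    ¬ IsCompletelyReducible (stdRep l) := by
  intro hcr
  have h1 : ∀ m ∈ Submodule.span ℂ {(1 : Fock)}, ∀ D : Derivation ℂ Fock Fock, D m = 0 := by
    intro m hm D
    obtain ⟨c, rfl⟩ := Submodule.mem_span_singleton.1 hm
    simp
  set W := lieSubmoduleOf (stdRep l) (Submodule.span ℂ {1})
    (fun m hm => by rw [stdRep_E, h1 m hm, neg_zero]; exact zero_mem _)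
    (fun m hm => by rw [stdRep_H, h1 m hm, smul_zero]; exact zero_mem _)
    (fun m hm => by rw [stdRep_F, h1 m hm]; exact zero_mem _) with hW
  obtain ⟨K, hK⟩ := hcr.exists_isCompl W
  have hX : RepModule.of (stdRep l) (X 0) ∈ W ⊔ K := by rw [hK.sup_eq_top]; trivial
  obtain ⟨a, ha, b, hb, hab⟩ := (LieSubmodule.mem_sup _ _ _).1 hX
  obtain ⟨a, rfl⟩ := (RepModule.of (stdRep l)).surjective a
  obtain ⟨b, rfl⟩ := (RepModule.of (stdRep l)).surjective b
  rw [hW, mem_lieSubmoduleOf] at ha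
  have hab' : a + b = X 0 := hab
  have hLb : stdRep l sl2E b = C (2 * l) := by
    have : b = X 0 - a := by rw [← hab']; abel
    rw [stdRep_E, this, map_sub, h1 a ha, lowDer_X_zero, sub_zero, ← C_neg]
    congr 1
    ring
  have hbK := LieSubmodule_rep_mem K sl2E hb
  rw [hLb] at hbK
  have h1K : RepModule.of (stdRep l) 1 ∈ K := by
    have h2 : (1 : Fock) = (2 * l)⁻¹ • C (2 * l) := by
      rw [smul_eq_C_mul, ← C_mul, inv_mul_cancel₀ (mul_ne_zero two_ne_zero hl), C_1]
    rw [h2, map_smul]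
    exact K.smul_mem _ hbK
  have h1W : RepModule.of (stdRep l) 1 ∈ W := by
    rw [hW, mem_lieSubmoduleOf]
    exact Submodule.mem_span_singleton_self _
  have hbot : RepModule.of (stdRep l) 1 ∈ W ⊓ K := ⟨h1W, h1K⟩
  rw [hK.inf_eq_bot, LieSubmodule.mem_bot] at hbot
  exact one_ne_zero ((RepModule.of (stdRep l)).injective (hbot.trans (map_zero _).symm))

/-! ### Complete reducibility for `½ x₁²` -/

theorem degDer_iterate {p : Fock} {h : ℂ} (hp : degDer p = h • p) (n : ℕ) :
    degDer (((transDer : Module.End ℂ Fock) ^ n) p) =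
      (h + n) • ((transDer : Module.End ℂ Fock) ^ n) p := by
  induction n with
  | zero => simpa using hp
  | succ n ih =>
    rw [pow_succ', Module.End.mul_apply, Derivation.coeFn_coe, degDer_transDer, ih,
      Derivation.map_smul]
    push_cast
    module

/-- The standard $sl_2$ string. For integers $h\ge0$ the coefficient vanishes only at $h=n=0$, so
the vacuum is the only exceptional case below. -/
theorem lowDer_iterate {l : ℂ} {p : Fock} {h : ℂ} (hp : degDer p = h • p) (h0 : lowDer l p = 0)
    (n : ℕ) : lowDer l (((transDer : Module.End ℂ Fock) ^ (n + 1)) p) =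
      (((n : ℂ) + 1) * (2 * h + n)) • ((transDer : Module.End ℂ Fock) ^ n) p := by
  induction n with
  | zero =>
    rw [zero_add, pow_one, Derivation.coeFn_coe, lowDer_transDer, h0, map_zero, hp, pow_zero,
      Module.End.one_apply]
    push_cast
    module
  | succ n ih =>
    rw [pow_succ', Module.End.mul_apply, Derivation.coeFn_coe, lowDer_transDer, ih,
      degDer_iterate hp, Derivation.map_smul, pow_succ' _ n, Module.End.mul_apply,
      Derivation.coeFn_coe]
    push_cast
    module

/-- This is where $l=0$ matters: $L_1$ never reaches the vacuum component. -/
theorem constantCoeff_lowDer (p : Fock) : constantCoeff (lowDer 0 p) = 0 := by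
  induction p using MvPolynomial.induction_on with
  | C a => simp
  | add p q hp hq => rw [map_add, map_add, hp, hq, add_zero]
  | mul_X p k ih =>
    rw [Derivation.leibniz, map_add, smul_eq_mul, smul_eq_mul, map_mul, map_mul, ih]
    cases k with
    | zero => simp
    | succ k => simp [smul_eq_C_mul]

theorem eq_C_of_degDer_eq_zero {p : Fock} (hp : degDer p = 0) : p = C (constantCoeff p) := by
  classical
  ext s
  rw [coeff_C, constantCoeff_eq]
  by_cases h0 : s = 0
  · subst h0; simp
  · rw [if_neg (Ne.symm h0)]
    have hs := congrArg (coeff s) hp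
    rw [coeff_degDer, coeff_zero] at hs
    obtain ⟨k, s', rfl⟩ := exists_eq_single_add h0
    rw [confWt_single_add] at hs
    refine (mul_eq_zero.1 hs).resolve_left (Nat.cast_ne_zero.2 (by omega))

/-- The span of the descendants of the primary vectors, in degree `d`. -/
def descendants (d : ℕ) : Submodule ℂ Fock :=
  Submodule.span ℂ {q | ∃ (h n : ℕ) (p : Fock), h + n = d ∧ degDer p = (h : ℂ) • p ∧
    lowDer 0 p = 0 ∧ q = ((transDer : Module.End ℂ Fock) ^ n) p}

theorem degDer_of_mem_descendants {d : ℕ} {q : Fock} (hq : q ∈ descendants d) :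
    degDer q = (d : ℂ) • q := by
  induction hq using Submodule.span_induction with
  | mem q hq =>
    obtain ⟨h, n, p, rfl, hp, _, rfl⟩ := hq
    rw [degDer_iterate hp]
    push_cast
    rfl
  | zero => simp
  | add q q' _ _ hq hq' => rw [map_add, hq, hq', smul_add]
  | smul c q _ hq => rw [Derivation.map_smul, hq, smul_comm]

theorem transDer_pow_eq_zero {p : Fock} (hp : degDer p = 0) (n : ℕ) :
    ((transDer : Module.End ℂ Fock) ^ (n + 1)) p = 0 := by
  rw [eq_C_of_degDer_eq_zero hp, pow_succ, Module.End.mul_apply, Derivation.coeFn_coe,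
    derivation_C, map_zero]

/-- The string coefficients are nonzero for primaries of positive degree. Primaries of degree 0 are
constants, killed by `T`, and contribute nothing in positive degree. -/
theorem exists_lowDer_eq {d : ℕ} {q : Fock} (hq : q ∈ descendants (d + 1)) :
    ∃ q' ∈ descendants (d + 2), lowDer 0 q' = q := by
  induction hq using Submodule.span_induction with
  | mem q hq =>
    obtain ⟨h, n, p, hd, hp, hl, rfl⟩ := hq
    rcases Nat.eq_zero_or_pos h with rfl | hpos
    · refine ⟨0, zero_mem _, ?_⟩
      obtain ⟨n, rfl⟩ : ∃ m, n = m + 1 := ⟨n - 1, by omega⟩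
      rw [transDer_pow_eq_zero (by simpa using hp), map_zero]
    · have hne : ((n : ℂ) + 1) * (2 * h + n) ≠ 0 := by
        exact_mod_cast (Nat.mul_pos n.succ_pos (by omega : 0 < 2 * h + n)).ne'
      refine ⟨(((n : ℂ) + 1) * (2 * h + n))⁻¹ • ((transDer : Module.End ℂ Fock) ^ (n + 1)) p,
        Submodule.smul_mem _ _ (Submodule.subset_span ⟨h, n + 1, p, by omega, hp, hl, rfl⟩), ?_⟩
      rw [Derivation.map_smul, lowDer_iterate hp hl, inv_smul_smul₀ hne]
  | zero => exact ⟨0, zero_mem _, map_zero _⟩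
  | add q q' _ _ hq hq' =>
    obtain ⟨a, ha, rfl⟩ := hq
    obtain ⟨b, hb, rfl⟩ := hq'
    exact ⟨a + b, add_mem ha hb, map_add _ _ _⟩
  | smul c q _ hq =>
    obtain ⟨a, ha, rfl⟩ := hq
    exact ⟨c • a, Submodule.smul_mem _ _ ha, Derivation.map_smul _ _ _⟩

theorem mem_descendants_of_primary {d : ℕ} {p : Fock} (hp : degDer p = (d : ℂ) • p)
    (hl : lowDer 0 p = 0) : p ∈ descendants d :=
  Submodule.subset_span ⟨d, 0, p, by simp, hp, hl, rfl⟩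

/-- By induction $L_1q$ is a sum of descendants, hence equals $L_1q'$ with $q'$ a sum of
descendants, and $q-q'$ is primary. In degree 1 this surjectivity is unavailable, but there $L_1q$
is a constant, hence zero by `constantCoeff_lowDer`. -/
theorem mem_descendants (d : ℕ) : ∀ q : Fock, degDer q = (d : ℂ) • q → q ∈ descendants d := by
  induction d with
  | zero =>
    intro q hq
    refine mem_descendants_of_primary hq ?_
    rw [eq_C_of_degDer_eq_zero (p := q) (by simpa using hq), derivation_C]
  | succ d ih =>
    intro q hq
    have hL : degDer (lowDer 0 q) = (d : ℂ) • lowDer 0 q := by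
      rw [degDer_lowDer, hq, Derivation.map_smul]
      push_cast
      module
    cases d with
    | zero =>
      refine mem_descendants_of_primary hq ?_
      rw [eq_C_of_degDer_eq_zero (p := lowDer 0 q) (by simpa using hL), constantCoeff_lowDer, C_0]
    | succ d =>
      obtain ⟨q', hq', h⟩ := exists_lowDer_eq (ih _ hL)
      have hprim : q - q' ∈ descendants (d + 1 + 1) := by
        refine mem_descendants_of_primary ?_ (by rw [map_sub, h, sub_self])
        rw [map_sub, hq, degDer_of_mem_descendants hq', smul_sub]
      simpa using add_mem hprim hq'

theorem map_mem_span_range {v : ℕ → Fock} (D : Derivation ℂ Fock Fock)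
    (h : ∀ n, D (v n) ∈ Submodule.span ℂ (Set.range v)) {m : Fock}
    (hm : m ∈ Submodule.span ℂ (Set.range v)) : D m ∈ Submodule.span ℂ (Set.range v) := by
  induction hm using Submodule.span_induction with
  | mem q hq => obtain ⟨n, rfl⟩ := hq; exact h n
  | zero => rw [map_zero]; exact zero_mem _
  | add q q' _ _ hq hq' => rw [map_add]; exact add_mem hq hq'
  | smul c q _ hq => rw [Derivation.map_smul]; exact Submodule.smul_mem _ _ hq

/-- The submodule generated by a primary vector. -/
def primarySubmodule {p : Fock} {h : ℂ} (hp : degDer p = h • p) (hl : lowDer 0 p = 0) :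
    LieSubmodule ℂ sl2 (RepModule (stdRep 0)) :=
  lieSubmoduleOf (stdRep 0)
    (Submodule.span ℂ (Set.range fun n : ℕ => ((transDer : Module.End ℂ Fock) ^ n) p))
    (fun m hm => by
      rw [stdRep_E]
      refine neg_mem (map_mem_span_range (lowDer 0) (fun n => ?_) hm)
      cases n with
      | zero => simp [hl]
      | succ n =>
        rw [lowDer_iterate hp hl]
        exact Submodule.smul_mem _ _ (Submodule.subset_span ⟨n, rfl⟩))
    (fun m hm => by
      rw [stdRep_H]
      refine Submodule.smul_mem _ _ (map_mem_span_range degDer (fun n => ?_) hm)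
      rw [degDer_iterate hp]
      exact Submodule.smul_mem _ _ (Submodule.subset_span ⟨n, rfl⟩))
    (fun m hm => by
      rw [stdRep_F]
      refine map_mem_span_range transDer (fun n => Submodule.subset_span ⟨n + 1, ?_⟩) hm
      simp only [pow_succ', Module.End.mul_apply, Derivation.coeFn_coe])

theorem lowDer_pow_iterate {p : Fock} {h : ℂ} (hp : degDer p = h • p) (hl : lowDer 0 p = 0)
    (n : ℕ) : ∃ c : ℂ, ((∀ i : ℕ, i < n → 2 * h + i ≠ 0) → c ≠ 0) ∧
      ((lowDer 0 : Module.End ℂ Fock) ^ n) (((transDer : Module.End ℂ Fock) ^ n) p) = c • p := by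
  induction n with
  | zero => exact ⟨1, fun _ => one_ne_zero, by simp⟩
  | succ n ih =>
    obtain ⟨c, hc, h'⟩ := ih
    refine ⟨((n : ℂ) + 1) * (2 * h + n) * c, fun hi => mul_ne_zero (mul_ne_zero
      (Nat.cast_add_one_ne_zero n) (hi n (by omega))) (hc fun i hin => hi i (by omega)), ?_⟩
    rw [pow_succ (lowDer 0 : Module.End ℂ Fock), Module.End.mul_apply, Derivation.coeFn_coe,
      lowDer_iterate hp hl, map_smul, h', smul_smul]

theorem lowDer_pow_iterate_of_lt {p : Fock} {h : ℂ} (hp : degDer p = h • p) (hl : lowDer 0 p = 0)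
    {m n : ℕ} (hmn : m < n) :
    ((lowDer 0 : Module.End ℂ Fock) ^ n) (((transDer : Module.End ℂ Fock) ^ m) p) = 0 := by
  obtain ⟨c, _, h'⟩ := lowDer_pow_iterate hp hl m
  obtain ⟨k, rfl⟩ := Nat.exists_eq_add_of_lt hmn
  rw [show m + k + 1 = k + (1 + m) by ring, pow_add, pow_add, Module.End.mul_apply,
    Module.End.mul_apply, h', map_smul, pow_one, Derivation.coeFn_coe, hl, smul_zero, map_zero]

theorem lowDer_pow_mem {K : LieSubmodule ℂ sl2 (RepModule (stdRep 0))} {q : Fock}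
    (hq : RepModule.of (stdRep 0) q ∈ K) (n : ℕ) :
    RepModule.of (stdRep 0) (((lowDer 0 : Module.End ℂ Fock) ^ n) q) ∈ K := by
  induction n with
  | zero => simpa using hq
  | succ n ih =>
    rw [pow_succ', Module.End.mul_apply, Derivation.coeFn_coe]
    have := LieSubmodule_rep_mem K sl2E ih
    rw [stdRep_E, map_neg] at this
    simpa using K.neg_mem this

/-- A nonzero submodule contains some $q=aT^Np+\cdots$ with nonzero top term and lower terms $T^mp$,
$m<N$. The operator $L_1^N$ kills the lower terms and returns a nonzero multiple of $p$, which
generates everything. -/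
theorem isAtom_primarySubmodule {p : Fock} {h : ℕ} (hp0 : p ≠ 0) (hp : degDer p = (h : ℂ) • p)
    (hl : lowDer 0 p = 0) : IsAtom (primarySubmodule hp hl) := by
  have hpmem : RepModule.of (stdRep 0) p ∈ primarySubmodule hp hl := by
    rw [primarySubmodule, mem_lieSubmoduleOf]
    exact Submodule.subset_span ⟨0, rfl⟩
  have key : ∀ (K : LieSubmodule ℂ sl2 (RepModule (stdRep 0))) (N : ℕ) (q : Fock),
      RepModule.of (stdRep 0) q ∈ K → q ≠ 0 →
      q ∈ Submodule.span ℂ ((fun n : ℕ => ((transDer : Module.End ℂ Fock) ^ n) p) '' Set.Iio N) →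
      RepModule.of (stdRep 0) p ∈ K := by
    intro K N
    induction N with
    | zero =>
      intro q _ hq0 hq
      simp at hq
      exact absurd hq hq0
    | succ N ih =>
      intro q hqK hq0 hq
      rw [show Set.Iio (N + 1) = insert N (Set.Iio N) by ext i; simp, Set.image_insert_eq,
        Submodule.mem_span_insert] at hq
      obtain ⟨a, q', hq', rfl⟩ := hq
      by_cases ha : a • ((transDer : Module.End ℂ Fock) ^ N) p = 0
      · rw [ha, zero_add] at hqK hq0
        exact ih q' hqK hq0 hq'
      · have h0 : ((lowDer 0 : Module.End ℂ Fock) ^ N) q' = 0 := by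
          refine (Submodule.span_le (p := LinearMap.ker
            ((lowDer 0 : Module.End ℂ Fock) ^ N))).2 ?_ hq'
          rintro _ ⟨m, hm, rfl⟩
          exact lowDer_pow_iterate_of_lt hp hl hm
        obtain ⟨c, hc, hcp⟩ := lowDer_pow_iterate hp hl N
        -- A vanishing factor forces `h = 0` and `N > 0`, but then $p$ is constant and $T^Np=0$,
        -- contrary to `ha`.
        have hc0 : c ≠ 0 := by
          refine hc fun i hi h2 => ?_
          have h3 : 2 * h + i = 0 := by exact_mod_cast h2
          obtain rfl : h = 0 := by omega
          obtain ⟨N, rfl⟩ : ∃ m, N = m + 1 := ⟨N - 1, by omega⟩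
          exact ha (by rw [transDer_pow_eq_zero (by simpa using hp), smul_zero])
        have hmem := lowDer_pow_mem hqK N
        rw [map_add, map_smul, hcp, h0, add_zero, smul_smul, map_smul] at hmem
        have hac : a * c ≠ 0 := mul_ne_zero (fun h => ha (by rw [h, zero_smul])) hc0
        have := K.smul_mem (a * c)⁻¹ hmem
        rwa [inv_smul_smul₀ hac] at this
  refine ⟨fun hbot => ?_, fun K hK => ?_⟩
  · rw [hbot, LieSubmodule.mem_bot] at hpmem
    exact hp0 ((RepModule.of (stdRep 0)).injective (hpmem.trans (map_zero _).symm))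
  · by_contra hne
    rw [LieSubmodule.eq_bot_iff] at hne
    push Not at hne
    obtain ⟨q, hqK, hq0⟩ := hne
    obtain ⟨q, rfl⟩ := (RepModule.of (stdRep 0)).surjective q
    have hqU := hK.le hqK
    rw [primarySubmodule, mem_lieSubmoduleOf, Finsupp.mem_span_range_iff_exists_finsupp] at hqU
    obtain ⟨c, hc⟩ := hqU
    obtain ⟨N, hN⟩ := c.support.bddAbove
    have hpK : RepModule.of (stdRep 0) p ∈ K := by
      refine key K (N + 1) q hqK (fun h => hq0 (by rw [h, map_zero])) ?_
      rw [← hc]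
      exact Submodule.sum_mem _ fun i hi => Submodule.smul_mem _ _
        (Submodule.subset_span ⟨i, Nat.lt_succ_of_le (hN hi), rfl⟩)
    have hTK : ∀ n : ℕ, RepModule.of (stdRep 0) (((transDer : Module.End ℂ Fock) ^ n) p) ∈ K := by
      intro n
      induction n with
      | zero => simpa using hpK
      | succ n ih =>
        have := LieSubmodule_rep_mem K sl2F ih
        rw [stdRep_F] at this
        rwa [pow_succ', Module.End.mul_apply]
    refine hK.not_ge fun m hm => ?_
    obtain ⟨m, rfl⟩ := (RepModule.of (stdRep 0)).surjective m
    rw [primarySubmodule, mem_lieSubmoduleOf, Finsupp.mem_span_range_iff_exists_finsupp] at hm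
    obtain ⟨c, rfl⟩ := hm
    rw [Finsupp.sum, map_sum]
    refine sum_mem fun i _ => ?_
    rw [map_smul]
    exact K.smul_mem _ (hTK i)

/-- Monomials are homogeneous, hence sums of descendants of primaries, so the module is a sum of
simple submodules. -/
theorem isCompletelyReducible_stdRep_zero : IsCompletelyReducible (stdRep 0) := by
  refine complementedLattice_of_sSup_atoms_eq_top (eq_top_iff.2 fun q _ => ?_)
  obtain ⟨q, rfl⟩ := (RepModule.of (stdRep 0)).surjective q
  set S := sSup {a : LieSubmodule ℂ sl2 (RepModule (stdRep 0)) | IsAtom a}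
  have hd : ∀ (d : ℕ), ∀ q ∈ descendants d, RepModule.of (stdRep 0) q ∈ S := by
    intro d q hq
    induction hq using Submodule.span_induction with
    | mem q hq =>
      obtain ⟨h, n, p, _, hp, hl, rfl⟩ := hq
      by_cases hp0 : p = 0
      · rw [hp0, map_zero, map_zero]
        exact zero_mem _
      · have hle : primarySubmodule hp hl ≤ S := le_sSup (isAtom_primarySubmodule hp0 hp hl)
        refine hle ?_
        rw [primarySubmodule, mem_lieSubmoduleOf]
        exact Submodule.subset_span ⟨n, rfl⟩
    | zero => rw [map_zero]; exact zero_mem _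
    | add q q' _ _ hq hq' => rw [map_add]; exact add_mem hq hq'
    | smul c q _ hq => rw [map_smul]; exact S.smul_mem _ hq
  rw [eq_sum_smul_monomial q, map_sum]
  refine sum_mem fun s _ => ?_
  rw [map_smul]
  exact S.smul_mem _ (hd _ _ (mem_descendants _ _ (degDer_monomial s)))

/-! ## The pairing with the Verma module -/

/-- The projection to the vacuum component. -/
def vacuumFunctional : Module.Dual ℂ Fock := (aeval fun _ : ℕ => (0 : ℂ)).toLinearMap

theorem vacuumFunctional_apply (p : Fock) : vacuumFunctional p = constantCoeff p := by
  simp [vacuumFunctional, aeval_def, eval₂_eq_eval_map]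

theorem constantCoeff_degDer (p : Fock) : constantCoeff (degDer p) = 0 := by
  rw [constantCoeff_eq, coeff_degDer, map_zero, Nat.cast_zero, zero_mul]

theorem fullDualRep_apply {M : Type*} [AddCommGroup M] [Module ℂ M]
    (ρ : sl2 →ₗ⁅ℂ⁆ Module.End ℂ M) (x : sl2) (f : Module.Dual ℂ M) (m : M) :
    fullDualRep ρ x f m = f (ρ (sl2Transpose x) m) := rfl

theorem sl2Transpose_E : sl2Transpose sl2E = sl2F := by
  apply Subtype.ext
  ext i j
  fin_cases i <;> fin_cases j <;> rfl

theorem sl2Transpose_H : sl2Transpose sl2H = sl2H := by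
  apply Subtype.ext
  ext i j
  fin_cases i <;> fin_cases j <;> rfl

theorem sl2Transpose_sl2Transpose (x : sl2) : sl2Transpose (sl2Transpose x) = x := by
  apply Subtype.ext
  exact Matrix.transpose_transpose _

/-- The action of the enveloping algebra on the full dual of the Fock space. -/
def dualFockAction (l : ℂ) :
    UniversalEnvelopingAlgebra ℂ sl2 →ₐ[ℂ] Module.End ℂ (Module.Dual ℂ Fock) :=
  UniversalEnvelopingAlgebra.lift ℂ (fullDualRep (stdRep l))

theorem dualFockAction_ι (l : ℂ) (x : sl2) :
    dualFockAction l (UniversalEnvelopingAlgebra.ι ℂ x) = fullDualRep (stdRep l) x :=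
  UniversalEnvelopingAlgebra.lift_ι_apply ℂ _ x

/-- The vacuum functional is a highest weight vector of weight 0: through transposition $E$ acts by
precomposition with $T$ and $H$ by precomposition with $-2\deg$, and the images of both have no
constant term. -/
theorem dualFockAction_vermaIdeal (l : ℂ) {u : UniversalEnvelopingAlgebra ℂ sl2}
    (hu : u ∈ vermaIdeal 0) : dualFockAction l u vacuumFunctional = 0 := by
  induction hu using Submodule.span_induction with
  | mem u hu =>
    rcases hu with rfl | rfl
    · rw [dualFockAction_ι]
      ext1 s
      apply LinearMap.ext_ring
      simp only [LinearMap.comp_apply]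
      rw [fullDualRep_apply, sl2Transpose_E, stdRep_F, vacuumFunctional_apply,
        constantCoeff_transDer]
      rfl
    · rw [map_zero, sub_zero, dualFockAction_ι]
      ext1 s
      apply LinearMap.ext_ring
      simp only [LinearMap.comp_apply]
      rw [fullDualRep_apply, sl2Transpose_H, stdRep_H, vacuumFunctional_apply, constantCoeff_smul,
        constantCoeff_degDer, smul_zero]
      rfl
  | zero => rw [map_zero]; rfl
  | add u u' _ _ hu hu' => rw [map_add, LinearMap.add_apply, hu, hu', add_zero]
  | smul a u _ hu => rw [smul_eq_mul, map_mul, Module.End.mul_apply, hu, map_zero]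

/-- The homomorphism from `M(0)` to the full dual of the Fock space that maps the highest weight
vector to the projection to the vacuum component. -/
def vermaToDual (l : ℂ) : Verma 0 →ₗ[ℂ] Module.Dual ℂ Fock :=
  (((vermaIdeal 0).restrictScalars ℂ).liftQ
    ((LinearMap.applyₗ vacuumFunctional).comp (dualFockAction l).toLinearMap)
    (fun _ hu => dualFockAction_vermaIdeal l hu)).comp
  (Submodule.Quotient.restrictScalarsEquiv ℂ (vermaIdeal 0)).symm.toLinearMap

/-- The class of an element of the enveloping algebra in the Verma module. -/
def vermaMk (u : UniversalEnvelopingAlgebra ℂ sl2) : Verma 0 := Submodule.Quotient.mk u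

theorem vermaMk_surjective : Function.Surjective vermaMk := Submodule.Quotient.mk_surjective _

theorem vermaToDual_mk (l : ℂ) (u : UniversalEnvelopingAlgebra ℂ sl2) :
    vermaToDual l (vermaMk u) = dualFockAction l u vacuumFunctional := rfl

theorem vermaRep_mk (x : sl2) (u : UniversalEnvelopingAlgebra ℂ sl2) :
    vermaRep 0 x (vermaMk u) = vermaMk (UniversalEnvelopingAlgebra.ι ℂ x * u) := rfl

theorem vermaToDual_vermaRep (l : ℂ) (x : sl2) (m : Verma 0) :
    vermaToDual l (vermaRep 0 x m) = fullDualRep (stdRep l) x (vermaToDual l m) := by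
  obtain ⟨u, rfl⟩ := vermaMk_surjective m
  rw [vermaRep_mk, vermaToDual_mk, vermaToDual_mk, map_mul, Module.End.mul_apply, dualFockAction_ι]

/-- The homomorphism from the Fock space to the full dual of `M(0)`. -/
def fockToDual (l : ℂ) : Fock →ₗ[ℂ] Module.Dual ℂ (Verma 0) := (vermaToDual l).flip

theorem fockToDual_stdRep (l : ℂ) (x : sl2) (p : Fock) :
    fockToDual l (stdRep l x p) = fullDualRep (vermaRep 0) x (fockToDual l p) := by
  apply LinearMap.ext
  intro m
  change vermaToDual l m (stdRep l x p) = vermaToDual l (vermaRep 0 (sl2Transpose x) m) p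
  rw [vermaToDual_vermaRep, fullDualRep_apply, sl2Transpose_sl2Transpose]

theorem fockToDual_mem_restrictedDual (l : ℂ) (p : Fock) :
    fockToDual l p ∈ restrictedDual (vermaRep 0) := by
  rw [eq_sum_smul_monomial p, map_sum]
  refine Submodule.sum_mem _ fun s _ => ?_
  rw [map_smul]
  refine Submodule.smul_mem _ _ (Submodule.mem_iSup_of_mem ((-2 : ℂ) * confWt s) ?_)
  rw [Module.End.mem_eigenspace_iff, ← fockToDual_stdRep, stdRep_H, degDer_monomial, smul_smul,
    map_smul]

/-- The vectors `F^n m₀` of the Verma module. -/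
def vermaVec (n : ℕ) : Verma 0 := vermaMk (UniversalEnvelopingAlgebra.ι ℂ sl2F ^ n)

theorem vermaRep_F_vec (n : ℕ) : vermaRep 0 sl2F (vermaVec n) = vermaVec (n + 1) := by
  rw [vermaVec, vermaRep_mk, ← pow_succ', vermaVec]

theorem vermaRep_lie (x y : sl2) (m : Verma 0) :
    vermaRep 0 x (vermaRep 0 y m) = vermaRep 0 y (vermaRep 0 x m) + vermaRep 0 ⁅x, y⁆ m := by
  rw [LieHom.map_lie, Ring.lie_def, LinearMap.sub_apply, Module.End.mul_apply,
    Module.End.mul_apply]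
  abel

theorem vermaRep_H_vec (n : ℕ) : vermaRep 0 sl2H (vermaVec n) = (-2 * n : ℂ) • vermaVec n := by
  induction n with
  | zero =>
    rw [vermaVec, vermaRep_mk, pow_zero, mul_one, Nat.cast_zero, mul_zero, zero_smul]
    refine (Submodule.Quotient.mk_eq_zero _).2 (Submodule.subset_span ?_)
    simp
  | succ n ih =>
    rw [← vermaRep_F_vec, vermaRep_lie, ih, lie_H_F, map_smul, map_smul, LinearMap.smul_apply,
      ← add_smul]
    congr 1
    push_cast
    ring

theorem vermaRep_E_vec_zero : vermaRep 0 sl2E (vermaVec 0) = 0 := by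
  rw [vermaVec, vermaRep_mk, pow_zero, mul_one]
  refine (Submodule.Quotient.mk_eq_zero _).2 (Submodule.subset_span ?_)
  simp

theorem exists_vermaRep_E_vec (n : ℕ) :
    ∃ c : ℂ, vermaRep 0 sl2E (vermaVec (n + 1)) = c • vermaVec n := by
  induction n with
  | zero =>
    refine ⟨-2 * (0 : ℕ), ?_⟩
    rw [← vermaRep_F_vec, vermaRep_lie, vermaRep_E_vec_zero, map_zero, zero_add, lie_E_F,
      vermaRep_H_vec]
  | succ n ih =>
    obtain ⟨c, hc⟩ := ih
    refine ⟨c + -2 * (n + 1 : ℕ), ?_⟩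
    rw [← vermaRep_F_vec, vermaRep_lie, hc, map_smul, vermaRep_F_vec, lie_E_F, vermaRep_H_vec,
      add_smul]

/-- The span is stable under $sl_2$. The elements of the enveloping algebra preserving it form a
subalgebra containing $sl_2$; by the universal property the identity factors through this
subalgebra, so it is everything. -/
theorem span_vermaVec : Submodule.span ℂ (Set.range vermaVec) = ⊤ := by
  set Q := Submodule.span ℂ (Set.range vermaVec)
  have hstab : ∀ (x : sl2) (m : Verma 0), m ∈ Q → vermaRep 0 x m ∈ Q := by
    intro x m hm
    induction hm using Submodule.span_induction with
    | mem m hm =>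
      obtain ⟨n, rfl⟩ := hm
      rw [rep_apply_eq]
      refine add_mem (add_mem (Q.smul_mem _ ?_) (Q.smul_mem _ ?_)) (Q.smul_mem _ ?_)
      · cases n with
        | zero => rw [vermaRep_E_vec_zero]; exact zero_mem _
        | succ n =>
          obtain ⟨c, hc⟩ := exists_vermaRep_E_vec n
          rw [hc]
          exact Q.smul_mem _ (Submodule.subset_span ⟨n, rfl⟩)
      · rw [vermaRep_H_vec]
        exact Q.smul_mem _ (Submodule.subset_span ⟨n, rfl⟩)
      · rw [vermaRep_F_vec]
        exact Submodule.subset_span ⟨n + 1, rfl⟩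
    | zero => rw [map_zero]; exact zero_mem _
    | add m m' _ _ hm hm' => rw [map_add]; exact add_mem hm hm'
    | smul c m _ hm => rw [map_smul]; exact Q.smul_mem _ hm
  let A : Subalgebra ℂ (UniversalEnvelopingAlgebra ℂ sl2) :=
    { carrier := {u | ∀ m ∈ Q, u • m ∈ Q}
      mul_mem' := fun {a b} ha hb m hm => by rw [mul_smul]; exact ha _ (hb m hm)
      add_mem' := fun {a b} ha hb m hm => by rw [add_smul]; exact add_mem (ha m hm) (hb m hm)
      algebraMap_mem' := fun c m hm => by rw [algebraMap_smul]; exact Q.smul_mem _ hm }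
  let ιA : sl2 →ₗ⁅ℂ⁆ A :=
    { toFun := fun x => ⟨UniversalEnvelopingAlgebra.ι ℂ x, fun m hm => hstab x m hm⟩
      map_add' := fun x y => Subtype.ext (map_add _ _ _)
      map_smul' := fun c x => Subtype.ext (map_smul _ _ _)
      map_lie' := fun {x y} => Subtype.ext (LieHom.map_lie _ _ _) }
  have hA : A.val.comp (UniversalEnvelopingAlgebra.lift ℂ ιA) = AlgHom.id ℂ _ := by
    apply UniversalEnvelopingAlgebra.hom_ext
    apply LieHom.ext
    intro x
    simp [ιA]
  rw [eq_top_iff]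
  intro m _
  obtain ⟨u, rfl⟩ := vermaMk_surjective m
  have hu : u ∈ A := by
    have := congrArg (fun φ => φ u) hA
    simp only [AlgHom.comp_apply, AlgHom.id_apply] at this
    rw [← this]
    exact Subtype.property _
  have := hu (vermaVec 0) (Submodule.subset_span ⟨0, rfl⟩)
  rw [vermaVec, pow_zero] at this
  have h1 : u • vermaMk 1 = vermaMk u := congrArg vermaMk (mul_one u)
  rwa [h1] at this

/-- Each $F$ on the Verma side moves to the Fock side as its transpose $E=-L_1$. -/
theorem fockToDual_vermaVec (l : ℂ) (p : Fock) (n : ℕ) :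
    fockToDual l p (vermaVec n) =
      (-1) ^ n * constantCoeff (((lowDer l : Module.End ℂ Fock) ^ n) p) := by
  induction n generalizing p with
  | zero =>
    change vermaToDual l (vermaVec 0) p = _
    rw [vermaVec, vermaToDual_mk, pow_zero, pow_zero, pow_zero, map_one, Module.End.one_apply,
      vacuumFunctional_apply, Module.End.one_apply, one_mul]
  | succ n ih =>
    have h := congrArg (fun f => f (vermaVec n)) (fockToDual_stdRep l sl2E p)
    simp only [fullDualRep_apply, sl2Transpose_E] at h
    rw [← vermaRep_F_vec, ← h, stdRep_E, map_neg, LinearMap.neg_apply, ih, pow_succ, pow_succ,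
      Module.End.mul_apply, Derivation.coeFn_coe]
    ring

/-- The basis `1, x₁, x₂, …` of the submodule generated by `x₁`. -/
def linVec : ℕ → Fock
  | 0 => 1
  | k + 1 => X k

/-- $L_1$ sends each vector of the sequence $1,x_1,x_2,\dots$ to a nonzero multiple of its
predecessor, and $1$ to zero. The hypothesis $l\ne0$ is needed only for the step from $x_1$ to $1$.
-/
theorem fockToDual_linVec {l : ℂ} (hl : l ≠ 0) (k : ℕ) :
    fockToDual l (linVec k) (vermaVec k) ≠ 0 ∧
      ∀ n, n ≠ k → fockToDual l (linVec k) (vermaVec n) = 0 := by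
  have hone : ∀ n, ((lowDer l : Module.End ℂ Fock) ^ (n + 1)) 1 = 0 := fun n => by
    rw [pow_succ, Module.End.mul_apply, Derivation.coeFn_coe, Derivation.map_one_eq_zero, map_zero]
  have key : ∀ k : ℕ, constantCoeff (((lowDer l : Module.End ℂ Fock) ^ k) (linVec k)) ≠ 0 ∧
      ∀ n, n ≠ k → constantCoeff (((lowDer l : Module.End ℂ Fock) ^ n) (linVec k)) = 0 := by
    intro k
    induction k with
    | zero =>
      refine ⟨by simp [linVec], fun n hn => ?_⟩
      obtain ⟨n, rfl⟩ := Nat.exists_eq_succ_of_ne_zero hn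
      rw [linVec, hone, map_zero]
    | succ k ih =>
      have hstep : ∃ c : ℂ, c ≠ 0 ∧ lowDer l (linVec (k + 1)) = c • linVec k := by
        cases k with
        | zero =>
          refine ⟨-2 * l, mul_ne_zero (by norm_num) hl, ?_⟩
          change lowDer l (X 0) = (-2 * l) • (1 : Fock)
          rw [lowDer_X_zero, C_eq_smul_one]
        | succ k =>
          refine ⟨(k : ℂ) + 2, by exact_mod_cast (k + 1).succ_ne_zero, ?_⟩
          rw [linVec, lowDer_X_succ, linVec]
      obtain ⟨c, hc, hstep⟩ := hstep
      refine ⟨?_, fun n hn => ?_⟩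
      · rw [pow_succ, Module.End.mul_apply, Derivation.coeFn_coe, hstep, map_smul,
          constantCoeff_smul]
        exact smul_ne_zero hc ih.1
      · cases n with
        | zero => simp [linVec]
        | succ n =>
          rw [pow_succ, Module.End.mul_apply, Derivation.coeFn_coe, hstep, map_smul,
            constantCoeff_smul, ih.2 n (by omega), smul_zero]
  refine ⟨?_, fun n hn => ?_⟩
  · rw [fockToDual_vermaVec]
    exact mul_ne_zero (pow_ne_zero _ (by norm_num)) (key k).1
  · rw [fockToDual_vermaVec, (key k).2 n hn, mul_zero]

theorem fockToDual_injOn {l : ℂ} (hl : l ≠ 0) {p : Fock}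
    (hp : p ∈ Submodule.span ℂ (Set.range linVec)) (h0 : fockToDual l p = 0) : p = 0 := by
  obtain ⟨c, rfl⟩ := Finsupp.mem_span_range_iff_exists_finsupp.1 hp
  have hc : c = 0 := by
    ext n
    have h := congrArg (fun f => f (vermaVec n)) h0
    simp only [Finsupp.sum, map_sum, map_smul, LinearMap.sum_apply, LinearMap.smul_apply,
      LinearMap.zero_apply] at h
    rw [Finset.sum_eq_single n] at h
    · exact (mul_eq_zero.1 h).resolve_right (fockToDual_linVec hl n).1
    · intro k _ hk
      rw [(fockToDual_linVec hl k).2 n hk.symm, smul_zero]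
    · intro hn
      rw [Finsupp.notMem_support_iff.1 hn, zero_smul]
  rw [hc, Finsupp.sum_zero_index]

/-- The weights $-2n$ of the vectors $F^nm_0$ are distinct, so a weight functional is supported on
at most one of them and is a multiple of the functional dual to it. -/
theorem exists_fockToDual_eq {l : ℂ} (hl : l ≠ 0) {f : Module.Dual ℂ (Verma 0)}
    (hf : f ∈ restrictedDual (vermaRep 0)) :
    ∃ p ∈ Submodule.span ℂ (Set.range linVec), fockToDual l p = f := by
  change f ∈ (Submodule.span ℂ (Set.range linVec)).map (fockToDual l)
  refine (iSup_le fun μ g hg => ?_ : restrictedDual (vermaRep 0) ≤ _) hf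
  rw [Module.End.mem_eigenspace_iff] at hg
  have hw : ∀ n : ℕ, g (vermaVec n) ≠ 0 → μ = -2 * n := by
    intro n hn
    have h := congrArg (fun f => f (vermaVec n)) hg
    simp only [fullDualRep_apply, sl2Transpose_H, vermaRep_H_vec, map_smul, LinearMap.smul_apply,
      smul_eq_mul] at h
    exact (mul_right_cancel₀ hn h).symm
  by_cases hex : ∃ n, g (vermaVec n) ≠ 0
  · obtain ⟨n, hn⟩ := hex
    obtain ⟨h1, h2⟩ := fockToDual_linVec hl n
    refine ⟨(g (vermaVec n) / fockToDual l (linVec n) (vermaVec n)) • linVec n,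
      Submodule.smul_mem _ _ (Submodule.subset_span ⟨n, rfl⟩), ?_⟩
    refine LinearMap.ext_on_range span_vermaVec fun k => ?_
    rw [map_smul, LinearMap.smul_apply, smul_eq_mul]
    by_cases hk : k = n
    · subst hk
      exact div_mul_cancel₀ _ h1
    · rw [h2 k hk, mul_zero]
      by_contra hne
      have h3 := hw k (Ne.symm hne)
      rw [hw n hn] at h3
      have h4 : (n : ℂ) = k := by linear_combination (-1 / 2 : ℂ) * h3
      exact hk (by exact_mod_cast h4.symm)
  · push Not at hex
    have : g = 0 := LinearMap.ext_on_range span_vermaVec fun k => by rw [hex k]; rfl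
    rw [this]
    exact zero_mem _

/-- The homomorphism from the Fock space to the dual Verma module. -/
def fockToDualVerma (l : ℂ) : RepModule (stdRep l) →ₗ⁅ℂ, sl2⁆ DualVerma 0 :=
  { ((RepModule.of (dualRep (vermaRep 0))).toLinearMap.comp
      ((fockToDual l).codRestrict _ (fockToDual_mem_restrictedDual l))).comp
      (RepModule.of (stdRep l)).symm.toLinearMap with
    map_lie' := by
      intro x m
      obtain ⟨p, rfl⟩ := (RepModule.of (stdRep l)).surjective m
      exact congrArg (RepModule.of (dualRep (vermaRep 0)))
        (Subtype.ext (fockToDual_stdRep l x p)) }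

theorem fockToDualVerma_of (l : ℂ) (p : Fock) : fockToDualVerma l (RepModule.of (stdRep l) p) =
    RepModule.of (dualRep (vermaRep 0)) ⟨fockToDual l p, fockToDual_mem_restrictedDual l p⟩ := rfl

/-! ### The submodule generated by $x_1$ and its identification with the dual Verma module. -/

theorem linVec_mem_of_mem {l t : ℂ} (hl : l ≠ 0)
    (K : LieSubmodule ℂ sl2 (RepModule (stdRep l)))
    (hK : RepModule.of (stdRep l) (X 0 + C t) ∈ K) (n : ℕ) :
    RepModule.of (stdRep l) (linVec n) ∈ K := by
  have hX : RepModule.of (stdRep l) (X 0) ∈ K := by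
    -- $H$ kills the constant and has eigenvalue $-2$ on $x_1$, so $-\frac12H$ isolates $x_1$.
    have h := K.smul_mem (-1 / 2 : ℂ) (LieSubmodule_rep_mem K sl2H hK)
    rw [stdRep_H, map_add, derivation_C, add_zero, degDer_X, ← map_smul, smul_smul] at h
    norm_num at h
    exact h
  have hT : ∀ k : ℕ, RepModule.of (stdRep l) (X k) ∈ K := by
    intro k
    induction k with
    | zero => exact hX
    | succ k ih =>
      have h := K.smul_mem ((k : ℂ) + 1)⁻¹ (LieSubmodule_rep_mem K sl2F ih)
      rwa [stdRep_F, transDer_X, ← map_smul, inv_smul_smul₀ (Nat.cast_add_one_ne_zero k)] at h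
  cases n with
  | zero =>
    have h := K.smul_mem (2 * l)⁻¹ (LieSubmodule_rep_mem K sl2E hX)
    rw [stdRep_E, lowDer_X_zero, ← map_smul, ← C_neg, C_eq_smul_one, smul_smul,
      show (2 * l)⁻¹ * -(-2 * l) = 1 by field_simp, one_smul] at h
    exact h
  | succ n => exact hT n

theorem add_C_mem_span_linVec (t : ℂ) :
    X 0 + C t ∈ Submodule.span ℂ (Set.range linVec) := by
  rw [C_eq_smul_one]
  exact add_mem (Submodule.subset_span ⟨1, rfl⟩)
    (Submodule.smul_mem _ _ (Submodule.subset_span ⟨0, rfl⟩))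

/-- The submodule spanned by `1, x₁, x₂, …`. -/
def linSubmodule (l : ℂ) : LieSubmodule ℂ sl2 (RepModule (stdRep l)) :=
  lieSubmoduleOf (stdRep l) (Submodule.span ℂ (Set.range linVec))
    (fun m hm => by
      rw [stdRep_E]
      refine neg_mem (map_mem_span_range (lowDer l) (fun n => ?_) hm)
      match n with
      | 0 => rw [linVec, Derivation.map_one_eq_zero]; exact zero_mem _
      | 1 =>
        rw [linVec, lowDer_X_zero, C_eq_smul_one]
        exact Submodule.smul_mem _ _ (Submodule.subset_span ⟨0, rfl⟩)
      | n + 2 =>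
        rw [linVec, lowDer_X_succ]
        exact Submodule.smul_mem _ _ (Submodule.subset_span ⟨n + 1, rfl⟩))
    (fun m hm => by
      rw [stdRep_H]
      refine Submodule.smul_mem _ _ (map_mem_span_range degDer (fun n => ?_) hm)
      cases n with
      | zero => rw [linVec, Derivation.map_one_eq_zero]; exact zero_mem _
      | succ n =>
        rw [linVec, degDer_X]
        exact Submodule.smul_mem _ _ (Submodule.subset_span ⟨n + 1, rfl⟩))
    (fun m hm => by
      rw [stdRep_F]
      refine map_mem_span_range transDer (fun n => ?_) hm
      cases n with
      | zero => rw [linVec, Derivation.map_one_eq_zero]; exact zero_mem _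
      | succ n =>
        rw [linVec, transDer_X]
        exact Submodule.smul_mem _ _ (Submodule.subset_span ⟨n + 2, rfl⟩))

theorem fockToDualVerma_injOn {l : ℂ} (hl : l ≠ 0) {q q' : RepModule (stdRep l)}
    (hq : q ∈ linSubmodule l) (hq' : q' ∈ linSubmodule l)
    (h : fockToDualVerma l q = fockToDualVerma l q') : q = q' := by
  obtain ⟨r, rfl⟩ := (RepModule.of (stdRep l)).surjective q
  obtain ⟨r', rfl⟩ := (RepModule.of (stdRep l)).surjective q'
  rw [linSubmodule, mem_lieSubmoduleOf] at hq hq'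
  rw [fockToDualVerma_of, fockToDualVerma_of] at h
  have h1 := congrArg Subtype.val ((RepModule.of (dualRep (vermaRep 0))).injective h)
  rw [sub_eq_zero.1 (fockToDual_injOn hl (sub_mem hq hq')
    (by rw [map_sub]; exact sub_eq_zero.2 h1))]

/-- A bijective homomorphism of modules is an isomorphism. -/
def lieModuleEquivOfBijective {M N : Type*} [AddCommGroup M] [Module ℂ M] [LieRingModule sl2 M]
    [AddCommGroup N] [Module ℂ N] [LieRingModule sl2 N] (f : M →ₗ⁅ℂ, sl2⁆ N)
    (hf : Function.Bijective f) : M ≃ₗ⁅ℂ, sl2⁆ N :=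
  { LinearEquiv.ofBijective (f : M →ₗ[ℂ] N) hf with
    map_lie' := fun {x m} => f.map_lie x m }

/-- The constant `t` is allowed because undoing the shift turns $x_1$ into $x_1$ plus a constant.
Under `e` the generated submodule becomes `linSubmodule l`, where the pairing map is bijective. -/
theorem nonempty_equiv_dualVerma {l t : ℂ} (hl : l ≠ 0) {ρ : sl2 →ₗ⁅ℂ⁆ Module.End ℂ Fock}
    (e : RepModule ρ ≃ₗ⁅ℂ, sl2⁆ RepModule (stdRep l)) {p : RepModule ρ}
    (he : e p = RepModule.of (stdRep l) (X 0 + C t)) :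
    Nonempty (LieSubmodule.lieSpan ℂ sl2 {p} ≃ₗ⁅ℂ, sl2⁆ DualVerma 0) := by
  set S := LieSubmodule.lieSpan ℂ sl2 {p}
  have hS : ∀ q, q ∈ S ↔ e q ∈ linSubmodule l := by
    have hle : S ≤ (linSubmodule l).comap (e : RepModule ρ →ₗ⁅ℂ, sl2⁆ RepModule (stdRep l)) := by
      rw [LieSubmodule.lieSpan_le, Set.singleton_subset_iff]
      change e p ∈ linSubmodule l
      rw [he, linSubmodule, mem_lieSubmoduleOf]
      exact add_C_mem_span_linVec t
    refine fun q => ⟨fun hq => hle hq, fun hq => ?_⟩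
    set K := S.comap (e.symm : RepModule (stdRep l) →ₗ⁅ℂ, sl2⁆ RepModule ρ)
    have hK : RepModule.of (stdRep l) (X 0 + C t) ∈ K := by
      change e.symm _ ∈ S
      rw [← he, e.symm_apply_apply]
      exact LieSubmodule.subset_lieSpan rfl
    have hqK : e q ∈ K := by
      obtain ⟨r, hr⟩ := (RepModule.of (stdRep l)).surjective (e q)
      rw [← hr, linSubmodule, mem_lieSubmoduleOf, Finsupp.mem_span_range_iff_exists_finsupp] at hq
      obtain ⟨c, rfl⟩ := hq
      rw [← hr, Finsupp.sum, map_sum]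
      refine sum_mem fun i _ => ?_
      rw [map_smul]
      exact K.smul_mem _ (linVec_mem_of_mem hl K hK i)
    have : e.symm (e q) ∈ S := hqK
    rwa [e.symm_apply_apply] at this
  let f : S →ₗ⁅ℂ, sl2⁆ DualVerma 0 := ((fockToDualVerma l).comp
    (e : RepModule ρ →ₗ⁅ℂ, sl2⁆ RepModule (stdRep l))).comp S.incl
  have hf : ∀ q : S, f q = fockToDualVerma l (e q) := fun _ => rfl
  clear_value f
  refine ⟨lieModuleEquivOfBijective f ⟨fun q q' h => ?_, fun g => ?_⟩⟩
  · rw [hf, hf] at h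
    exact Subtype.ext (e.injective
      (fockToDualVerma_injOn hl ((hS q).1 q.2) ((hS q').1 q'.2) h))
  · obtain ⟨⟨f', hf'⟩, rfl⟩ := (RepModule.of (dualRep (vermaRep 0))).surjective g
    obtain ⟨r, hr, rfl⟩ := exists_fockToDual_eq hl hf'
    refine ⟨⟨e.symm (RepModule.of (stdRep l) r), ?_⟩, ?_⟩
    · rw [hS, e.apply_symm_apply, linSubmodule, mem_lieSubmoduleOf]
      exact hr
    · exact (hf _).trans ((congrArg _ (e.apply_symm_apply _)).trans (fockToDualVerma_of l r))

/-- The transport of a representation along a linear isomorphism. -/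
def conjRep (σ : Fock ≃ₗ[ℂ] Fock) (ρ : sl2 →ₗ⁅ℂ⁆ Module.End ℂ Fock) :
    sl2 →ₗ⁅ℂ⁆ Module.End ℂ Fock :=
  σ.lieConj.toLieHom.comp ρ

theorem conjRep_apply (σ : Fock ≃ₗ[ℂ] Fock) (ρ : sl2 →ₗ⁅ℂ⁆ Module.End ℂ Fock) (x : sl2)
    (p : Fock) : conjRep σ ρ x p = σ (ρ x (σ.symm p)) := rfl

/-- The representation attached to the conformal vector `σ (stdVec l)` is transported from
`stdRep l`. -/
theorem conjRep_stdRep {σ : Fock ≃ₗ[ℂ] Fock} (hσ : IsAutomorphism σ) (l : ℂ) :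
    conjRep σ (stdRep l) sl2E = -virasoroOp (σ (stdVec l)) 1 ∧
      conjRep σ (stdRep l) sl2H = (-2 : ℂ) • virasoroOp (σ (stdVec l)) 0 ∧
      conjRep σ (stdRep l) sl2F = virasoroOp (σ (stdVec l)) (-1) := by
  have hmode : ∀ (n : ℤ) (p : Fock),
      virasoroOp (σ (stdVec l)) n p = σ (mode (stdVec l) (n + 1) (σ.symm p)) := fun n p => by
    rw [hσ, σ.apply_symm_apply, virasoroOp]
  refine ⟨?_, ?_, ?_⟩ <;> refine LinearMap.ext fun p => ?_
  · rw [conjRep_apply, stdRep_E, LinearMap.neg_apply, hmode, one_add_one_eq_two, mode_stdVec_two,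
      map_neg, Derivation.coeFn_coe]
  · rw [conjRep_apply, stdRep_H, LinearMap.smul_apply, hmode, zero_add, mode_stdVec_one, map_smul,
      Derivation.coeFn_coe]
  · rw [conjRep_apply, stdRep_F, hmode, neg_add_cancel, mode_stdVec_zero, Derivation.coeFn_coe]

/-- A representation transported along `σ` is isomorphic to the original one. -/
def conjRepEquiv (σ : Fock ≃ₗ[ℂ] Fock) (ρ ρ' : sl2 →ₗ⁅ℂ⁆ Module.End ℂ Fock)
    (hE : ρ' sl2E = conjRep σ ρ sl2E) (hH : ρ' sl2H = conjRep σ ρ sl2H)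
    (hF : ρ' sl2F = conjRep σ ρ sl2F) : RepModule ρ' ≃ₗ⁅ℂ, sl2⁆ RepModule ρ :=
  repEquiv ρ' ρ σ.symm
    (fun m => by rw [hE, conjRep_apply, σ.symm_apply_apply])
    (fun m => by rw [hH, conjRep_apply, σ.symm_apply_apply])
    (fun m => by rw [hF, conjRep_apply, σ.symm_apply_apply])

theorem conjRepEquiv_of (σ : Fock ≃ₗ[ℂ] Fock) (ρ ρ' : sl2 →ₗ⁅ℂ⁆ Module.End ℂ Fock) (hE) (hH) (hF)
    (p : Fock) : conjRepEquiv σ ρ ρ' hE hH hF (RepModule.of ρ' p) =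
      RepModule.of ρ (σ.symm p) := rfl

theorem stdVec_zero : stdVec 0 = (1 / 2 : ℂ) • X 0 ^ 2 := by
  rw [stdVec, zero_smul, add_zero]

theorem shift_symm_X_zero (t : ℂ) : (shift t).toLinearEquiv.symm (X 0) = X 0 + C (-t) := by
  rw [LinearEquiv.symm_apply_eq]
  change X 0 = shift t (X 0 + C (-t))
  rw [map_add, shift_X, shift_C, if_pos rfl, add_assoc, ← C_add, add_neg_cancel, C_0, add_zero]

end FreeBoson

end

/-! ### Assembly of the theorem. -/

theorem mainTheorem7 (v : FreeBoson.Fock) (hv : FreeBoson.IsConformalVector v) :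
    ∃ ρ : FreeBoson.sl2 →ₗ⁅ℂ⁆ Module.End ℂ FreeBoson.Fock,
      ρ FreeBoson.sl2E = -FreeBoson.virasoroOp v 1 ∧
      ρ FreeBoson.sl2H = (-2 : ℂ) • FreeBoson.virasoroOp v 0 ∧
      ρ FreeBoson.sl2F = FreeBoson.virasoroOp v (-1) ∧
      (FreeBoson.IsCompletelyReducible ρ ↔
        ∃ σ : FreeBoson.Fock ≃ₗ[ℂ] FreeBoson.Fock, FreeBoson.IsInnerAutomorphism σ ∧
          σ ((1 / 2 : ℂ) • MvPolynomial.X 0 ^ 2) = v) ∧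
      (¬ FreeBoson.IsCompletelyReducible ρ →
        Nonempty (LieSubmodule.lieSpan ℂ FreeBoson.sl2
          {FreeBoson.RepModule.of ρ (MvPolynomial.X 0)} ≃ₗ⁅ℂ, FreeBoson.sl2⁆
            FreeBoson.DualVerma 0)) := by
  obtain ⟨t, l, hv⟩ := FreeBoson.exists_shift_stdVec_eq hv
  replace hv : (FreeBoson.shift t).toLinearEquiv (FreeBoson.stdVec l) = v := hv
  have hshift := FreeBoson.isInnerAutomorphism_shift t
  have hX := FreeBoson.shift_symm_X_zero t
  -- Of the shift only three facts remain in use: it is inner, it carries `stdVec l` to `v`, and its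
  -- inverse sends $x_1$ to $x_1-t$.
  generalize (FreeBoson.shift t).toLinearEquiv = σ at hv hshift hX
  obtain ⟨hE, hH, hF⟩ := FreeBoson.conjRep_stdRep hshift.1 l
  rw [hv] at hE hH hF
  have e := FreeBoson.conjRepEquiv_of σ (FreeBoson.stdRep l) (FreeBoson.conjRep σ
    (FreeBoson.stdRep l)) rfl rfl rfl
  generalize FreeBoson.conjRepEquiv σ (FreeBoson.stdRep l) (FreeBoson.conjRep σ
    (FreeBoson.stdRep l)) rfl rfl rfl = e' at e
  generalize FreeBoson.conjRep σ (FreeBoson.stdRep l) = ρ at hE hH hF e' e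
  have hCR := FreeBoson.isCompletelyReducible_iff_of_equiv e'
  refine ⟨ρ, hE, hH, hF, ⟨fun h => ⟨σ, hshift, ?_⟩, ?_⟩, fun h => ?_⟩
  · have hl : l = 0 := by
      by_contra hl
      exact FreeBoson.not_isCompletelyReducible_stdRep hl (hCR.1 h)
    rw [← hv, hl, FreeBoson.stdVec_zero]
  -- The given automorphism need not be a shift. Transporting `stdRep 0` along it yields the same
  -- operators for $E,H,F$ as `ρ`, because these depend only on `v`.
  · rintro ⟨τ, hτ, hτv⟩
    obtain ⟨hE', hH', hF'⟩ := FreeBoson.conjRep_stdRep hτ.1 0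
    rw [FreeBoson.stdVec_zero, hτv] at hE' hH' hF'
    exact (FreeBoson.isCompletelyReducible_iff_of_equiv (FreeBoson.conjRepEquiv τ
      (FreeBoson.stdRep 0) ρ (hE.trans hE'.symm) (hH.trans hH'.symm) (hF.trans hF'.symm))).2
      FreeBoson.isCompletelyReducible_stdRep_zero
  · refine FreeBoson.nonempty_equiv_dualVerma (t := -t) (l := l) (fun hl => h (hCR.2 ?_)) e' ?_
    · rw [hl]
      exact FreeBoson.isCompletelyReducible_stdRep_zero
    · rw [e, hX]
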